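/- Let $\lambda,\mu>0$, $q\neq 0$, $\rho\in\mathbb R$, let $\sigma^{+-},\sigma^{-+}:[0,1]\to\mathbb R$ be bounded and measurable, and consider the system on $[0,1]$ $$u_t+\lambda u_x=\sigma^{+-}(x)v,\qquad v_t-\mu v_x=\sigma^{-+}(x)u,\qquad u(t,0)=q\,v(t,0),\qquad v(t,1)=\rho\,u(t,1)+U(t),$$ with initial state $(u_0,v_0)\in L^2(0,1)^2$. Assume $|\rho q|<1$ and let $K\in\mathbb R$ satisfy $|K|<\frac{1-|\rho q|}{|q|}$. On $\mathcal T=\{(x,\xi): 0\le\xi\le x\le1\}$ consider the kernel equations $$\lambda K^{uu}_x+\lambda K^{uu}_\xi=-K^{uv}\sigma^{-+}(\xi),\qquad \lambda K^{uv}_x-\mu K^{uv}_\xi=-K^{uu}\sigma^{+-}(\xi),$$ $$\mu K^{vu}_x-\lambda K^{vu}_\xi=K^{vv}\sigma^{-+}(\xi),\qquad \mu K^{vv}_x+\mu K^{vv}_\xi=K^{vu}\sigma^{+-}(\xi),$$ $$K^{vu}(x,x)=-\tfrac{\sigma^{-+}(x)}{\lambda+\mu},\quad K^{vv}(x,0)=\tfrac{\lambda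 q}{\mu}K^{vu}(x,0),\quad K^{uv}(x,x)=\tfrac{\sigma^{+-}(x)}{\lambda+\mu},\quad K^{uv}(x,0)=\tfrac{\lambda q}{\mu}K^{uu}(x,0),$$ whose solutions are bounded measurable functions on $\mathcal T$ that satisfy the differential equations integrated along characteristics and the boundary conditions pointwise, and consider the control law $$U_{BS_2}(t)=-K u(t,1)-(\rho-K)\int_0^1\big(K^{uu}(1,\xi)u(t,\xi)+K^{uv}(1,\xi)v(t,\xi)\big)d\xi+\int_0^1\big(K^{vu}(1,\xi)u(t,\xi)+K^{vv}(1,\xi)v(t,\xi)\big)d\xi .$$ For a delay $\delta\ge0$ the closed loop is the system with $U(t)=U_{BS_2}(t-\delta)$ for $t\ge\delta$ and $U(t)=h(t-\delta)$ for $t<\delta$, where $h\in L^2(-\delta,0)$ is the past actuation; solutions are weak solutions, continuous in time with values in $L^2(0,1)^2$, with boundary traces in $L^2_{loc}$. The closed loop is called stable if for all $u_0,v_0,h$ a solution exists and there are $C,\omega>0$ (which may depend on $\delta$) such that all solutions satisfy $\|u(t)\|_{L^2}+\|v(t)\|_{L^2}\le Ce^{-\omega t}(\|u_0\|_{L^2}+\|v_0\|_{L^2}+\|h\|_{L^2})$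 for all $t\ge0$. Then the kernel equations have a solution, and for every solution: (i) $U_{BS_2}$ delay-robustly stabilizes the system: the closed loop is stable for $\delta=0$, and there is $\delta_0>0$ such that it is stable for every $\delta\in(0,\delta_0]$. (ii) The transformation $\alpha=u-\int_0^x(K^{uu}u+K^{uv}v)\,d\xi$, $\beta=v-\int_0^x(K^{vu}u+K^{vv}v)\,d\xi$ has an inverse of the form $u=\alpha+\int_0^x(L^{\alpha\alpha}\alpha+L^{\alpha\beta}\beta)\,d\xi$, $v=\beta+\int_0^x(L^{\beta\alpha}\alpha+L^{\beta\beta}\beta)\,d\xi$ with bounded measurable kernels on $\mathcal T$ (for integrable functions, at every $x\in[0,1]$). For any such kernels put $\tau=\frac1\lambda+\frac1\mu$, $N^\alpha(\xi)=L^{\beta\alpha}(1,\xi)-\rho L^{\alpha\alpha}(1,\xi)$, $N^\beta(\xi)=L^{\beta\beta}(1,\xi)-\rho L^{\alpha\beta}(1,\xi)$ and $$\tilde N(\nu)=q\lambda N^\alpha\big(\lambda\nu-\tfrac\lambda\mu\big)\mathbf 1_{[1/\mu,\tau]}(\nu)+\mu N^\beta(1-\mu\nu)\mathbf 1_{[0,1/\mu]}(\nu).$$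 Then there is $\delta_0>0$ such that for every $\delta\in[0,\delta_0]$ the characteristic function of the closed loop $$F(s)=1-q\rho e^{-\tau s}+Kq\,e^{-(\tau+\delta)s}+\int_0^\tau\tilde N(\xi)\big(e^{-\xi s}-e^{-(\xi+\delta)s}\big)d\xi$$ has no zero with $\operatorname{Re}s\ge0$. -/

import Mathlib

open MeasureTheory Set

noncomputable section

namespace Hyperbolic

/-- The data of the system
`u_t + lam u_x = sPM(x) v`, `v_t - mu v_x = sMP(x) u` on `[0,1]`,
`u(t,0) = q v(t,0)`, `v(t,1) = rho u(t,1) + U(t)`. -/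
structure HypSystem where
  lam : ℝ
  mu : ℝ
  q : ℝ
  rho : ℝ
  sPM : ℝ → ℝ
  sMP : ℝ → ℝ

/-- The characteristic time `1/lam + 1/mu`. -/
def HypSystem.tau (S : HypSystem) : ℝ := 1 / S.lam + 1 / S.mu

/-- The space `L²(0,1)`. -/
abbrev StateL2 : Type := Lp ℝ 2 (volume.restrict (Icc (0 : ℝ) 1))

/-- The space `L²(-δ,0)` of past actuation signals. -/
abbrev HistoryL2 (δ : ℝ) : Type := Lp ℝ 2 (volume.restrict (Icc (-δ) (0 : ℝ)))

/-- A (static) full-state feedback: it sends the boundary value `u(t,1)` and the profiles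
`u(t,·)`, `v(t,·)` to the value `U(t)`. -/
abbrev Feedback : Type := ℝ → StateL2 → StateL2 → ℝ

/-- The signal that acts at time `t` when the feedback `𝒦` is applied with delay `δ`:
`𝒦[(u,v)(t-δ)]` for `t ≥ δ`, and the past actuation `h(t-δ)` for `t < δ`.
Here `u1 t` stands for `u(t,1)`. -/
def delayedInput (𝒦 : Feedback) (δ : ℝ) (h : HistoryL2 δ) (u v : ℝ → StateL2) (u1 : ℝ → ℝ)
    (t : ℝ) : ℝ :=
  if t < δ then h (t - δ) else 𝒦 (u1 (t - δ)) (u (t - δ)) (v (t - δ))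

/-- Weak solutions of the closed loop with delay `δ`, initial state `(uInit, vInit)` in `L²(0,1)²`
and past actuation `h`. The state is a continuous curve in `L²(0,1)²`; the functions
`u0, u1, v0, v1`, locally square integrable in time, are the boundary traces
`u(t,0), u(t,1), v(t,0), v(t,1)`, singled out by the boundary terms of the weak formulation. -/
structure IsClosedLoopSolution (S : HypSystem) (𝒦 : Feedback) (δ : ℝ) (uInit vInit : StateL2)
    (h : HistoryL2 δ) (u v : ℝ → StateL2) (u0 u1 v0 v1 : ℝ → ℝ) : Prop where
  continuousOn_u : ContinuousOn u (Ici 0)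
  continuousOn_v : ContinuousOn v (Ici 0)
  init_u : u 0 = uInit
  init_v : v 0 = vInit
  trace_u0 : ∀ T : ℝ, MemLp u0 2 (volume.restrict (Icc 0 T))
  trace_u1 : ∀ T : ℝ, MemLp u1 2 (volume.restrict (Icc 0 T))
  trace_v0 : ∀ T : ℝ, MemLp v0 2 (volume.restrict (Icc 0 T))
  trace_v1 : ∀ T : ℝ, MemLp v1 2 (volume.restrict (Icc 0 T))
  weak_u : ∀ φ : ℝ → ℝ, ContDiff ℝ 1 φ → ∀ t : ℝ, 0 ≤ t →
    (∫ x in Icc (0 : ℝ) 1, u t x * φ x) - (∫ x in Icc (0 : ℝ) 1, uInit x * φ x) =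
      ∫ s in (0 : ℝ)..t,
        ((∫ x in Icc (0 : ℝ) 1, (S.lam * u s x * deriv φ x + S.sPM x * v s x * φ x))
          + S.lam * (u0 s * φ 0 - u1 s * φ 1))
  weak_v : ∀ φ : ℝ → ℝ, ContDiff ℝ 1 φ → ∀ t : ℝ, 0 ≤ t →
    (∫ x in Icc (0 : ℝ) 1, v t x * φ x) - (∫ x in Icc (0 : ℝ) 1, vInit x * φ x) =
      ∫ s in (0 : ℝ)..t,
        ((∫ x in Icc (0 : ℝ) 1, (-(S.mu * v s x * deriv φ x) + S.sMP x * u s x * φ x))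
          + S.mu * (v1 s * φ 1 - v0 s * φ 0))
  boundary_zero : ∀ᵐ t ∂(volume.restrict (Ici (0 : ℝ))), u0 t = S.q * v0 t
  boundary_one : ∀ᵐ t ∂(volume.restrict (Ici (0 : ℝ))),
    v1 t = S.rho * u1 t + delayedInput 𝒦 δ h u v u1 t

/-- The closed loop with delay `δ` is (exponentially) stable in the sense of the `L²` norm: every
initial state and every past actuation admit a solution, and all solutions decay exponentially,
with constants that do not depend on the data. -/
def StableWithDelay (S : HypSystem) (𝒦 : Feedback) (δ : ℝ) : Prop :=
  (∀ (uInit vInit : StateL2) (h : HistoryL2 δ), ∃ (u v : ℝ → StateL2) (u0 u1 v0 v1 : ℝ → ℝ),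
    IsClosedLoopSolution S 𝒦 δ uInit vInit h u v u0 u1 v0 v1) ∧
  ∃ C ω : ℝ, 0 < C ∧ 0 < ω ∧
    ∀ (uInit vInit : StateL2) (h : HistoryL2 δ) (u v : ℝ → StateL2) (u0 u1 v0 v1 : ℝ → ℝ),
      IsClosedLoopSolution S 𝒦 δ uInit vInit h u v u0 u1 v0 v1 →
      ∀ t : ℝ, 0 ≤ t →
        ‖u t‖ + ‖v t‖ ≤ C * Real.exp (-ω * t) * (‖uInit‖ + ‖vInit‖ + ‖h‖)

/-- Delay-robust stabilization: the undelayed closed loop is stable, and so is the closed loop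
with any sufficiently small delay. -/
def DelayRobustlyStabilizes (S : HypSystem) (𝒦 : Feedback) : Prop :=
  StableWithDelay S 𝒦 0 ∧
  ∃ δ₀ : ℝ, 0 < δ₀ ∧ ∀ δ : ℝ, 0 < δ → δ ≤ δ₀ → StableWithDelay S 𝒦 δ

/-- The triangle `0 ≤ ξ ≤ x ≤ 1`, with points `(x, ξ)`. -/
def triangle : Set (ℝ × ℝ) := {p | 0 ≤ p.2 ∧ p.2 ≤ p.1 ∧ p.1 ≤ 1}

/-- Four Volterra kernels (only their values on the triangle matter). -/
structure Kernels where
  uu : ℝ → ℝ → ℝ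
  uv : ℝ → ℝ → ℝ
  vu : ℝ → ℝ → ℝ
  vv : ℝ → ℝ → ℝ

/-- Borel measurable and bounded on the triangle. -/
def BddMeasKernel (f : ℝ → ℝ → ℝ) : Prop :=
  Measurable (fun p : triangle => f p.1.1 p.1.2) ∧
  ∃ M : ℝ, ∀ p ∈ triangle, |f p.1 p.2| ≤ M

/-- All four kernels are bounded and measurable on the triangle. -/
def Kernels.BddMeas (k : Kernels) : Prop :=
  BddMeasKernel k.uu ∧ BddMeasKernel k.uv ∧ BddMeasKernel k.vu ∧ BddMeasKernel k.vv

/-- `a f_x + b f_ξ = g` on the triangle, in the sense of characteristics: along every segment of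
direction `(a, b)` in the triangle, `f` is a primitive of `g`. -/
def SolvesTransport (a b : ℝ) (f g : ℝ → ℝ → ℝ) : Prop :=
  ∀ x ξ r : ℝ, 0 ≤ r → (x, ξ) ∈ triangle → (x + a * r, ξ + b * r) ∈ triangle →
    f (x + a * r) (ξ + b * r) = f x ξ + ∫ s in (0 : ℝ)..r, g (x + a * s) (ξ + b * s)

/-- `k` is a bounded solution of the backstepping kernel equations. -/
structure IsBacksteppingKernel (S : HypSystem) (k : Kernels) : Prop where
  bddMeas : k.BddMeas
  eq_uu : SolvesTransport S.lam S.lam k.uu (fun x ξ => -(k.uv x ξ * S.sMP ξ))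
  eq_uv : SolvesTransport S.lam (-S.mu) k.uv (fun x ξ => -(k.uu x ξ * S.sPM ξ))
  eq_vu : SolvesTransport S.mu (-S.lam) k.vu (fun x ξ => k.vv x ξ * S.sMP ξ)
  eq_vv : SolvesTransport S.mu S.mu k.vv (fun x ξ => k.vu x ξ * S.sPM ξ)
  diag_vu : ∀ x ∈ Icc (0 : ℝ) 1, k.vu x x = -(S.sMP x / (S.lam + S.mu))
  bottom_vv : ∀ x ∈ Icc (0 : ℝ) 1, k.vv x 0 = S.lam * S.q / S.mu * k.vu x 0
  diag_uv : ∀ x ∈ Icc (0 : ℝ) 1, k.uv x x = S.sPM x / (S.lam + S.mu)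
  bottom_uv : ∀ x ∈ Icc (0 : ℝ) 1, k.uv x 0 = S.lam * S.q / S.mu * k.uu x 0

/-- The modified backstepping control law with tuning gain `K`. -/
def controlBS2 (S : HypSystem) (k : Kernels) (K : ℝ) : Feedback := fun u1 u v =>
  -K * u1
    - (S.rho - K) * (∫ ξ in Icc (0 : ℝ) 1, (k.uu 1 ξ * u ξ + k.uv 1 ξ * v ξ))
    + ∫ ξ in Icc (0 : ℝ) 1, (k.vu 1 ξ * u ξ + k.vv 1 ξ * v ξ)

/-- First component of the Volterra operator with kernels `k`. -/
def Kernels.fst (k : Kernels) (f g : ℝ → ℝ) (x : ℝ) : ℝ :=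
  ∫ ξ in (0 : ℝ)..x, (k.uu x ξ * f ξ + k.uv x ξ * g ξ)

/-- Second component of the Volterra operator with kernels `k`. -/
def Kernels.snd (k : Kernels) (f g : ℝ → ℝ) (x : ℝ) : ℝ :=
  ∫ ξ in (0 : ℝ)..x, (k.vu x ξ * f ξ + k.vv x ξ * g ξ)

/-- The transformation `(α, β) ↦ (α + l.fst α β, β + l.snd α β)` with the bounded kernels
`l = (L^{αα}, L^{αβ}, L^{βα}, L^{ββ})` is the two-sided inverse of the backstepping transformation
`(u, v) ↦ (u - k.fst u v, v - k.snd u v)`, at every point of `[0,1]`. -/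
structure IsInverseKernel (k l : Kernels) : Prop where
  bddMeas : l.BddMeas
  right_inv : ∀ α β : ℝ → ℝ, IntegrableOn α (Icc 0 1) → IntegrableOn β (Icc 0 1) →
    ∀ x ∈ Icc (0 : ℝ) 1,
      (α x + l.fst α β x) - k.fst (fun y => α y + l.fst α β y) (fun y => β y + l.snd α β y) x
        = α x ∧
      (β x + l.snd α β x) - k.snd (fun y => α y + l.fst α β y) (fun y => β y + l.snd α β y) x
        = β x
  left_inv : ∀ u v : ℝ → ℝ, IntegrableOn u (Icc 0 1) → IntegrableOn v (Icc 0 1) →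
    ∀ x ∈ Icc (0 : ℝ) 1,
      (u x - k.fst u v x) + l.fst (fun y => u y - k.fst u v y) (fun y => v y - k.snd u v y) x
        = u x ∧
      (v x - k.snd u v x) + l.snd (fun y => u y - k.fst u v y) (fun y => v y - k.snd u v y) x
        = v x

/-- `N^α(ξ) = L^{βα}(1,ξ) - ρ L^{αα}(1,ξ)`. -/
def Nalpha (S : HypSystem) (l : Kernels) (ξ : ℝ) : ℝ := l.vu 1 ξ - S.rho * l.uu 1 ξ

/-- `N^β(ξ) = L^{ββ}(1,ξ) - ρ L^{αβ}(1,ξ)`. -/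
def Nbeta (S : HypSystem) (l : Kernels) (ξ : ℝ) : ℝ := l.vv 1 ξ - S.rho * l.uv 1 ξ

/-- The distributed-delay kernel on `[0, τ]`. -/
def Ntilde (S : HypSystem) (l : Kernels) : ℝ → ℝ := fun ν =>
  (Icc (1 / S.mu) S.tau).indicator
      (fun ν => S.q * S.lam * Nalpha S l (S.lam * ν - S.lam / S.mu)) ν
    + (Icc 0 (1 / S.mu)).indicator (fun ν => S.mu * Nbeta S l (1 - S.mu * ν)) ν

/-- The characteristic function of the closed loop formed with `controlBS2 S k K` and a delay `δ`,
where `l` is the inverse kernel of `k`. -/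
def charFun (S : HypSystem) (l : Kernels) (K δ : ℝ) (s : ℂ) : ℂ :=
  1 - (S.q * S.rho : ℂ) * Complex.exp (-(S.tau * s))
    + (K * S.q : ℂ) * Complex.exp (-((S.tau + δ) * s))
    + ∫ ξ in (0 : ℝ)..S.tau,
        (Ntilde S l ξ : ℂ) * (Complex.exp (-(ξ * s)) - Complex.exp (-((ξ + δ) * s)))

end Hyperbolic

end

/-!
# Delay-robust stabilization of a pair of linear hyperbolic equations

**The kernels.** The four kernel equations split into two pairs. In each pair, one kernel is
transported along a direction that issues from the diagonal, where its values are prescribed, and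
the other one along `(1, 1)` from the side `ξ = 0`, where its values are proportional to those of
the first. Integrated along characteristics, a pair is a fixed point equation that contracts the
supremum norm with weight `exp (γ x)` for large `γ` (`exists_transport_pair`). The same weight gives
the resolvent of a Volterra operator, hence the inverse transformation (`exists_inverseKernel`).

**From the system to the target system.** The kernels are only bounded and measurable, so the
transformation cannot be differentiated on weak solutions. It is instead moved to the test
functions. By the divergence theorem on triangles `ξ₀ ≤ ξ ≤ x ≤ 1`, the kernel equations say that
the adjoint transformation maps Lipschitz functions to Lipschitz functions, with an explicit
derivative (`IsRegularPair.dual₁_eq_prim`, `IsRegularPair.dual₂_eq_prim`); consequently testing the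
original system with a transformed pair of functions is the same as testing the target system
(`IsRegularPair.defect_add_defect`). As the adjoint transformation is onto
(`IsRegularPair.exists_dualDeriv_eq`), the two weak formulations are equivalent
(`IsRegularPair.target_iff`). In the target system the source terms are gone and everything that is
left of them is a nonlocal term in the boundary condition at `x = 1`.

**From the target system to a delay equation.** The time integral of a solution of a transport
equation without inflow and with zero initial state has nonincreasing norm, so it vanishes
(`IntegratedTransport.eq_zero`). Hence a solution of the target system is a pair of waves,
determined by the trace `b = β(·, 1)`:
`β(t, x) = b(t - (1 - x) / μ)` and `α(t, x) = q b(t - 1 / μ - x / λ)`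
(`exists_waves_of_target`). Substituted into the boundary condition at `x = 1`, this turns the
nonlocal term into a distributed delay with kernel `Ñ` (`op_waves_eq`), and the closed loop into
`b(t) = q ρ b(t - τ) - K q b(t - τ - δ) - ∫ (Ñ(ν) - Ñ(ν - δ)) b(t - ν) dν`,
up to a term from the initial state and the past actuation that vanishes for `t ≥ δ`.

**Small gain.** The right-hand side is a contraction of `L²(ℝ)` if
`|q ρ| + |K q| + ∫ |Ñ(ν) - Ñ(ν - δ)| dν < 1`. The first two terms are less than `1` by the choice of
`K`, and the last one tends to `0` with `δ`, because translations are continuous in `L¹`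
(`exists_loopGain_lt_one`). The contraction gives existence (`exists_delay_solution`); as the strict
inequality survives a small exponential weight `exp (ω t)`, it also gives decay of every solution
(`delay_solution_bound`). The same inequality excludes zeros of the characteristic function in the
closed right half plane, where all exponentials that occur have modulus at most `1`
(`charFun_ne_zero`).
-/

noncomputable section

namespace Hyperbolic

/-! ### A fixed point theorem for bounded measurable functions -/

/-- Picard iteration in the space of bounded measurable functions supported in `s`, for a map that
contracts the norm `sup_s ‖f‖ / W`. -/
theorem exists_measurable_fixedPoint {Ω E : Type*} [MeasurableSpace Ω] [NormedAddCommGroup E]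
    [CompleteSpace E] [MeasurableSpace E] [BorelSpace E] {s : Set Ω} (hs : MeasurableSet s)
    (T : (Ω → E) → Ω → E) (W : Ω → ℝ) (Wm : ℝ) (hW : ∀ ω ∈ s, 1 ≤ W ω ∧ W ω ≤ Wm)
    {θ : ℝ} (hθ0 : 0 ≤ θ) (hθ1 : θ < 1)
    (hT : ∀ f : Ω → E, Measurable f → (∃ M, ∀ ω, ‖f ω‖ ≤ M) → (∀ ω, ω ∉ s → f ω = 0) →
      Measurable (T f) ∧ ∃ M, ∀ ω ∈ s, ‖T f ω‖ ≤ M)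
    (hc : ∀ f g : Ω → E, Measurable f → (∃ M, ∀ ω, ‖f ω‖ ≤ M) → (∀ ω, ω ∉ s → f ω = 0) →
      Measurable g → (∃ M, ∀ ω, ‖g ω‖ ≤ M) → (∀ ω, ω ∉ s → g ω = 0) →
      ∀ c : ℝ, 0 ≤ c → (∀ ω ∈ s, ‖f ω - g ω‖ ≤ c * W ω) →
        ∀ ω ∈ s, ‖T f ω - T g ω‖ ≤ θ * (c * W ω)) :
    ∃ f : Ω → E, Measurable f ∧ (∃ M, ∀ ω, ‖f ω‖ ≤ M) ∧ (∀ ω, ω ∉ s → f ω = 0) ∧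
      ∀ ω ∈ s, T f ω = f ω := by
  set F : (Ω → E) → Ω → E := fun f => s.indicator (T f) with hF
  have hFs : ∀ f, ∀ ω ∈ s, F f ω = T f ω := fun f ω hω => indicator_of_mem hω _
  have hFn : ∀ f, ∀ ω, ω ∉ s → F f ω = 0 := fun f ω hω => indicator_of_notMem hω _
  set x : ℕ → Ω → E := fun n => F^[n] 0 with hx
  have hx1 : ∀ n, x (n + 1) = F (x n) := fun n => Function.iterate_succ_apply' F n 0
  have hP : ∀ n, Measurable (x n) ∧ (∃ M, ∀ ω, ‖x n ω‖ ≤ M) ∧ ∀ ω, ω ∉ s → x n ω = 0 := by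
    intro n
    induction n with
    | zero => exact ⟨measurable_const, ⟨0, fun ω => by simp [hx]⟩, fun ω _ => rfl⟩
    | succ n ih =>
      obtain ⟨h1, M, hM⟩ := hT (x n) ih.1 ih.2.1 ih.2.2
      refine ⟨hx1 n ▸ h1.indicator hs, ⟨max M 0, fun ω => ?_⟩, fun ω hω => ?_⟩
      · rw [hx1]
        by_cases hω : ω ∈ s
        · rw [hFs _ ω hω]; exact (hM ω hω).trans (le_max_left _ _)
        · rw [hFn _ ω hω, norm_zero]; exact le_max_right _ _
      · rw [hx1, hFn _ ω hω]
  obtain ⟨c0, hc0⟩ := (hP 1).2.1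
  set c := max c0 0
  have hc00 : 0 ≤ c := le_max_right _ _
  have hstep : ∀ n, ∀ ω ∈ s, ‖x (n + 1) ω - x n ω‖ ≤ (c * θ ^ n) * W ω := by
    intro n
    induction n with
    | zero =>
      intro ω hω
      have h0 : x 0 ω = 0 := rfl
      rw [h0, sub_zero, pow_zero, mul_one]
      calc ‖x 1 ω‖ ≤ c := (hc0 ω).trans (le_max_left _ _)
        _ ≤ c * W ω := le_mul_of_one_le_right hc00 (hW ω hω).1
    | succ n ih =>
      intro ω hω
      rw [hx1 (n + 1), hx1 n, hFs _ ω hω, hFs _ ω hω]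
      rw [← hx1 n]
      have := hc (x (n + 1)) (x n) (hP _).1 (hP _).2.1 (hP _).2.2 (hP _).1 (hP _).2.1 (hP _).2.2
        (c * θ ^ n) (by positivity) ih ω hω
      refine this.trans (le_of_eq (by ring))
  have hdist : ∀ ω ∈ s, ∀ n, dist (x n ω) (x (n + 1) ω) ≤ (c * W ω) * θ ^ n := by
    intro ω hω n
    rw [dist_comm, dist_eq_norm]
    exact (hstep n ω hω).trans (le_of_eq (by ring))
  have hlim : ∀ ω, ∃ y, Filter.Tendsto (fun n => x n ω) Filter.atTop (nhds y) := by
    intro ω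
    by_cases hω : ω ∈ s
    · exact cauchySeq_tendsto_of_complete (cauchySeq_of_le_geometric θ _ hθ1 (hdist ω hω))
    · exact ⟨0, by simp [(hP _).2.2 ω hω]⟩
  choose f hf using hlim
  have hfm : Measurable f :=
    measurable_of_tendsto_metrizable (fun n => (hP n).1) (tendsto_pi_nhds.2 hf)
  have hf0 : ∀ ω, ω ∉ s → f ω = 0 := fun ω hω =>
    tendsto_nhds_unique (hf ω) (by simp [(hP _).2.2 ω hω])
  have hfd : ∀ n, ∀ ω ∈ s, ‖x n ω - f ω‖ ≤ (c * θ ^ n / (1 - θ)) * W ω := by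
    intro n ω hω
    have := dist_le_of_le_geometric_of_tendsto θ _ hθ1 (hdist ω hω) (hf ω) n
    rw [dist_eq_norm] at this
    exact this.trans (le_of_eq (by ring))
  have h1θ : 0 < 1 - θ := by linarith
  have hfb : ∃ M, ∀ ω, ‖f ω‖ ≤ M := by
    refine ⟨max ((c / (1 - θ)) * Wm) 0, fun ω => ?_⟩
    by_cases hω : ω ∈ s
    · have h := hfd 0 ω hω
      have h0 : x 0 ω = 0 := rfl
      rw [h0, zero_sub, norm_neg, pow_zero, mul_one] at h
      refine (h.trans ?_).trans (le_max_left _ _)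
      exact mul_le_mul_of_nonneg_left (hW ω hω).2 (by positivity)
    · rw [hf0 ω hω, norm_zero]; exact le_max_right _ _
  refine ⟨f, hfm, hfb, hf0, fun ω hω => ?_⟩
  have hT' : Filter.Tendsto (fun n => x (n + 1) ω) Filter.atTop (nhds (T f ω)) := by
    rw [tendsto_iff_norm_sub_tendsto_zero]
    have hb : Filter.Tendsto (fun n : ℕ => θ * ((c * θ ^ n / (1 - θ)) * W ω)) Filter.atTop
        (nhds 0) := by
      have h := tendsto_pow_atTop_nhds_zero_of_lt_one hθ0 hθ1
      have h2 := h.const_mul (θ * c / (1 - θ) * W ω)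
      rw [mul_zero] at h2
      refine h2.congr fun n => by ring
    refine squeeze_zero (fun n => norm_nonneg _) (fun n => ?_) hb
    rw [hx1 n, hFs _ ω hω]
    exact hc (x n) f (hP _).1 (hP _).2.1 (hP _).2.2 hfm hfb hf0 _ (by positivity) (hfd n) ω hω
  exact tendsto_nhds_unique hT' ((hf ω).comp (Filter.tendsto_add_atTop_nat 1))

/-! ### Bounded measurable functions and kernels -/

/-- Lebesgue measure on `[0,1]`. -/
abbrev m01 : Measure ℝ := volume.restrict (Icc (0 : ℝ) 1)

/-- Bounded measurable functions on the line. -/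
structure BddMeas₁ (f : ℝ → ℝ) : Prop where
  meas : Measurable f
  bdd : ∃ M, ∀ x, |f x| ≤ M

/-- Bounded measurable functions on the plane. -/
structure BddMeas₂ (κ : ℝ → ℝ → ℝ) : Prop where
  meas : Measurable (Function.uncurry κ)
  bdd : ∃ M, ∀ x y, |κ x y| ≤ M

/-- Bounded measurable functions on the plane that vanish off the triangle, so that Volterra
integrals become integrals over `[0,1]`. -/
structure TriKernel (κ : ℝ → ℝ → ℝ) : Prop extends BddMeas₂ κ where
  supp : ∀ x ξ, (x, ξ) ∉ triangle → κ x ξ = 0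

theorem BddMeas₁.exists_pos {f : ℝ → ℝ} (h : BddMeas₁ f) : ∃ M, 0 < M ∧ ∀ x, |f x| ≤ M := by
  obtain ⟨M, hM⟩ := h.bdd
  exact ⟨max M 1, by positivity, fun x => (hM x).trans (le_max_left _ _)⟩

theorem BddMeas₂.exists_pos {f : ℝ → ℝ → ℝ} (h : BddMeas₂ f) :
    ∃ M, 0 < M ∧ ∀ x y, |f x y| ≤ M := by
  obtain ⟨M, hM⟩ := h.bdd
  exact ⟨max M 1, by positivity, fun x y => (hM x y).trans (le_max_left _ _)⟩

theorem BddMeas₁.const (c : ℝ) : BddMeas₁ fun _ => c := ⟨measurable_const, |c|, fun _ => le_rfl⟩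

theorem BddMeas₁.add {f g : ℝ → ℝ} (hf : BddMeas₁ f) (hg : BddMeas₁ g) :
    BddMeas₁ fun x => f x + g x := by
  obtain ⟨M, hM⟩ := hf.bdd
  obtain ⟨N, hN⟩ := hg.bdd
  exact ⟨hf.meas.add hg.meas, M + N, fun x => (abs_add_le _ _).trans (add_le_add (hM x) (hN x))⟩

theorem BddMeas₁.mul {f g : ℝ → ℝ} (hf : BddMeas₁ f) (hg : BddMeas₁ g) :
    BddMeas₁ fun x => f x * g x := by
  obtain ⟨M, hM⟩ := hf.bdd
  obtain ⟨N, hN⟩ := hg.bdd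
  refine ⟨hf.meas.mul hg.meas, M * N, fun x => ?_⟩
  rw [abs_mul]
  exact mul_le_mul (hM x) (hN x) (abs_nonneg _) ((abs_nonneg _).trans (hM x))

theorem BddMeas₁.neg {f : ℝ → ℝ} (hf : BddMeas₁ f) : BddMeas₁ fun x => -f x := by
  simpa using (BddMeas₁.const (-1)).mul hf

theorem BddMeas₁.sub {f g : ℝ → ℝ} (hf : BddMeas₁ f) (hg : BddMeas₁ g) :
    BddMeas₁ fun x => f x - g x := by
  simpa [sub_eq_add_neg] using hf.add hg.neg

theorem BddMeas₁.const_mul {f : ℝ → ℝ} (hf : BddMeas₁ f) (c : ℝ) : BddMeas₁ fun x => c * f x :=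
  (BddMeas₁.const c).mul hf

theorem BddMeas₁.div_const {f : ℝ → ℝ} (hf : BddMeas₁ f) (c : ℝ) : BddMeas₁ fun x => f x / c := by
  simpa [div_eq_inv_mul] using hf.const_mul c⁻¹

theorem BddMeas₁.indicator {f : ℝ → ℝ} (hf : BddMeas₁ f) {s : Set ℝ} (hs : MeasurableSet s) :
    BddMeas₁ (s.indicator f) := by
  obtain ⟨M, hM⟩ := hf.bdd
  refine ⟨hf.meas.indicator hs, M, fun x => ?_⟩
  by_cases hx : x ∈ s
  · rw [indicator_of_mem hx]; exact hM x
  · rw [indicator_of_notMem hx, abs_zero]; exact (abs_nonneg _).trans (hM x)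

theorem BddMeas₁.memLp {f : ℝ → ℝ} (hf : BddMeas₁ f) (p : ENNReal) (μ : Measure ℝ)
    [IsFiniteMeasure μ] : MemLp f p μ := by
  obtain ⟨M, hM⟩ := hf.bdd
  exact MemLp.of_bound hf.meas.aestronglyMeasurable M (Filter.Eventually.of_forall hM)

theorem BddMeas₁.integrable {f : ℝ → ℝ} (hf : BddMeas₁ f) (μ : Measure ℝ) [IsFiniteMeasure μ] :
    Integrable f μ := memLp_one_iff_integrable.1 (hf.memLp 1 μ)

theorem BddMeas₁.integrable_mul {f g : ℝ → ℝ} (hf : BddMeas₁ f) {μ : Measure ℝ}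
    (hg : Integrable g μ) : Integrable (fun x => f x * g x) μ := by
  obtain ⟨M, hM⟩ := hf.bdd
  exact hg.bdd_mul hf.meas.aestronglyMeasurable (Filter.Eventually.of_forall hM)

theorem BddMeas₁.intervalIntegrable {f : ℝ → ℝ} (hf : BddMeas₁ f) (a b : ℝ) :
    IntervalIntegrable f volume a b :=
  ⟨hf.integrable (volume.restrict (Ioc a b)), hf.integrable (volume.restrict (Ioc b a))⟩

theorem BddMeas₂.left {κ : ℝ → ℝ → ℝ} (h : BddMeas₂ κ) (x : ℝ) : BddMeas₁ (κ x) := by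
  obtain ⟨M, hM⟩ := h.bdd
  exact ⟨h.meas.comp measurable_prodMk_left, M, hM x⟩

theorem BddMeas₂.right {κ : ℝ → ℝ → ℝ} (h : BddMeas₂ κ) (y : ℝ) : BddMeas₁ fun x => κ x y := by
  obtain ⟨M, hM⟩ := h.bdd
  exact ⟨h.meas.comp measurable_prodMk_right, M, fun x => hM x y⟩

theorem BddMeas₂.swap {κ : ℝ → ℝ → ℝ} (h : BddMeas₂ κ) : BddMeas₂ fun x y => κ y x := by
  obtain ⟨M, hM⟩ := h.bdd
  exact ⟨h.meas.comp measurable_swap, M, fun x y => hM y x⟩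

theorem BddMeas₂.add {f g : ℝ → ℝ → ℝ} (hf : BddMeas₂ f) (hg : BddMeas₂ g) :
    BddMeas₂ fun x y => f x y + g x y := by
  obtain ⟨M, hM⟩ := hf.bdd
  obtain ⟨N, hN⟩ := hg.bdd
  exact ⟨hf.meas.add hg.meas, M + N,
    fun x y => (abs_add_le _ _).trans (add_le_add (hM x y) (hN x y))⟩

theorem BddMeas₂.mul {f g : ℝ → ℝ → ℝ} (hf : BddMeas₂ f) (hg : BddMeas₂ g) :
    BddMeas₂ fun x y => f x y * g x y := by
  obtain ⟨M, hM⟩ := hf.bdd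
  obtain ⟨N, hN⟩ := hg.bdd
  refine ⟨hf.meas.mul hg.meas, M * N, fun x y => ?_⟩
  rw [abs_mul]
  exact mul_le_mul (hM x y) (hN x y) (abs_nonneg _) ((abs_nonneg _).trans (hM x y))

theorem BddMeas₁.fst {f : ℝ → ℝ} (hf : BddMeas₁ f) : BddMeas₂ fun x _ => f x := by
  obtain ⟨M, hM⟩ := hf.bdd
  exact ⟨hf.meas.comp measurable_fst, M, fun x _ => hM x⟩

theorem BddMeas₁.snd {f : ℝ → ℝ} (hf : BddMeas₁ f) : BddMeas₂ fun _ y => f y := by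
  obtain ⟨M, hM⟩ := hf.bdd
  exact ⟨hf.meas.comp measurable_snd, M, fun _ y => hM y⟩

/-- A kernel times an integrable function of the second variable is integrable on the square. -/
theorem BddMeas₂.integrable_prod {κ : ℝ → ℝ → ℝ} (h : BddMeas₂ κ) {f g : ℝ → ℝ} {μ ν : Measure ℝ}
    [SFinite μ] [SFinite ν] (hf : Integrable f μ) (hg : Integrable g ν) :
    Integrable (Function.uncurry fun x y => κ x y * (f x * g y)) (μ.prod ν) := by
  obtain ⟨M, hM⟩ := h.bdd
  exact (hf.mul_prod hg).bdd_mul h.meas.aestronglyMeasurable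
    (Filter.Eventually.of_forall fun p => hM p.1 p.2)

/-- The function `x ↦ ∫ κ(x,ξ) f(ξ) dξ` over `[0,1]`. -/
def intOp (κ : ℝ → ℝ → ℝ) (f : ℝ → ℝ) (x : ℝ) : ℝ := ∫ ξ, κ x ξ * f ξ ∂m01

/-- The function `ξ ↦ ∫ κ(x,ξ) f(x) dx` over `[0,1]`. -/
def adjOp (κ : ℝ → ℝ → ℝ) (f : ℝ → ℝ) (ξ : ℝ) : ℝ := ∫ x, κ x ξ * f x ∂m01

theorem intOp_bddMeas {κ : ℝ → ℝ → ℝ} (h : BddMeas₂ κ) {f : ℝ → ℝ} (hf : Integrable f m01) :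
    BddMeas₁ (intOp κ f) := by
  obtain ⟨M, hM0, hM⟩ := h.exists_pos
  have hmk : ∃ g : ℝ → ℝ, StronglyMeasurable g ∧ f =ᵐ[m01] g := hf.1
  obtain ⟨g, hg, hfg⟩ := hmk
  have heq : intOp κ f = intOp κ g := by
    funext x
    exact integral_congr_ae (hfg.mono fun ξ hξ => by simp only [hξ])
  refine ⟨?_, M * ∫ ξ, |f ξ| ∂m01, fun x => ?_⟩
  · rw [heq]
    have : StronglyMeasurable (Function.uncurry fun x ξ => κ x ξ * g ξ) :=
      (h.meas.mul (hg.measurable.comp measurable_snd)).stronglyMeasurable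
    exact (this.integral_prod_right (ν := m01)).measurable
  · rw [← integral_const_mul]
    refine (abs_integral_le_integral_abs).trans (integral_mono ?_ (hf.abs.const_mul M) fun ξ => ?_)
    · exact ((h.left x).integrable_mul hf).abs
    · simp only [abs_mul]
      exact mul_le_mul_of_nonneg_right (hM x ξ) (abs_nonneg _)

theorem adjOp_bddMeas {κ : ℝ → ℝ → ℝ} (h : BddMeas₂ κ) {f : ℝ → ℝ} (hf : Integrable f m01) :
    BddMeas₁ (adjOp κ f) := intOp_bddMeas h.swap hf

/-- Fubini: `intOp` and `adjOp` are adjoint to each other. -/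
theorem integral_intOp_mul {κ : ℝ → ℝ → ℝ} (h : BddMeas₂ κ) {f g : ℝ → ℝ} (hf : Integrable f m01)
    (hg : Integrable g m01) :
    ∫ x, intOp κ f x * g x ∂m01 = ∫ ξ, f ξ * adjOp κ g ξ ∂m01 := by
  have h1 : ∀ x, intOp κ f x * g x = ∫ ξ, κ x ξ * (g x * f ξ) ∂m01 := by
    intro x
    rw [intOp, ← integral_mul_const]
    exact integral_congr_ae (Filter.Eventually.of_forall fun ξ => by ring)
  have h2 : ∀ ξ, f ξ * adjOp κ g ξ = ∫ x, κ x ξ * (g x * f ξ) ∂m01 := by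
    intro ξ
    rw [adjOp, ← integral_const_mul]
    exact integral_congr_ae (Filter.Eventually.of_forall fun x => by ring)
  simp_rw [h1, h2]
  exact integral_integral_swap (h.integrable_prod hg hf)

theorem measurableSet_triangle : MeasurableSet triangle := by
  have h1 : MeasurableSet {p : ℝ × ℝ | 0 ≤ p.2} := measurableSet_le measurable_const measurable_snd
  have h2 : MeasurableSet {p : ℝ × ℝ | p.2 ≤ p.1} := measurableSet_le measurable_snd measurable_fst
  have h3 : MeasurableSet {p : ℝ × ℝ | p.1 ≤ 1} := measurableSet_le measurable_fst measurable_const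
  exact h1.inter (h2.inter h3)

/-- The extension by zero of a kernel on the triangle. -/
def cutTri (f : ℝ → ℝ → ℝ) (x ξ : ℝ) : ℝ := triangle.indicator (Function.uncurry f) (x, ξ)

theorem cutTri_of_mem {f : ℝ → ℝ → ℝ} {x ξ : ℝ} (h : (x, ξ) ∈ triangle) :
    cutTri f x ξ = f x ξ := indicator_of_mem h _

theorem cutTri_triKernel {f : ℝ → ℝ → ℝ} (h : BddMeasKernel f) : TriKernel (cutTri f) := by
  obtain ⟨hm, M, hM⟩ := h
  refine ⟨⟨?_, max M 0, fun x y => ?_⟩, fun x ξ hx => indicator_of_notMem hx _⟩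
  · have : Function.uncurry (cutTri f) = triangle.indicator (Function.uncurry f) := by
      funext p; rfl
    rw [this]
    refine measurable_of_restrict_of_restrict_compl measurableSet_triangle ?_ ?_
    · have h2 : triangle.domRestrict (triangle.indicator (Function.uncurry f)) =
          fun p : triangle => f p.1.1 p.1.2 := by
        funext p
        exact indicator_of_mem p.2 _
      rw [h2]; exact hm
    · have h2 : (triangleᶜ).domRestrict (triangle.indicator (Function.uncurry f)) = fun _ => 0 := by
        funext p
        exact indicator_of_notMem p.2 _
      rw [h2]; exact measurable_const
  · by_cases hp : (x, y) ∈ triangle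
    · rw [cutTri_of_mem hp]; exact (hM _ hp).trans (le_max_left _ _)
    · rw [cutTri, indicator_of_notMem hp, abs_zero]; exact le_max_right _ _

theorem TriKernel.bddMeasKernel {f : ℝ → ℝ → ℝ} (h : TriKernel f) : BddMeasKernel f := by
  obtain ⟨M, hM⟩ := h.bdd
  exact ⟨h.meas.comp measurable_subtype_coe, M, fun p _ => hM p.1 p.2⟩

/-- For a kernel supported in the triangle the Volterra integral is an integral over `[0,1]`. -/
theorem intervalIntegral_tri {κ f : ℝ → ℝ → ℝ} (hsupp : ∀ x ξ, (x, ξ) ∉ triangle → f x ξ = 0)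
    (heq : ∀ x ξ, (x, ξ) ∈ triangle → κ x ξ = f x ξ) {x : ℝ} (hx : x ∈ Icc (0 : ℝ) 1) :
    ∫ ξ in (0 : ℝ)..x, κ x ξ = ∫ ξ, f x ξ ∂m01 := by
  rw [intervalIntegral.integral_of_le hx.1, ← integral_Icc_eq_integral_Ioc]
  rw [← integral_indicator measurableSet_Icc, ← integral_indicator measurableSet_Icc]
  congr 1
  funext ξ
  by_cases h : (x, ξ) ∈ triangle
  · rw [indicator_of_mem, indicator_of_mem, heq x ξ h]
    · exact ⟨h.1, h.2.1.trans h.2.2⟩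
    · exact ⟨h.1, h.2.1⟩
  · rw [indicator_of_notMem]
    · by_cases h' : ξ ∈ Icc (0 : ℝ) 1
      · rw [indicator_of_mem h', hsupp x ξ h]
      · rw [indicator_of_notMem h']
    · exact fun h' => h ⟨h'.1, h'.2, hx.2⟩

/-! ### Solvability of the kernel equations -/

theorem measurable_parametric_intervalIntegral {α : Type*} [MeasurableSpace α] {r : α → ℝ}
    {h : α → ℝ → ℝ} (hr : Measurable r) (hh : Measurable (Function.uncurry h)) :
    Measurable fun p => ∫ s in (0 : ℝ)..r p, h p s := by
  have key : ∀ u v : α → ℝ, Measurable u → Measurable v →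
      Measurable fun p => ∫ s in Ioc (u p) (v p), h p s := by
    intro u v hu hv
    have h1 : ∀ p, ∫ s in Ioc (u p) (v p), h p s =
        ∫ s, {q : α × ℝ | u q.1 < q.2 ∧ q.2 ≤ v q.1}.indicator (Function.uncurry h) (p, s) := by
      intro p
      rw [← integral_indicator measurableSet_Ioc]
      rfl
    simp_rw [h1]
    have hs : MeasurableSet {q : α × ℝ | u q.1 < q.2 ∧ q.2 ≤ v q.1} :=
      (measurableSet_lt (hu.comp measurable_fst) measurable_snd).inter
        (measurableSet_le measurable_snd (hv.comp measurable_fst))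
    have := (hh.indicator hs).stronglyMeasurable
    exact (this.integral_prod_right' (ν := volume)).measurable
  exact (key _ _ measurable_const hr).sub (key _ _ hr measurable_const)

theorem integral_exp_affine_le {γ a : ℝ} (hγ : 0 < γ) (ha : 0 < a) (y r : ℝ) :
    ∫ s in (0 : ℝ)..r, Real.exp (γ * (y + a * s)) ≤ Real.exp (γ * (y + a * r)) / (γ * a) := by
  have hd : ∀ s ∈ uIcc 0 r, HasDerivAt (fun s => Real.exp (γ * (y + a * s)) / (γ * a))
      (Real.exp (γ * (y + a * s))) s := by
    intro s _
    have h1 : HasDerivAt (fun s => γ * (y + a * s)) (γ * a) s := by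
      simpa using (((hasDerivAt_id s).const_mul a).const_add y).const_mul γ
    have := h1.exp.div_const (γ * a)
    rwa [mul_div_assoc, div_self (by positivity), mul_one] at this
  rw [intervalIntegral.integral_eq_sub_of_hasDerivAt hd
    ((by fun_prop : Continuous fun s => Real.exp (γ * (y + a * s))).intervalIntegrable _ _)]
  have : 0 < Real.exp (γ * (y + a * 0)) / (γ * a) := by positivity
  linarith

/-- The function with values `d` on the diagonal that is transported by `f s₂` along `(a, -b)`. -/
def fromDiag (a b : ℝ) (s₂ d : ℝ → ℝ) (f : ℝ × ℝ → ℝ) (p : ℝ × ℝ) : ℝ :=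
  d ((b * p.1 + a * p.2) / (a + b)) + ∫ s in (0 : ℝ)..(p.1 - p.2) / (a + b),
    f ((b * p.1 + a * p.2) / (a + b) + a * s, (b * p.1 + a * p.2) / (a + b) - b * s) *
      s₂ ((b * p.1 + a * p.2) / (a + b) - b * s)

/-- The function transported by `g s₁` along `(a, a)` from the boundary values `c g` on `ξ = 0`. -/
def fromBottom (a c : ℝ) (s₁ : ℝ → ℝ) (g : ℝ × ℝ → ℝ) (p : ℝ × ℝ) : ℝ :=
  c * g (p.1 - p.2, 0) + ∫ s in (0 : ℝ)..p.2 / a, g (p.1 - p.2 + a * s, a * s) * s₁ (a * s)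

section
variable {a b c : ℝ} {s₁ s₂ d : ℝ → ℝ} {f : ℝ × ℝ → ℝ}

theorem fromDiag_measurable (hs₂ : BddMeas₁ s₂) (hd : BddMeas₁ d) (hf : Measurable f) :
    Measurable (fromDiag a b s₂ d f) := by
  have h1 := hd.meas
  have h2 := hs₂.meas
  refine Measurable.add (by fun_prop) ?_
  exact measurable_parametric_intervalIntegral (by fun_prop) (by fun_prop)

theorem fromBottom_measurable (hs₁ : BddMeas₁ s₁) {g : ℝ × ℝ → ℝ} (hg : Measurable g) :
    Measurable (fromBottom a c s₁ g) := by
  have h1 := hs₁.meas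
  refine Measurable.add (by fun_prop) ?_
  exact measurable_parametric_intervalIntegral (by fun_prop) (by fun_prop)

theorem fromDiag_intervalIntegrable (hs₂ : BddMeas₁ s₂) (hf : Measurable f)
    (hfb : ∃ M, ∀ p, ‖f p‖ ≤ M) (y u v : ℝ) :
    IntervalIntegrable (fun s => f (y + a * s, y - b * s) * s₂ (y - b * s)) volume u v := by
  obtain ⟨M, hM⟩ := hfb
  obtain ⟨N, hN⟩ := hs₂.bdd
  have h1 : BddMeas₁ fun s => f (y + a * s, y - b * s) := ⟨by fun_prop, M, fun s => hM _⟩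
  have h2 : BddMeas₁ fun s => s₂ (y - b * s) :=
    ⟨hs₂.meas.comp (by fun_prop), N, fun s => hN _⟩
  exact (h1.mul h2).intervalIntegrable u v

theorem fromDiag_bound (hs₂ : BddMeas₁ s₂) (hd : BddMeas₁ d) (hfb : ∃ M, ∀ p, ‖f p‖ ≤ M) :
    ∃ D N, 0 ≤ D ∧ 0 ≤ N ∧ ∀ p, |fromDiag a b s₂ d f p| ≤ D + N * |p.1 - p.2| := by
  obtain ⟨M, hM⟩ := hfb
  obtain ⟨N, hN0, hN⟩ := hs₂.exists_pos
  obtain ⟨D, hD0, hD⟩ := hd.exists_pos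
  have hM0 : 0 ≤ M := (norm_nonneg _).trans (hM 0)
  refine ⟨D, M * N / |a + b|, hD0.le, by positivity, fun p => ?_⟩
  refine (abs_add_le _ _).trans (add_le_add (hD _) ?_)
  have h := intervalIntegral.norm_integral_le_of_norm_le_const
    (a := 0) (b := (p.1 - p.2) / (a + b)) (C := M * N)
    (f := fun s => f ((b * p.1 + a * p.2) / (a + b) + a * s,
      (b * p.1 + a * p.2) / (a + b) - b * s) * s₂ ((b * p.1 + a * p.2) / (a + b) - b * s))
    (fun s _ => by
      rw [norm_mul]
      exact mul_le_mul (hM _) (hN _) (norm_nonneg _) hM0)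
  rw [Real.norm_eq_abs] at h
  refine h.trans (le_of_eq ?_)
  rw [sub_zero, abs_div]; ring

theorem fromBottom_intervalIntegrable (hs₁ : BddMeas₁ s₁) {g : ℝ × ℝ → ℝ} (hg : Measurable g)
    {D N : ℝ} (hgb : ∀ p : ℝ × ℝ, |g p| ≤ D + N * |p.1 - p.2|) (z u v : ℝ) :
    IntervalIntegrable (fun s => g (z + a * s, a * s) * s₁ (a * s)) volume u v := by
  obtain ⟨S, hS⟩ := hs₁.bdd
  have h1 : BddMeas₁ fun s => g (z + a * s, a * s) :=
    ⟨by fun_prop, D + N * |z|, fun s => by simpa using hgb (z + a * s, a * s)⟩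
  have h2 : BddMeas₁ fun s => s₁ (a * s) := ⟨hs₁.meas.comp (by fun_prop), S, fun s => hS _⟩
  exact (h1.mul h2).intervalIntegrable u v

theorem fromBottom_bound (ha : 0 < a) (hs₁ : BddMeas₁ s₁) {g : ℝ × ℝ → ℝ}
    {D N : ℝ} (hD : 0 ≤ D) (hN : 0 ≤ N) (hgb : ∀ p : ℝ × ℝ, |g p| ≤ D + N * |p.1 - p.2|) :
    ∃ M, ∀ p ∈ triangle, |fromBottom a c s₁ g p| ≤ M := by
  obtain ⟨S, hS0, hS⟩ := hs₁.exists_pos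
  refine ⟨|c| * (D + N) + (D + N) * S * (1 / a), fun p hp => ?_⟩
  obtain ⟨h0, h1, h2⟩ := hp
  have hz : |p.1 - p.2| ≤ 1 := by rw [abs_le]; constructor <;> linarith
  have hb : ∀ q : ℝ × ℝ, q.1 - q.2 = p.1 - p.2 → |g q| ≤ D + N := fun q hq =>
    (hgb q).trans (by rw [hq]; nlinarith)
  refine (abs_add_le _ _).trans (add_le_add ?_ ?_)
  · rw [abs_mul]
    exact mul_le_mul_of_nonneg_left (hb _ (by simp)) (abs_nonneg _)
  · have h := intervalIntegral.norm_integral_le_of_norm_le_const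
      (a := 0) (b := p.2 / a) (C := (D + N) * S)
      (f := fun s => g (p.1 - p.2 + a * s, a * s) * s₁ (a * s))
      (fun s _ => by
        rw [norm_mul]
        exact mul_le_mul (hb _ (by simp)) (hS _) (norm_nonneg _) (by positivity))
    rw [Real.norm_eq_abs] at h
    refine h.trans (mul_le_mul_of_nonneg_left ?_ (by positivity))
    rw [sub_zero, abs_of_nonneg (by positivity)]
    gcongr
    linarith

theorem fromDiag_contraction (ha : 0 < a) (hb : 0 < b) (hs₂ : BddMeas₁ s₂) {g : ℝ × ℝ → ℝ}
    (hf : Measurable f) (hfb : ∃ M, ∀ p, ‖f p‖ ≤ M) (hg : Measurable g)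
    (hgb : ∃ M, ∀ p, ‖g p‖ ≤ M) {S γ C : ℝ} (hS : ∀ x, |s₂ x| ≤ S) (hγ : 0 < γ)
    (hC : 0 ≤ C) (hfg : ∀ p ∈ triangle, ‖f p - g p‖ ≤ C * Real.exp (γ * p.1)) :
    ∀ p ∈ triangle, |fromDiag a b s₂ d f p - fromDiag a b s₂ d g p| ≤
      C * S / (γ * a) * Real.exp (γ * p.1) := by
  intro p hp
  obtain ⟨h0, h1, h2⟩ := hp
  have hS0 : 0 ≤ S := (abs_nonneg _).trans (hS 0)
  rw [fromDiag, fromDiag, add_sub_add_left_eq_sub]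
  set y := (b * p.1 + a * p.2) / (a + b) with hy
  set r := (p.1 - p.2) / (a + b) with hr
  have hab : 0 < a + b := by positivity
  have hr0 : 0 ≤ r := div_nonneg (by linarith) hab.le
  have hyr : y + a * r = p.1 := by rw [hy, hr]; field_simp; ring
  have hyr' : y - b * r = p.2 := by rw [hy, hr]; field_simp; ring
  rw [← intervalIntegral.integral_sub (fromDiag_intervalIntegrable hs₂ hf hfb _ _ _)
    (fromDiag_intervalIntegrable hs₂ hg hgb _ _ _)]
  have hle : |∫ s in (0 : ℝ)..r, (f (y + a * s, y - b * s) * s₂ (y - b * s) -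
      g (y + a * s, y - b * s) * s₂ (y - b * s))| ≤
      ∫ s in (0 : ℝ)..r, C * S * Real.exp (γ * (y + a * s)) := by
    rw [← Real.norm_eq_abs]
    refine intervalIntegral.norm_integral_le_of_norm_le hr0 ?_
      ((by fun_prop : Continuous fun s => C * S * Real.exp (γ * (y + a * s))).intervalIntegrable _ _)
    refine Filter.Eventually.of_forall fun s hs => ?_
    rw [← sub_mul, norm_mul]
    have hmem : (y + a * s, y - b * s) ∈ triangle := by
      refine ⟨?_, ?_, ?_⟩
      · show 0 ≤ y - b * s
        have := mul_le_mul_of_nonneg_left hs.2 hb.le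
        linarith
      · show y - b * s ≤ y + a * s
        have := mul_nonneg hb.le hs.1.le
        have := mul_nonneg ha.le hs.1.le
        linarith
      · show y + a * s ≤ 1
        have := mul_le_mul_of_nonneg_left hs.2 ha.le
        linarith
    calc _ ≤ (C * Real.exp (γ * (y + a * s))) * S :=
          mul_le_mul (hfg _ hmem) (hS _) (abs_nonneg _) (by positivity)
      _ = _ := by ring
  refine hle.trans ?_
  rw [intervalIntegral.integral_const_mul]
  have := integral_exp_affine_le hγ ha y r
  rw [hyr] at this
  calc _ ≤ C * S * (Real.exp (γ * p.1) / (γ * a)) := mul_le_mul_of_nonneg_left this (by positivity)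
    _ = _ := by ring

end

/-- A pair of coupled transport equations on the triangle, one along `(a, -b)` with data on the
diagonal, one along `(a, a)` with data on `ξ = 0` reflected from the first one, is solvable. -/
theorem exists_transport_pair {a b : ℝ} (c : ℝ) {s₁ s₂ d : ℝ → ℝ} (ha : 0 < a) (hb : 0 < b)
    (hs₁ : BddMeas₁ s₁) (hs₂ : BddMeas₁ s₂) (hd : BddMeas₁ d) :
    ∃ f g : ℝ → ℝ → ℝ, BddMeasKernel f ∧ BddMeasKernel g ∧
      SolvesTransport a a f (fun x ξ => g x ξ * s₁ ξ) ∧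
      SolvesTransport a (-b) g (fun x ξ => f x ξ * s₂ ξ) ∧
      (∀ x ∈ Icc (0 : ℝ) 1, g x x = d x) ∧ ∀ x ∈ Icc (0 : ℝ) 1, f x 0 = c * g x 0 := by
  obtain ⟨S₁, hS₁0, hS₁⟩ := hs₁.exists_pos
  obtain ⟨S₂, hS₂0, hS₂⟩ := hs₂.exists_pos
  -- the composed map contracts with the constant `(|c| + S₁ / a) (S₂ / a) / γ`, which is below `1
  -- / 2`
  set γ := 2 * ((|c| + S₁ * (1 / a)) * (S₂ / a)) + 1 with hγ
  have hγ0 : 0 < γ := by positivity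
  have hT : ∀ f : ℝ × ℝ → ℝ, Measurable f → (∃ M, ∀ p, ‖f p‖ ≤ M) →
      Measurable (fromBottom a c s₁ (fromDiag a b s₂ d f)) ∧
        ∃ M, ∀ p ∈ triangle, ‖fromBottom a c s₁ (fromDiag a b s₂ d f) p‖ ≤ M := by
    intro f hf hfb
    obtain ⟨D, N, hD, hN, hDN⟩ := fromDiag_bound (a := a) (b := b) hs₂ hd hfb
    exact ⟨fromBottom_measurable hs₁ (fromDiag_measurable hs₂ hd hf),
      fromBottom_bound ha hs₁ hD hN hDN⟩
  obtain ⟨f, hfm, hfb, -, hfix⟩ := exists_measurable_fixedPoint measurableSet_triangle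
    (fun f => fromBottom a c s₁ (fromDiag a b s₂ d f)) (fun p => Real.exp (γ * p.1))
    (Real.exp γ)
    (fun p hp => ⟨Real.one_le_exp (mul_nonneg hγ0.le (hp.1.trans hp.2.1)),
      Real.exp_le_exp.2 (mul_le_of_le_one_right hγ0.le hp.2.2)⟩)
    (θ := 1 / 2) (by norm_num) (by norm_num) (fun f hf hfb _ => hT f hf hfb) (by
      intro f g hf hfb _ hg hgb _ C hC hfg p hp
      have key := fromDiag_contraction (d := d) ha hb hs₂ hf hfb hg hgb hS₂ hγ0 hC hfg
      obtain ⟨D, N, hD, hN, hDN⟩ := fromDiag_bound (a := a) (b := b) hs₂ hd hfb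
      obtain ⟨D', N', hD', hN', hDN'⟩ := fromDiag_bound (a := a) (b := b) hs₂ hd hgb
      set F := fromDiag a b s₂ d f
      set G := fromDiag a b s₂ d g
      have hFm : Measurable F := fromDiag_measurable hs₂ hd hf
      have hGm : Measurable G := fromDiag_measurable hs₂ hd hg
      obtain ⟨h0, h1, h2⟩ := hp
      set Q := C * S₂ / (γ * a) with hQ
      have hQ0 : 0 ≤ Q := by positivity
      have e1 : ∀ x' ≤ p.1, Real.exp (γ * x') ≤ Real.exp (γ * p.1) := fun x' hx' =>
        Real.exp_le_exp.2 (mul_le_mul_of_nonneg_left hx' hγ0.le)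
      -- characteristics that end in `p` stay in `x ≤ p.1`, where the weight is at most its value
      -- in `p`
      have hA : |F (p.1 - p.2, 0) - G (p.1 - p.2, 0)| ≤ Q * Real.exp (γ * p.1) :=
        (key (p.1 - p.2, 0) ⟨le_rfl, by simpa using h1, by simp only; linarith⟩).trans
          (mul_le_mul_of_nonneg_left (e1 _ (by simp only; linarith)) hQ0)
      have hB : |(∫ s in (0 : ℝ)..p.2 / a, F (p.1 - p.2 + a * s, a * s) * s₁ (a * s)) -
          ∫ s in (0 : ℝ)..p.2 / a, G (p.1 - p.2 + a * s, a * s) * s₁ (a * s)| ≤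
          Q * Real.exp (γ * p.1) * S₁ * (1 / a) := by
        rw [← intervalIntegral.integral_sub (fromBottom_intervalIntegrable hs₁ hFm hDN _ _ _)
          (fromBottom_intervalIntegrable hs₁ hGm hDN' _ _ _), ← Real.norm_eq_abs]
        refine (intervalIntegral.norm_integral_le_of_norm_le_const
          (C := Q * Real.exp (γ * p.1) * S₁) fun s hs => ?_).trans ?_
        · rw [uIoc_of_le (by positivity)] at hs
          have has : a * s ≤ p.2 := by
            have := mul_le_mul_of_nonneg_left hs.2 ha.le
            rwa [mul_div_cancel₀ _ ha.ne'] at this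
          have has0 : 0 ≤ a * s := mul_nonneg ha.le hs.1.le
          rw [← sub_mul, norm_mul]
          refine mul_le_mul ((key _ ⟨has0, ?_, ?_⟩).trans
            (mul_le_mul_of_nonneg_left (e1 _ ?_) hQ0)) (hS₁ _) (norm_nonneg _) (by positivity)
          all_goals simp only; linarith
        · refine mul_le_mul_of_nonneg_left ?_ (by positivity)
          rw [sub_zero, abs_of_nonneg (by positivity)]
          gcongr
          linarith
      have h3 : ‖fromBottom a c s₁ F p - fromBottom a c s₁ G p‖ ≤
          |c| * (Q * Real.exp (γ * p.1)) + Q * Real.exp (γ * p.1) * S₁ * (1 / a) := by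
        rw [fromBottom, fromBottom, add_sub_add_comm, ← mul_sub]
        refine (norm_add_le _ _).trans (add_le_add ?_ hB)
        rw [norm_mul]
        exact mul_le_mul_of_nonneg_left hA (norm_nonneg _)
      refine h3.trans ?_
      have h4 : |c| * (Q * Real.exp (γ * p.1)) + Q * Real.exp (γ * p.1) * S₁ * (1 / a) =
          ((|c| + S₁ * (1 / a)) * (S₂ / a)) / γ * (C * Real.exp (γ * p.1)) := by
        rw [hQ]; field_simp
      rw [h4]
      refine mul_le_mul_of_nonneg_right ?_ (by positivity)
      rw [div_le_iff₀ hγ0, hγ]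
      linarith)
  obtain ⟨D, N, hD, hN, hDN⟩ := fromDiag_bound (a := a) (b := b) hs₂ hd hfb
  set G := fromDiag a b s₂ d f with hG
  have hGm : Measurable G := fromDiag_measurable hs₂ hd hfm
  have hab : 0 < a + b := by positivity
  refine ⟨fun x ξ => f (x, ξ), fun x ξ => G (x, ξ), ⟨hfm.comp measurable_subtype_coe, ?_⟩,
    ⟨hGm.comp measurable_subtype_coe, ?_⟩, ?_, ?_, ?_, ?_⟩
  · obtain ⟨M, hM⟩ := hfb
    exact ⟨M, fun p _ => hM p⟩
  · refine ⟨D + N, fun p hp => (hDN p).trans ?_⟩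
    obtain ⟨h0, h1, h2⟩ := hp
    have hz : |p.1 - p.2| ≤ 1 := by rw [abs_le]; constructor <;> linarith
    nlinarith
  · intro x ξ r hr h1 h2
    simp only
    rw [← hfix _ h1, ← hfix _ h2]
    simp only [fromBottom]
    rw [show x + a * r - (ξ + a * r) = x - ξ by ring,
      show (ξ + a * r) / a = r + ξ / a by field_simp; ring]
    rw [← intervalIntegral.integral_add_adjacent_intervals (b := ξ / a)
      (fromBottom_intervalIntegrable hs₁ hGm hDN _ _ _)
      (fromBottom_intervalIntegrable hs₁ hGm hDN _ _ _), add_assoc]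
    congr 2
    have := intervalIntegral.integral_comp_add_right (a := 0) (b := r)
      (fun s => G (x - ξ + a * s, a * s) * s₁ (a * s)) (ξ / a)
    rw [zero_add] at this
    rw [← this]
    refine intervalIntegral.integral_congr fun s _ => ?_
    have e : a * (s + ξ / a) = ξ + a * s := by field_simp; ring
    simp only [e]
    rw [show x - ξ + (ξ + a * s) = x + a * s by ring]
  · intro x ξ r hr h1 h2
    simp only [hG, fromDiag]
    have e1 : (b * (x + a * r) + a * (ξ + -b * r)) / (a + b) = (b * x + a * ξ) / (a + b) := by
      congr 1; ring
    have e2 : (x + a * r - (ξ + -b * r)) / (a + b) = r + (x - ξ) / (a + b) := by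
      field_simp; ring
    rw [e1, e2]
    set y := (b * x + a * ξ) / (a + b) with hy
    rw [← intervalIntegral.integral_add_adjacent_intervals (b := (x - ξ) / (a + b))
      (fromDiag_intervalIntegrable hs₂ hfm hfb _ _ _)
      (fromDiag_intervalIntegrable hs₂ hfm hfb _ _ _), add_assoc]
    congr 2
    have := intervalIntegral.integral_comp_add_right (a := 0) (b := r)
      (fun s => f (y + a * s, y - b * s) * s₂ (y - b * s)) ((x - ξ) / (a + b))
    rw [zero_add] at this
    rw [← this]
    refine intervalIntegral.integral_congr fun s _ => ?_
    have e3 : y + a * (s + (x - ξ) / (a + b)) = x + a * s := by rw [hy]; field_simp; ring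
    have e4 : y - b * (s + (x - ξ) / (a + b)) = ξ + -b * s := by rw [hy]; field_simp; ring
    simp only [e3, e4]
  · intro x _
    simp only [hG, fromDiag, sub_self, zero_div, intervalIntegral.integral_same, add_zero]
    congr 1
    field_simp
    ring
  · intro x hx
    simp only
    rw [← hfix (x, 0) ⟨le_rfl, hx.1, hx.2⟩]
    simp [fromBottom]

theorem triangle_segment {x ξ a b r s : ℝ} (h1 : (x, ξ) ∈ triangle)
    (h2 : (x + a * r, ξ + b * r) ∈ triangle) (hs0 : 0 ≤ s) (hsr : s ≤ r) :
    (x + a * s, ξ + b * s) ∈ triangle := by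
  rcases hs0.eq_or_lt with rfl | hs
  · simpa using h1
  have hr : 0 < r := hs.trans_le hsr
  obtain ⟨h10, h11, h12⟩ := h1
  obtain ⟨h20, h21, h22⟩ := h2
  simp only at h10 h11 h12 h20 h21 h22
  set t := s / r with ht
  have hst : s = t * r := by rw [ht]; field_simp
  have ht0 : 0 ≤ t := by positivity
  have ht1 : 0 ≤ 1 - t := by rw [ht, sub_nonneg, div_le_one hr]; exact hsr
  refine ⟨?_, ?_, ?_⟩ <;> simp only <;> rw [hst]
  · have := add_nonneg (mul_nonneg ht0 h20) (mul_nonneg ht1 h10)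
    linarith
  · have := add_le_add (mul_le_mul_of_nonneg_left h21 ht0) (mul_le_mul_of_nonneg_left h11 ht1)
    linarith
  · have := add_le_add (mul_le_mul_of_nonneg_left h22 ht0) (mul_le_mul_of_nonneg_left h12 ht1)
    linarith

/-- Only the values on the triangle matter for the transport equation. -/
theorem SolvesTransport.congr {a b : ℝ} {f g f' g' : ℝ → ℝ → ℝ} (h : SolvesTransport a b f g)
    (hf : ∀ x ξ, (x, ξ) ∈ triangle → f x ξ = f' x ξ)
    (hg : ∀ x ξ, (x, ξ) ∈ triangle → g x ξ = g' x ξ) : SolvesTransport a b f' g' := by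
  intro x ξ r hr h1 h2
  rw [← hf _ _ h1, ← hf _ _ h2, h x ξ r hr h1 h2]
  congr 1
  refine intervalIntegral.integral_congr fun s hs => ?_
  rw [uIcc_of_le hr] at hs
  exact hg _ _ (triangle_segment h1 h2 hs.1 hs.2)

theorem indicator_bddMeas {σ : ℝ → ℝ} (hσ : Measurable σ)
    (hb : ∃ M : ℝ, ∀ x ∈ Icc (0 : ℝ) 1, |σ x| ≤ M) :
    BddMeas₁ ((Icc (0 : ℝ) 1).indicator σ) := by
  obtain ⟨M, hM⟩ := hb
  refine ⟨hσ.indicator measurableSet_Icc, max M 0, fun x => ?_⟩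
  by_cases hx : x ∈ Icc (0 : ℝ) 1
  · rw [indicator_of_mem hx]
    exact (hM x hx).trans (le_max_left _ _)
  · rw [indicator_of_notMem hx, abs_zero]
    exact le_max_right _ _

/-- The kernel equations decouple into two transport pairs. -/
theorem exists_backsteppingKernel (S : HypSystem) (hlam : 0 < S.lam) (hmu : 0 < S.mu)
    (hq : S.q ≠ 0) (hPM : Measurable S.sPM) (hPM_bdd : ∃ M : ℝ, ∀ x ∈ Icc (0 : ℝ) 1, |S.sPM x| ≤ M)
    (hMP : Measurable S.sMP) (hMP_bdd : ∃ M : ℝ, ∀ x ∈ Icc (0 : ℝ) 1, |S.sMP x| ≤ M) :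
    ∃ k : Kernels, IsBacksteppingKernel S k := by
  have hp := indicator_bddMeas hPM hPM_bdd
  have hm := indicator_bddMeas hMP hMP_bdd
  have hmem : ∀ {x ξ : ℝ}, (x, ξ) ∈ triangle → ξ ∈ Icc (0 : ℝ) 1 :=
    fun h => ⟨h.1, h.2.1.trans h.2.2⟩
  -- the condition at `ξ = 0` for the first pair is solved for `K^{uu}`, which needs `q ≠ 0`
  obtain ⟨uu, uv, huu, huv, e1, e2, e3, e4⟩ := exists_transport_pair (S.mu / (S.lam * S.q))
    hlam hmu hm.neg hp.neg (hp.div_const (S.lam + S.mu))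
  obtain ⟨vv, vu, hvv, hvu, e5, e6, e7, e8⟩ := exists_transport_pair (S.lam * S.q / S.mu)
    hmu hlam hp hm (hm.div_const (S.lam + S.mu)).neg
  refine ⟨⟨uu, uv, vu, vv⟩, ⟨⟨huu, huv, hvu, hvv⟩, ?_, ?_, ?_, ?_, ?_, e8, ?_, ?_⟩⟩
  · refine e1.congr (fun _ _ _ => rfl) fun x ξ h => ?_
    simp only [indicator_of_mem (hmem h)]; ring
  · refine e2.congr (fun _ _ _ => rfl) fun x ξ h => ?_
    simp only [indicator_of_mem (hmem h)]; ring
  · refine e6.congr (fun _ _ _ => rfl) fun x ξ h => ?_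
    simp only [indicator_of_mem (hmem h)]
  · refine e5.congr (fun _ _ _ => rfl) fun x ξ h => ?_
    simp only [indicator_of_mem (hmem h)]
  · intro x hx
    simpa only [indicator_of_mem hx] using e7 x hx
  · intro x hx
    simpa only [indicator_of_mem hx] using e3 x hx
  · intro x hx
    simp only
    rw [e4 x hx]
    field_simp

/-! ### The inverse of a Volterra operator -/

section intOp
variable {κ ℓ : ℝ → ℝ → ℝ} {f g : ℝ → ℝ}

theorem intOp_congr_ae (κ : ℝ → ℝ → ℝ) (h : f =ᵐ[m01] g) (x : ℝ) : intOp κ f x = intOp κ g x :=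
  integral_congr_ae (h.mono fun ξ hξ => by simp only [hξ])

theorem intOp_add (h : BddMeas₂ κ) (hf : Integrable f m01) (hg : Integrable g m01) (x : ℝ) :
    intOp κ (fun y => f y + g y) x = intOp κ f x + intOp κ g x := by
  simp only [intOp, mul_add]
  exact integral_add ((h.left x).integrable_mul hf) ((h.left x).integrable_mul hg)

theorem intOp_sub (h : BddMeas₂ κ) (hf : Integrable f m01) (hg : Integrable g m01) (x : ℝ) :
    intOp κ (fun y => f y - g y) x = intOp κ f x - intOp κ g x := by
  simp only [intOp, mul_sub]
  exact integral_sub ((h.left x).integrable_mul hf) ((h.left x).integrable_mul hg)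

theorem intOp_add_kernel (h : BddMeas₂ κ) (h' : BddMeas₂ ℓ) (hf : Integrable f m01) (x : ℝ) :
    intOp (fun x y => κ x y + ℓ x y) f x = intOp κ f x + intOp ℓ f x := by
  simp only [intOp, add_mul]
  exact integral_add ((h.left x).integrable_mul hf) ((h'.left x).integrable_mul hf)

/-- The composition of two kernels. -/
def kerComp (κ ℓ : ℝ → ℝ → ℝ) (x ξ : ℝ) : ℝ := ∫ s, κ x s * ℓ s ξ ∂m01

theorem kerComp_bddMeas (h : BddMeas₂ κ) (h' : BddMeas₂ ℓ) : BddMeas₂ (kerComp κ ℓ) := by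
  obtain ⟨M, hM0, hM⟩ := h.exists_pos
  obtain ⟨N, hN0, hN⟩ := h'.exists_pos
  have h1 := h.meas
  have h2 := h'.meas
  refine ⟨?_, M * N, fun x ξ => ?_⟩
  · have : Measurable fun q : (ℝ × ℝ) × ℝ => κ q.1.1 q.2 * ℓ q.2 q.1.2 :=
      (h1.comp (by fun_prop : Measurable fun q : (ℝ × ℝ) × ℝ => (q.1.1, q.2))).mul
        (h2.comp (by fun_prop : Measurable fun q : (ℝ × ℝ) × ℝ => (q.2, q.1.2)))
    exact (this.stronglyMeasurable.integral_prod_right' (ν := m01)).measurable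
  · have := norm_integral_le_of_norm_le_const (μ := m01) (C := M * N)
      (f := fun s => κ x s * ℓ s ξ) (Filter.Eventually.of_forall fun s => by
        rw [norm_mul]; exact mul_le_mul (hM _ _) (hN _ _) (norm_nonneg _) hM0.le)
    simpa [Measure.real, kerComp] using this

theorem kerComp_tri (h : TriKernel κ) (h' : TriKernel ℓ) : TriKernel (kerComp κ ℓ) := by
  refine ⟨kerComp_bddMeas h.toBddMeas₂ h'.toBddMeas₂, fun x ξ hx => ?_⟩
  refine integral_eq_zero_of_ae (Filter.Eventually.of_forall fun s => ?_)
  by_cases h1 : (x, s) ∈ triangle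
  · by_cases h2 : (s, ξ) ∈ triangle
    · exact absurd ⟨h2.1, h2.2.1.trans h1.2.1, h1.2.2⟩ hx
    · simp [h'.supp _ _ h2]
  · simp [h.supp _ _ h1]

theorem intOp_intOp (h : BddMeas₂ κ) (h' : BddMeas₂ ℓ) (hf : Integrable f m01) (x : ℝ) :
    intOp κ (intOp ℓ f) x = intOp (kerComp κ ℓ) f x := by
  have := integral_intOp_mul h' hf ((h.left x).integrable m01)
  simp only [mul_comm (intOp ℓ f _), mul_comm (f _)] at this
  rw [intOp, this, intOp]
  refine integral_congr_ae (Filter.Eventually.of_forall fun ξ => ?_)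
  simp only [kerComp, adjOp, mul_comm]

end intOp

/-- All four kernels are extended by zero. -/
def Kernels.cut (k : Kernels) : Kernels := ⟨cutTri k.uu, cutTri k.uv, cutTri k.vu, cutTri k.vv⟩

/-- All four kernels are globally measurable, bounded and supported in the triangle. -/
structure Kernels.Tri (k : Kernels) : Prop where
  uu : TriKernel k.uu
  uv : TriKernel k.uv
  vu : TriKernel k.vu
  vv : TriKernel k.vv

theorem Kernels.BddMeas.cut {k : Kernels} (h : k.BddMeas) : k.cut.Tri :=
  ⟨cutTri_triKernel h.1, cutTri_triKernel h.2.1, cutTri_triKernel h.2.2.1, cutTri_triKernel h.2.2.2⟩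

/-- First component of the operator with kernels `k`, as an integral over `[0,1]`. -/
def Kernels.op₁ (k : Kernels) (f g : ℝ → ℝ) (x : ℝ) : ℝ := intOp k.uu f x + intOp k.uv g x

/-- Second component of the operator with kernels `k`, as an integral over `[0,1]`. -/
def Kernels.op₂ (k : Kernels) (f g : ℝ → ℝ) (x : ℝ) : ℝ := intOp k.vu f x + intOp k.vv g x

theorem intervalIntegral_cutTri {a b : ℝ → ℝ → ℝ} (ha : BddMeasKernel a) (hb : BddMeasKernel b)
    {f g : ℝ → ℝ} (hf : Integrable f m01) (hg : Integrable g m01) {x : ℝ}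
    (hx : x ∈ Icc (0 : ℝ) 1) :
    ∫ ξ in (0 : ℝ)..x, (a x ξ * f ξ + b x ξ * g ξ) =
      intOp (cutTri a) f x + intOp (cutTri b) g x := by
  have h1 := cutTri_triKernel ha
  have h2 := cutTri_triKernel hb
  rw [intervalIntegral_tri (κ := fun x ξ => a x ξ * f ξ + b x ξ * g ξ)
    (f := fun x ξ => cutTri a x ξ * f ξ + cutTri b x ξ * g ξ) ?_ ?_ hx]
  · exact integral_add ((h1.left x).integrable_mul hf) ((h2.left x).integrable_mul hg)
  · intro x ξ h
    simp [h1.supp _ _ h, h2.supp _ _ h]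
  · intro x ξ h
    simp only [cutTri_of_mem h]

theorem Kernels.fst_eq {k : Kernels} (hk : k.BddMeas) {f g : ℝ → ℝ} (hf : Integrable f m01)
    (hg : Integrable g m01) {x : ℝ} (hx : x ∈ Icc (0 : ℝ) 1) : k.fst f g x = k.cut.op₁ f g x :=
  intervalIntegral_cutTri hk.1 hk.2.1 hf hg hx

theorem Kernels.snd_eq {k : Kernels} (hk : k.BddMeas) {f g : ℝ → ℝ} (hf : Integrable f m01)
    (hg : Integrable g m01) {x : ℝ} (hx : x ∈ Icc (0 : ℝ) 1) : k.snd f g x = k.cut.op₂ f g x :=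
  intervalIntegral_cutTri hk.2.2.1 hk.2.2.2 hf hg hx

theorem integral_indicator_exp_le {γ x : ℝ} (hγ : 0 < γ) (hx : 0 ≤ x) :
    ∫ s, (Iic x).indicator (fun s => Real.exp (γ * s)) s ∂m01 ≤ Real.exp (γ * x) / γ := by
  have hc : Continuous fun s => Real.exp (γ * s) := by fun_prop
  rw [integral_indicator measurableSet_Iic, Measure.restrict_restrict measurableSet_Iic]
  have h1 : ∫ s in Iic x ∩ Icc 0 1, Real.exp (γ * s) ≤ ∫ s in Icc 0 x, Real.exp (γ * s) :=
    setIntegral_mono_set (hc.integrableOn_Icc)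
      (Filter.Eventually.of_forall fun s => (Real.exp_pos _).le)
      (Filter.Eventually.of_forall fun s hs => ⟨hs.2.1, hs.1⟩)
  refine h1.trans ?_
  rw [integral_Icc_eq_integral_Ioc, ← intervalIntegral.integral_of_le hx]
  have := integral_exp_affine_le hγ one_pos 0 x
  simpa using this

/-- The exponential weight `exp (γ x)` absorbs Volterra operators. -/
theorem abs_integral_le_exp {M γ C x : ℝ} (hγ : 0 < γ) (hx : 0 ≤ x) (hM : 0 ≤ M) (hC : 0 ≤ C)
    {h : ℝ → ℝ} (h0 : ∀ s, x < s → h s = 0)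
    (hb : ∀ s ∈ Icc (0 : ℝ) 1, s ≤ x → |h s| ≤ M * (C * Real.exp (γ * s))) :
    |∫ s, h s ∂m01| ≤ M / γ * (C * Real.exp (γ * x)) := by
  have hint : Integrable (fun s => M * C * (Iic x).indicator (fun s => Real.exp (γ * s)) s) m01 :=
    (((by fun_prop : Continuous fun s => Real.exp (γ * s)).integrableOn_Icc).indicator
      measurableSet_Iic).const_mul _
  have h1 : |∫ s, h s ∂m01| ≤
      ∫ s, M * C * (Iic x).indicator (fun s => Real.exp (γ * s)) s ∂m01 := by
    rw [← Real.norm_eq_abs]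
    refine norm_integral_le_of_norm_le hint ?_
    filter_upwards [ae_restrict_mem measurableSet_Icc] with s hs
    by_cases hsx : s ≤ x
    · rw [indicator_of_mem (by exact hsx), Real.norm_eq_abs, mul_assoc]
      exact hb s hs hsx
    · rw [h0 s (not_le.1 hsx), norm_zero]
      exact mul_nonneg (by positivity) (indicator_nonneg (fun _ _ => (Real.exp_pos _).le) _)
  refine h1.trans ?_
  rw [integral_const_mul]
  calc _ ≤ M * C * (Real.exp (γ * x) / γ) :=
        mul_le_mul_of_nonneg_left (integral_indicator_exp_le hγ hx) (by positivity)
    _ = _ := by ring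

/-- A common bound for the four kernels. -/
theorem Kernels.Tri.exists_bound {k : Kernels} (h : k.Tri) : ∃ M, 0 < M ∧
    (∀ x ξ, |k.uu x ξ| ≤ M) ∧ (∀ x ξ, |k.uv x ξ| ≤ M) ∧ (∀ x ξ, |k.vu x ξ| ≤ M) ∧
      ∀ x ξ, |k.vv x ξ| ≤ M := by
  obtain ⟨M1, h1, hM1⟩ := h.uu.exists_pos
  obtain ⟨M2, h2, hM2⟩ := h.uv.exists_pos
  obtain ⟨M3, h3, hM3⟩ := h.vu.exists_pos
  obtain ⟨M4, h4, hM4⟩ := h.vv.exists_pos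
  exact ⟨M1 + M2 + M3 + M4, by positivity, fun x ξ => (hM1 x ξ).trans (by linarith),
    fun x ξ => (hM2 x ξ).trans (by linarith), fun x ξ => (hM3 x ξ).trans (by linarith),
    fun x ξ => (hM4 x ξ).trans (by linarith)⟩

/-- One column of the resolvent equation `L = K + K L`. -/
theorem Kernels.Tri.exists_resolvent_column {k : Kernels} (h : k.Tri) {a b : ℝ → ℝ → ℝ}
    (ha : TriKernel a) (hb : TriKernel b) : ∃ X Y : ℝ → ℝ → ℝ, TriKernel X ∧ TriKernel Y ∧
      (∀ x ξ, X x ξ = a x ξ + (kerComp k.uu X x ξ + kerComp k.uv Y x ξ)) ∧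
      ∀ x ξ, Y x ξ = b x ξ + (kerComp k.vu X x ξ + kerComp k.vv Y x ξ) := by
  obtain ⟨M, hM0, hM1, hM2, hM3, hM4⟩ := h.exists_bound
  have bm : ∀ f : ℝ × ℝ → ℝ × ℝ, Measurable f → (∃ M, ∀ p, ‖f p‖ ≤ M) →
      BddMeas₂ (fun x y => (f (x, y)).1) ∧ BddMeas₂ (fun x y => (f (x, y)).2) := by
    rintro f hf ⟨N, hN⟩
    exact ⟨⟨hf.fst, N, fun x y => (norm_fst_le _).trans (hN _)⟩,
      ⟨hf.snd, N, fun x y => (norm_snd_le _).trans (hN _)⟩⟩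
  have tri : ∀ f : ℝ × ℝ → ℝ × ℝ, Measurable f → (∃ M, ∀ p, ‖f p‖ ≤ M) →
      (∀ p, p ∉ triangle → f p = 0) →
      TriKernel (fun x y => (f (x, y)).1) ∧ TriKernel (fun x y => (f (x, y)).2) :=
    fun f hf hfb hf0 => ⟨⟨(bm f hf hfb).1, fun x ξ hx => by simp only [hf0 _ hx, Prod.fst_zero]⟩,
      ⟨(bm f hf hfb).2, fun x ξ hx => by simp only [hf0 _ hx, Prod.snd_zero]⟩⟩
  have est : ∀ κ ℓ : ℝ → ℝ → ℝ, TriKernel κ → TriKernel ℓ → (∀ x ξ, |κ x ξ| ≤ M) →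
      (∀ x ξ, |ℓ x ξ| ≤ M) → ∀ f g : ℝ × ℝ → ℝ × ℝ, Measurable f → (∃ M, ∀ p, ‖f p‖ ≤ M) →
      (∀ p, p ∉ triangle → f p = 0) → Measurable g → (∃ M, ∀ p, ‖g p‖ ≤ M) →
      (∀ p, p ∉ triangle → g p = 0) → ∀ C : ℝ, 0 ≤ C →
      (∀ p ∈ triangle, ‖f p - g p‖ ≤ C * Real.exp (4 * M * p.1)) → ∀ x ξ, (x, ξ) ∈ triangle →
      |(kerComp κ (fun x y => (f (x, y)).1) x ξ + kerComp ℓ (fun x y => (f (x, y)).2) x ξ) -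
        (kerComp κ (fun x y => (g (x, y)).1) x ξ + kerComp ℓ (fun x y => (g (x, y)).2) x ξ)| ≤
        1 / 2 * (C * Real.exp (4 * M * x)) := by
    intro κ ℓ hκ hℓ hκM hℓM f g hf hfb hf0 hg hgb hg0 C hC hfg x ξ hx
    have i1 := fun (κ : ℝ → ℝ → ℝ) (hκ : TriKernel κ) (X : ℝ → ℝ → ℝ) (hX : BddMeas₂ X) =>
      ((hκ.left x).mul (hX.right ξ)).integrable m01
    have i2 := fun (f : ℝ × ℝ → ℝ × ℝ) (hf : Measurable f) (hfb : ∃ M, ∀ p, ‖f p‖ ≤ M) =>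
      (((hκ.left x).mul ((bm f hf hfb).1.right ξ)).add
        ((hℓ.left x).mul ((bm f hf hfb).2.right ξ))).integrable m01
    simp only [kerComp]
    rw [← integral_add (i1 κ hκ _ (bm f hf hfb).1) (i1 ℓ hℓ _ (bm f hf hfb).2),
      ← integral_add (i1 κ hκ _ (bm g hg hgb).1) (i1 ℓ hℓ _ (bm g hg hgb).2),
      ← integral_sub (i2 f hf hfb) (i2 g hg hgb)]
    have key := abs_integral_le_exp (M := 2 * M) (γ := 4 * M) (C := C) (x := x)
      (h := fun s => (κ x s * (f (s, ξ)).1 + ℓ x s * (f (s, ξ)).2) -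
        (κ x s * (g (s, ξ)).1 + ℓ x s * (g (s, ξ)).2)) (by positivity) (hx.1.trans hx.2.1)
      (by positivity) hC
      (fun s hs => by
        have : (x, s) ∉ triangle := fun h => absurd h.2.1 (not_le.2 hs)
        simp [hκ.supp _ _ this, hℓ.supp _ _ this])
      (fun s hs hsx => by
        by_cases hsξ : (s, ξ) ∈ triangle
        · have h1 : |(f (s, ξ)).1 - (g (s, ξ)).1| ≤ C * Real.exp (4 * M * s) :=
            (norm_fst_le (f (s, ξ) - g (s, ξ))).trans (hfg _ hsξ)
          have h2 : |(f (s, ξ)).2 - (g (s, ξ)).2| ≤ C * Real.exp (4 * M * s) :=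
            (norm_snd_le (f (s, ξ) - g (s, ξ))).trans (hfg _ hsξ)
          calc _ = |κ x s * ((f (s, ξ)).1 - (g (s, ξ)).1) +
                ℓ x s * ((f (s, ξ)).2 - (g (s, ξ)).2)| := by congr 1; ring
            _ ≤ |κ x s| * |(f (s, ξ)).1 - (g (s, ξ)).1| +
                |ℓ x s| * |(f (s, ξ)).2 - (g (s, ξ)).2| := by
                  rw [← abs_mul, ← abs_mul]; exact abs_add_le _ _
            _ ≤ M * (C * Real.exp (4 * M * s)) + M * (C * Real.exp (4 * M * s)) :=
                add_le_add (mul_le_mul (hκM _ _) h1 (abs_nonneg _) hM0.le)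
                  (mul_le_mul (hℓM _ _) h2 (abs_nonneg _) hM0.le)
            _ = _ := by ring
        · rw [hf0 _ hsξ, hg0 _ hsξ, sub_self, abs_zero]; positivity)
    refine key.trans (le_of_eq ?_)
    rw [show 2 * M / (4 * M) = 1 / 2 by field_simp; norm_num]
  obtain ⟨f, hf, hfb, hf0, hfix⟩ := exists_measurable_fixedPoint (E := ℝ × ℝ) measurableSet_triangle
    (fun f p => (a p.1 p.2 + (kerComp k.uu (fun x y => (f (x, y)).1) p.1 p.2 +
        kerComp k.uv (fun x y => (f (x, y)).2) p.1 p.2),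
      b p.1 p.2 + (kerComp k.vu (fun x y => (f (x, y)).1) p.1 p.2 +
        kerComp k.vv (fun x y => (f (x, y)).2) p.1 p.2)))
    (fun p => Real.exp (4 * M * p.1)) (Real.exp (4 * M))
    (fun p hp => ⟨Real.one_le_exp (mul_nonneg (by positivity) (hp.1.trans hp.2.1)),
      Real.exp_le_exp.2 (mul_le_of_le_one_right (by positivity) hp.2.2)⟩)
    (θ := 1 / 2) (by norm_num) (by norm_num)
    (by
      intro f hf hfb _
      obtain ⟨b1, b2⟩ := bm f hf hfb
      have c1 := ha.toBddMeas₂.add ((kerComp_bddMeas h.uu.toBddMeas₂ b1).add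
        (kerComp_bddMeas h.uv.toBddMeas₂ b2))
      have c2 := hb.toBddMeas₂.add ((kerComp_bddMeas h.vu.toBddMeas₂ b1).add
        (kerComp_bddMeas h.vv.toBddMeas₂ b2))
      refine ⟨c1.meas.prodMk c2.meas, ?_⟩
      obtain ⟨N1, hN1⟩ := c1.bdd
      obtain ⟨N2, hN2⟩ := c2.bdd
      exact ⟨max N1 N2, fun p _ => max_le_max (hN1 p.1 p.2) (hN2 p.1 p.2)⟩)
    (by
      intro f g hf hfb hf0 hg hgb hg0 C hC hfg p hp
      refine max_le ?_ ?_
      · simp only [Prod.fst_sub, add_sub_add_left_eq_sub]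
        exact est k.uu k.uv h.uu h.uv hM1 hM2 f g hf hfb hf0 hg hgb hg0 C hC hfg p.1 p.2 hp
      · simp only [Prod.snd_sub, add_sub_add_left_eq_sub]
        exact est k.vu k.vv h.vu h.vv hM3 hM4 f g hf hfb hf0 hg hgb hg0 C hC hfg p.1 p.2 hp)
  obtain ⟨t1, t2⟩ := tri f hf hfb hf0
  refine ⟨_, _, t1, t2, fun x ξ => ?_, fun x ξ => ?_⟩
  · by_cases hx : (x, ξ) ∈ triangle
    · exact congrArg Prod.fst (hfix _ hx).symm
    · rw [(kerComp_tri h.uu t1).supp _ _ hx, (kerComp_tri h.uv t2).supp _ _ hx, ha.supp _ _ hx]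
      simp [hf0 _ hx]
  · by_cases hx : (x, ξ) ∈ triangle
    · exact congrArg Prod.snd (hfix _ hx).symm
    · rw [(kerComp_tri h.vu t1).supp _ _ hx, (kerComp_tri h.vv t2).supp _ _ hx, hb.supp _ _ hx]
      simp [hf0 _ hx]

theorem Kernels.Tri.op₁_bddMeas {k : Kernels} (h : k.Tri) {f g : ℝ → ℝ} (hf : Integrable f m01)
    (hg : Integrable g m01) : BddMeas₁ (k.op₁ f g) :=
  (intOp_bddMeas h.uu.toBddMeas₂ hf).add (intOp_bddMeas h.uv.toBddMeas₂ hg)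

theorem Kernels.Tri.op₂_bddMeas {k : Kernels} (h : k.Tri) {f g : ℝ → ℝ} (hf : Integrable f m01)
    (hg : Integrable g m01) : BddMeas₁ (k.op₂ f g) :=
  (intOp_bddMeas h.vu.toBddMeas₂ hf).add (intOp_bddMeas h.vv.toBddMeas₂ hg)

/-- `L = K + K L` as an identity between operators. -/
theorem Kernels.Tri.exists_resolvent {k : Kernels} (h : k.Tri) : ∃ l : Kernels, l.Tri ∧
    ∀ α β : ℝ → ℝ, Integrable α m01 → Integrable β m01 → ∀ x,
      k.op₁ (fun y => α y + l.op₁ α β y) (fun y => β y + l.op₂ α β y) x = l.op₁ α β x ∧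
      k.op₂ (fun y => α y + l.op₁ α β y) (fun y => β y + l.op₂ α β y) x = l.op₂ α β x := by
  obtain ⟨X₁, Y₁, hX₁, hY₁, e1, e2⟩ := h.exists_resolvent_column h.uu h.vu
  obtain ⟨X₂, Y₂, hX₂, hY₂, e3, e4⟩ := h.exists_resolvent_column h.uv h.vv
  refine ⟨⟨X₁, X₂, Y₁, Y₂⟩, ⟨hX₁, hX₂, hY₁, hY₂⟩, fun α β hα hβ x => ?_⟩
  have aux : ∀ a b X Y X' Y' X'' Y'' : ℝ → ℝ → ℝ, TriKernel a → TriKernel b → TriKernel X →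
      TriKernel Y → TriKernel X' → TriKernel Y' →
      (∀ x ξ, X'' x ξ = a x ξ + (kerComp a X x ξ + kerComp b Y x ξ)) →
      (∀ x ξ, Y'' x ξ = b x ξ + (kerComp a X' x ξ + kerComp b Y' x ξ)) →
      intOp a (fun y => α y + (intOp X α y + intOp X' β y)) x +
        intOp b (fun y => β y + (intOp Y α y + intOp Y' β y)) x =
          intOp X'' α x + intOp Y'' β x := by
    intro a b X Y X' Y' X'' Y'' ha hb hX hY hX' hY' hX'' hY''
    have ia := ha.toBddMeas₂
    have ib := hb.toBddMeas₂
    have iX := (intOp_bddMeas hX.toBddMeas₂ hα).integrable m01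
    have iX' := (intOp_bddMeas hX'.toBddMeas₂ hβ).integrable m01
    have iY := (intOp_bddMeas hY.toBddMeas₂ hα).integrable m01
    have iY' := (intOp_bddMeas hY'.toBddMeas₂ hβ).integrable m01
    have iXX : Integrable (fun y => intOp X α y + intOp X' β y) m01 := iX.add iX'
    have iYY : Integrable (fun y => intOp Y α y + intOp Y' β y) m01 := iY.add iY'
    rw [intOp_add ia hα iXX, intOp_add ib hβ iYY, intOp_add ia iX iX',
      intOp_add ib iY iY', intOp_intOp ia hX.toBddMeas₂ hα, intOp_intOp ia hX'.toBddMeas₂ hβ,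
      intOp_intOp ib hY.toBddMeas₂ hα, intOp_intOp ib hY'.toBddMeas₂ hβ]
    have fX : X'' = fun x ξ => a x ξ + (kerComp a X x ξ + kerComp b Y x ξ) := by
      funext x ξ; exact hX'' x ξ
    have fY : Y'' = fun x ξ => b x ξ + (kerComp a X' x ξ + kerComp b Y' x ξ) := by
      funext x ξ; exact hY'' x ξ
    have c1 := kerComp_bddMeas ia hX.toBddMeas₂
    have c2 := kerComp_bddMeas ib hY.toBddMeas₂
    have c3 := kerComp_bddMeas ia hX'.toBddMeas₂
    have c4 := kerComp_bddMeas ib hY'.toBddMeas₂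
    rw [fX, fY, intOp_add_kernel ia (c1.add c2) hα, intOp_add_kernel c1 c2 hα,
      intOp_add_kernel ib (c3.add c4) hβ, intOp_add_kernel c3 c4 hβ]
    ring
  exact ⟨aux k.uu k.uv X₁ Y₁ X₂ Y₂ X₁ X₂ h.uu h.uv hX₁ hY₁ hX₂ hY₂ e1 e3,
    aux k.vu k.vv X₁ Y₁ X₂ Y₂ Y₁ Y₂ h.vu h.vv hX₁ hY₁ hX₂ hY₂ e2 e4⟩

/-- A homogeneous Volterra equation has only the trivial solution. -/
theorem Kernels.Tri.eq_zero_of_fixed {k : Kernels} (h : k.Tri) {e₁ e₂ : ℝ → ℝ}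
    (i₁ : Integrable e₁ m01) (i₂ : Integrable e₂ m01)
    (h₁ : ∀ x ∈ Icc (0 : ℝ) 1, e₁ x = k.op₁ e₁ e₂ x)
    (h₂ : ∀ x ∈ Icc (0 : ℝ) 1, e₂ x = k.op₂ e₁ e₂ x) :
    ∀ x ∈ Icc (0 : ℝ) 1, e₁ x = 0 ∧ e₂ x = 0 := by
  obtain ⟨M, hM0, hM1, hM2, hM3, hM4⟩ := h.exists_bound
  obtain ⟨B₁, hB₁0, hB₁⟩ := (h.op₁_bddMeas i₁ i₂).exists_pos
  obtain ⟨B₂, hB₂0, hB₂⟩ := (h.op₂_bddMeas i₁ i₂).exists_pos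
  set C := B₁ + B₂
  have step : ∀ a b : ℝ → ℝ → ℝ, TriKernel a → TriKernel b → (∀ x ξ, |a x ξ| ≤ M) →
      (∀ x ξ, |b x ξ| ≤ M) → ∀ D : ℝ, 0 ≤ D →
      (∀ x ∈ Icc (0 : ℝ) 1, |e₁ x| ≤ D * Real.exp (4 * M * x) ∧
        |e₂ x| ≤ D * Real.exp (4 * M * x)) → ∀ x ∈ Icc (0 : ℝ) 1,
      |intOp a e₁ x + intOp b e₂ x| ≤ 1 / 2 * D * Real.exp (4 * M * x) := by
    intro a b ha hb haM hbM D hD hD' x hx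
    rw [intOp, intOp, ← integral_add ((ha.left x).integrable_mul i₁)
      ((hb.left x).integrable_mul i₂)]
    have key := abs_integral_le_exp (M := 2 * M) (γ := 4 * M) (C := D) (x := x)
      (h := fun s => a x s * e₁ s + b x s * e₂ s) (by positivity) hx.1 (by positivity) hD
      (fun s hs => by
        have : (x, s) ∉ triangle := fun h => absurd h.2.1 (not_le.2 hs)
        simp [ha.supp _ _ this, hb.supp _ _ this])
      (fun s hs _ => by
        calc _ ≤ |a x s| * |e₁ s| + |b x s| * |e₂ s| := by
              rw [← abs_mul, ← abs_mul]; exact abs_add_le _ _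
          _ ≤ M * (D * Real.exp (4 * M * s)) + M * (D * Real.exp (4 * M * s)) :=
              add_le_add (mul_le_mul (haM _ _) (hD' s hs).1 (abs_nonneg _) hM0.le)
                (mul_le_mul (hbM _ _) (hD' s hs).2 (abs_nonneg _) hM0.le)
          _ = _ := by ring)
    refine key.trans (le_of_eq ?_)
    rw [show 2 * M / (4 * M) = 1 / 2 by field_simp; norm_num]
    ring
  have ind : ∀ n : ℕ, ∀ x ∈ Icc (0 : ℝ) 1,
      |e₁ x| ≤ (1 / 2) ^ n * C * Real.exp (4 * M * x) ∧
        |e₂ x| ≤ (1 / 2) ^ n * C * Real.exp (4 * M * x) := by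
    intro n
    induction n with
    | zero =>
      intro x hx
      have he : C ≤ (1 / 2) ^ 0 * C * Real.exp (4 * M * x) := by
        rw [pow_zero, one_mul]
        exact le_mul_of_one_le_right (by positivity)
          (Real.one_le_exp (mul_nonneg (by positivity) hx.1))
      constructor
      · rw [h₁ x hx]; exact ((hB₁ x).trans (by simp only [C]; linarith)).trans he
      · rw [h₂ x hx]; exact ((hB₂ x).trans (by simp only [C]; linarith)).trans he
    | succ n ih =>
      intro x hx
      rw [pow_succ', mul_assoc (1 / 2 : ℝ)]
      constructor
      · rw [h₁ x hx]
        exact step _ _ h.uu h.uv hM1 hM2 _ (by positivity) ih x hx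
      · rw [h₂ x hx]
        exact step _ _ h.vu h.vv hM3 hM4 _ (by positivity) ih x hx
  intro x hx
  have hlim : Filter.Tendsto (fun n : ℕ => (1 / 2 : ℝ) ^ n * C * Real.exp (4 * M * x))
      Filter.atTop (nhds 0) := by
    have := (tendsto_pow_atTop_nhds_zero_of_lt_one (r := (1 / 2 : ℝ)) (by norm_num)
      (by norm_num)).mul_const (C * Real.exp (4 * M * x))
    simpa [mul_assoc] using this
  exact ⟨abs_eq_zero.1 (le_antisymm (ge_of_tendsto' hlim fun n => (ind n x hx).1) (abs_nonneg _)),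
    abs_eq_zero.1 (le_antisymm (ge_of_tendsto' hlim fun n => (ind n x hx).2) (abs_nonneg _))⟩

/-- The resolvent is a right inverse by construction; it is a left inverse because `1 - 𝒦` is
injective. -/
theorem exists_inverseKernel {k : Kernels} (hk : k.BddMeas) :
    ∃ l : Kernels, IsInverseKernel k l := by
  have hT := hk.cut
  obtain ⟨l, hl, hres⟩ := hT.exists_resolvent
  have hlb : l.BddMeas := ⟨hl.uu.bddMeasKernel, hl.uv.bddMeasKernel, hl.vu.bddMeasKernel,
    hl.vv.bddMeasKernel⟩
  have hcut : ∀ f : ℝ → ℝ → ℝ, TriKernel f → cutTri f = f := by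
    intro f hf
    funext x ξ
    by_cases h : (x, ξ) ∈ triangle
    · exact cutTri_of_mem h
    · rw [hf.supp _ _ h]; exact indicator_of_notMem h _
  have hlc : l.cut = l := by
    rw [Kernels.cut, hcut _ hl.uu, hcut _ hl.uv, hcut _ hl.vu, hcut _ hl.vv]
  have hl1 : ∀ {f g : ℝ → ℝ}, Integrable f m01 → Integrable g m01 → ∀ x ∈ Icc (0 : ℝ) 1,
      l.fst f g x = l.op₁ f g x := fun hf hg x hx => by rw [Kernels.fst_eq hlb hf hg hx, hlc]
  have hl2 : ∀ {f g : ℝ → ℝ}, Integrable f m01 → Integrable g m01 → ∀ x ∈ Icc (0 : ℝ) 1,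
      l.snd f g x = l.op₂ f g x := fun hf hg x hx => by rw [Kernels.snd_eq hlb hf hg hx, hlc]
  have ae01 : ∀ f g : ℝ → ℝ, (∀ x ∈ Icc (0 : ℝ) 1, f x = g x) → f =ᵐ[m01] g := fun f g h =>
    (ae_restrict_mem measurableSet_Icc).mono h
  -- `(1 - K)(1 + L) = 1`
  have right : ∀ α β : ℝ → ℝ, IntegrableOn α (Icc 0 1) → IntegrableOn β (Icc 0 1) →
      ∀ x ∈ Icc (0 : ℝ) 1,
        k.fst (fun y => α y + l.fst α β y) (fun y => β y + l.snd α β y) x = l.fst α β x ∧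
        k.snd (fun y => α y + l.fst α β y) (fun y => β y + l.snd α β y) x = l.snd α β x := by
    intro α β hα hβ x hx
    have c1 := ae01 (fun y => α y + l.op₁ α β y) (fun y => α y + l.fst α β y)
      fun y hy => by simp only [hl1 hα hβ y hy]
    have c2 := ae01 (fun y => β y + l.op₂ α β y) (fun y => β y + l.snd α β y)
      fun y hy => by simp only [hl2 hα hβ y hy]
    have i1 := (Integrable.add hα ((hl.op₁_bddMeas hα hβ).integrable m01)).congr c1
    have i2 := (Integrable.add hβ ((hl.op₂_bddMeas hα hβ).integrable m01)).congr c2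
    rw [Kernels.fst_eq hk i1 i2 hx, Kernels.snd_eq hk i1 i2 hx, hl1 hα hβ x hx, hl2 hα hβ x hx,
      ← (hres α β hα hβ x).1, ← (hres α β hα hβ x).2]
    simp only [Kernels.op₁, Kernels.op₂]
    exact ⟨congrArg₂ _ (intOp_congr_ae _ c1.symm x) (intOp_congr_ae _ c2.symm x),
      congrArg₂ _ (intOp_congr_ae _ c1.symm x) (intOp_congr_ae _ c2.symm x)⟩
  refine ⟨l, hlb, fun α β hα hβ x hx => ?_, fun u v hu hv => ?_⟩
  · obtain ⟨r1, r2⟩ := right α β hα hβ x hx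
    rw [r1, r2]
    constructor <;> ring
  · -- `1 - K` is injective, and it takes the same value at `(u, v)` and at `(1 + L)(1 - K)(u, v)`
    set α : ℝ → ℝ := fun y => u y - k.fst u v y with hα_def
    set β : ℝ → ℝ := fun y => v y - k.snd u v y with hβ_def
    have hα : IntegrableOn α (Icc 0 1) :=
      (Integrable.sub hu ((hT.op₁_bddMeas hu hv).integrable m01)).congr
        (ae01 (fun y => u y - k.cut.op₁ u v y) _ fun y hy => by
          simp only [hα_def, Kernels.fst_eq hk hu hv hy])
    have hβ : IntegrableOn β (Icc 0 1) :=
      (Integrable.sub hv ((hT.op₂_bddMeas hu hv).integrable m01)).congr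
        (ae01 (fun y => v y - k.cut.op₂ u v y) _ fun y hy => by
          simp only [hβ_def, Kernels.snd_eq hk hu hv hy])
    set w₁ : ℝ → ℝ := fun y => α y + l.fst α β y with hw₁
    set w₂ : ℝ → ℝ := fun y => β y + l.snd α β y with hw₂
    have hw₁i : Integrable w₁ m01 :=
      (Integrable.add hα ((hl.op₁_bddMeas hα hβ).integrable m01)).congr
        (ae01 (fun y => α y + l.op₁ α β y) _ fun y hy => by
          simp only [hw₁, hl1 hα hβ y hy])
    have hw₂i : Integrable w₂ m01 :=
      (Integrable.add hβ ((hl.op₂_bddMeas hα hβ).integrable m01)).congr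
        (ae01 (fun y => β y + l.op₂ α β y) _ fun y hy => by
          simp only [hw₂, hl2 hα hβ y hy])
    have hz := hT.eq_zero_of_fixed (e₁ := fun y => w₁ y - u y) (e₂ := fun y => w₂ y - v y)
      (hw₁i.sub hu) (hw₂i.sub hv)
      (fun x hx => by
        have r := (right α β hα hβ x hx).1
        rw [Kernels.fst_eq hk hw₁i hw₂i hx] at r
        rw [Kernels.op₁, intOp_sub hT.uu.toBddMeas₂ hw₁i hu, intOp_sub hT.uv.toBddMeas₂ hw₂i hv]
        have s := Kernels.fst_eq hk hu hv hx
        rw [Kernels.op₁] at r s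
        simp only [hw₁, hα_def] at r ⊢
        linarith)
      (fun x hx => by
        have r := (right α β hα hβ x hx).2
        rw [Kernels.snd_eq hk hw₁i hw₂i hx] at r
        rw [Kernels.op₂, intOp_sub hT.vu.toBddMeas₂ hw₁i hu, intOp_sub hT.vv.toBddMeas₂ hw₂i hv]
        have s := Kernels.snd_eq hk hu hv hx
        rw [Kernels.op₂] at r s
        simp only [hw₂, hβ_def] at r ⊢
        linarith)
    exact fun x hx => ⟨by have := (hz x hx).1; simp only [hw₁] at this; linarith,
      by have := (hz x hx).2; simp only [hw₂] at this; linarith⟩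

/-! ### The divergence theorem on the triangle -/

theorem integrable_of_bdd_of_support {H : ℝ × ℝ → ℝ} (hm : Measurable H) {M : ℝ}
    (hM : ∀ p, |H p| ≤ M) (hs : ∀ p : ℝ × ℝ, p ∉ Icc (0 : ℝ) 1 ×ˢ Icc (0 : ℝ) 1 → H p = 0) :
    Integrable H (volume.prod volume) := by
  rw [← integrableOn_iff_integrable_of_support_subset (s := Icc (0 : ℝ) 1 ×ˢ Icc (0 : ℝ) 1)
    (fun p hp => by_contra fun h => hp (hs p h))]
  refine Measure.integrableOn_of_bounded (M := M) ?_ hm.aestronglyMeasurable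
    (Filter.Eventually.of_forall hM)
  rw [Measure.prod_prod]
  simp

theorem integral_m01_of_support {f : ℝ → ℝ} (hf : ∀ x, x ∉ Icc (0 : ℝ) 1 → f x = 0) :
    ∫ x, f x ∂m01 = ∫ x, f x :=
  setIntegral_eq_integral_of_forall_compl_eq_zero hf

theorem TriKernel.eq_zero_of_lt {κ : ℝ → ℝ → ℝ} (h : TriKernel κ) {x ξ : ℝ} (hx : x < ξ) :
    κ x ξ = 0 := h.supp _ _ fun h' => absurd h'.2.1 (not_le.2 hx)

theorem TriKernel.eq_zero_of_one_lt {κ : ℝ → ℝ → ℝ} (h : TriKernel κ) {x ξ : ℝ} (hx : 1 < x) :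
    κ x ξ = 0 := h.supp _ _ fun h' => absurd h'.2.2 (not_le.2 hx)

theorem TriKernel.eq_zero_left {κ : ℝ → ℝ → ℝ} (h : TriKernel κ) {x ξ : ℝ}
    (hx : x ∉ Icc (0 : ℝ) 1) : κ x ξ = 0 := h.supp _ _ fun h' => hx ⟨h'.1.trans h'.2.1, h'.2.2⟩

theorem TriKernel.eq_zero_right {κ : ℝ → ℝ → ℝ} (h : TriKernel κ) {x ξ : ℝ}
    (hx : ξ ∉ Icc (0 : ℝ) 1) : κ x ξ = 0 := h.supp _ _ fun h' => hx ⟨h'.1, h'.2.1.trans h'.2.2⟩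

theorem TriKernel.integral_eq {κ : ℝ → ℝ → ℝ} (h : TriKernel κ) {ξ : ℝ} (hξ : ξ ≤ 1) :
    ∫ x, κ x ξ ∂m01 = ∫ x in ξ..1, κ x ξ := by
  rw [integral_m01_of_support fun x hx => h.eq_zero_left hx, intervalIntegral.integral_of_le hξ,
    ← integral_Icc_eq_integral_Ioc]
  refine (setIntegral_eq_integral_of_forall_compl_eq_zero fun x hx => ?_).symm
  by_cases h1 : x < ξ
  · exact h.eq_zero_of_lt h1
  · exact h.eq_zero_of_one_lt (not_le.1 fun h2 => hx ⟨not_lt.1 h1, h2⟩)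

/-- The restriction of a kernel to the part `ξ₀ ≤ ξ` of the triangle. -/
def upper (ξ₀ : ℝ) (G : ℝ → ℝ → ℝ) (p : ℝ × ℝ) : ℝ :=
  {p : ℝ × ℝ | ξ₀ ≤ p.2}.indicator (Function.uncurry G) p

theorem upper_measurable (ξ₀ : ℝ) {G : ℝ → ℝ → ℝ} (hG : BddMeas₂ G) : Measurable (upper ξ₀ G) :=
  hG.meas.indicator (measurableSet_le measurable_const measurable_snd)

theorem upper_bound (ξ₀ : ℝ) {G : ℝ → ℝ → ℝ} {M : ℝ} (hM : ∀ x y, |G x y| ≤ M) (p : ℝ × ℝ) :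
    |upper ξ₀ G p| ≤ M := by
  by_cases h : ξ₀ ≤ p.2
  · rw [upper, indicator_of_mem (by exact h)]; exact hM _ _
  · rw [upper, indicator_of_notMem (by exact h), abs_zero]; exact (abs_nonneg _).trans (hM 0 0)

theorem upper_of_le {ξ₀ : ℝ} {G : ℝ → ℝ → ℝ} {x s : ℝ} (h : ξ₀ ≤ s) :
    upper ξ₀ G (x, s) = G x s := indicator_of_mem (by exact h) _

theorem upper_of_lt {ξ₀ : ℝ} {G : ℝ → ℝ → ℝ} {x s : ℝ} (h : s < ξ₀) :
    upper ξ₀ G (x, s) = 0 := indicator_of_notMem (by exact not_le.2 h) _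

theorem upper_eq_zero {ξ₀ : ℝ} {G : ℝ → ℝ → ℝ} {x s : ℝ} (h : G x s = 0) :
    upper ξ₀ G (x, s) = 0 := by
  by_cases h' : ξ₀ ≤ s
  · rw [upper_of_le h', h]
  · exact upper_of_lt (not_le.1 h')

theorem integral_upper {ξ₀ : ℝ} (hξ₀ : ξ₀ ∈ Icc (0 : ℝ) 1) {G : ℝ → ℝ → ℝ} (hG : TriKernel G) :
    ∫ s in ξ₀..1, ∫ x, G x s ∂m01 = ∫ s, ∫ x, upper ξ₀ G (x, s) := by
  rw [intervalIntegral.integral_of_le hξ₀.2, ← integral_Icc_eq_integral_Ioc,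
    ← integral_indicator measurableSet_Icc]
  congr 1
  funext s
  by_cases hs : s ∈ Icc ξ₀ 1
  · rw [indicator_of_mem hs, integral_m01_of_support fun x hx => hG.eq_zero_left hx]
    congr 1
    funext x
    rw [upper_of_le hs.1]
  · rw [indicator_of_notMem hs]
    symm
    refine integral_eq_zero_of_ae (Filter.Eventually.of_forall fun x => ?_)
    by_cases h1 : s < ξ₀
    · exact upper_of_lt h1
    · refine upper_eq_zero (hG.eq_zero_right fun h2 => hs ⟨not_lt.1 h1, h2.2⟩)

/-- Divergence theorem for the field `F · (a, -b)` on the triangle `ξ₀ ≤ ξ ≤ x ≤ 1`, by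
integration along the characteristics that issue from the diagonal. -/
theorem divergence_from_diag {a b : ℝ} (ha : 0 < a) (hb : 0 < b) {F G : ℝ → ℝ → ℝ}
    (hF : TriKernel F) (hG : TriKernel G) (hFG : SolvesTransport a (-b) F G) {ξ₀ : ℝ}
    (hξ₀ : ξ₀ ∈ Icc (0 : ℝ) 1) :
    b * ∫ x, F x ξ₀ ∂m01 = (a + b) * (∫ s in ξ₀..1, F s s) - a * (∫ s in ξ₀..1, F 1 s) +
      ∫ s in ξ₀..1, ∫ x, G x s ∂m01 := by
  have hab : 0 < a + b := by positivity
  set H := upper ξ₀ G with hH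
  obtain ⟨M, hM⟩ := hG.bdd
  have hHm : Measurable H := upper_measurable ξ₀ hG.toBddMeas₂
  have hH0 : ∀ d r : ℝ, ¬(0 ≤ r ∧ ξ₀ ≤ d + -b * r ∧ d + a * r ≤ 1) →
      H (d + a * r, d + -b * r) = 0 := by
    intro d r h
    by_cases h1 : 0 ≤ r
    · by_cases h2 : ξ₀ ≤ d + -b * r
      · exact upper_eq_zero (hG.eq_zero_of_one_lt (not_le.1 fun h3 => h ⟨h1, h2, h3⟩))
      · exact upper_of_lt (not_le.1 h2)
    · refine upper_eq_zero (hG.eq_zero_of_lt ?_)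
      have := mul_neg_of_pos_of_neg ha (not_le.1 h1)
      have := mul_neg_of_pos_of_neg hb (not_le.1 h1)
      linarith
  -- the change of variables `(x, s) = (d + a r, d - b r)`
  have hcv : ∫ s, ∫ x, H (x, s) = (a + b) * ∫ d, ∫ r, H (d + a * r, d + -b * r) := by
    have h1 : ∀ s, ∫ x, H (x, s) = ((a + b) / b) * ∫ d, H (d + a * ((d - s) / b), s) := by
      intro s
      have e1 := Measure.integral_comp_mul_left (fun y => H (y - a * s / b, s)) ((a + b) / b)
      have e2 := integral_sub_right_eq_self (μ := volume) (fun y => H (y, s)) (a * s / b)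
      rw [← e2]
      have e3 : (fun d => H (d + a * ((d - s) / b), s)) =
          fun d => H ((a + b) / b * d - a * s / b, s) := by
        funext d
        congr 2
        field_simp
        ring
      rw [e3, e1, abs_of_pos (by positivity), smul_eq_mul, ← mul_assoc,
        mul_inv_cancel₀ (by positivity), one_mul]
    have h2 : ∀ d, ∫ s, H (d + a * ((d - s) / b), s) = b * ∫ r, H (d + a * r, d + -b * r) := by
      intro d
      have e1 := Measure.integral_comp_mul_left (fun y => H (d + a * ((d - y) / b), y)) (-b)
      have e2 := integral_add_left_eq_self (μ := volume)
        (fun y => H (d + a * ((d - y) / b), y)) d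
      have e3 := Measure.integral_comp_mul_left (fun y => H (d + a * ((d - (d + y)) / b), d + y))
        (-b)
      have e4 : (fun r => H (d + a * r, d + -b * r)) =
          fun r => H (d + a * ((d - (d + -b * r)) / b), d + -b * r) := by
        funext r
        congr 2
        field_simp
        ring
      rw [e4, e3, ← e2, smul_eq_mul, ← mul_assoc, abs_inv, abs_neg, abs_of_pos hb,
        mul_inv_cancel₀ hb.ne', one_mul]
    simp_rw [h1]
    rw [integral_const_mul, integral_integral_swap]
    · simp_rw [h2]
      rw [integral_const_mul, ← mul_assoc]
      congr 1
      field_simp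
    · refine integrable_of_bdd_of_support (M := M) (by fun_prop)
        (fun p => upper_bound ξ₀ hM _) fun p hp => ?_
      simp only [Function.uncurry]
      have e := hH0 p.2 ((p.2 - p.1) / b)
      have e' : p.2 + -b * ((p.2 - p.1) / b) = p.1 := by field_simp; ring
      rw [e'] at e
      refine e fun h => hp ⟨⟨hξ₀.1.trans h.2.1, ?_⟩, ?_, ?_⟩
      · have h3 : 0 ≤ p.2 - p.1 := by
          have := mul_nonneg h.1 hb.le
          rwa [div_mul_cancel₀ _ hb.ne'] at this
        have := mul_nonneg ha.le h.1
        linarith [h.2.2]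
      · have h3 : 0 ≤ p.2 - p.1 := by
          have := mul_nonneg h.1 hb.le
          rwa [div_mul_cancel₀ _ hb.ne'] at this
        linarith [hξ₀.1, h.2.1]
      · have := mul_nonneg ha.le h.1
        linarith [h.2.2]
  set R : ℝ → ℝ := fun d => min ((d - ξ₀) / b) ((1 - d) / a) with hR
  have hinner : ∀ d, ∫ r, H (d + a * r, d + -b * r) =
      (Icc ξ₀ 1).indicator (fun d => F (d + a * R d) (d + -b * R d) - F d d) d := by
    intro d
    by_cases hd : d ∈ Icc ξ₀ 1
    · rw [indicator_of_mem hd]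
      have hR0 : 0 ≤ R d := le_min (div_nonneg (by linarith [hd.1]) hb.le)
        (div_nonneg (by linarith [hd.2]) ha.le)
      have hRb : b * R d ≤ d - ξ₀ := by
        have := mul_le_mul_of_nonneg_left (min_le_left ((d - ξ₀) / b) ((1 - d) / a)) hb.le
        rwa [mul_div_cancel₀ _ hb.ne'] at this
      have hRa : a * R d ≤ 1 - d := by
        have := mul_le_mul_of_nonneg_left (min_le_right ((d - ξ₀) / b) ((1 - d) / a)) ha.le
        rwa [mul_div_cancel₀ _ ha.ne'] at this
      have hmem0 : (d, d) ∈ triangle := ⟨hξ₀.1.trans hd.1, le_rfl, hd.2⟩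
      have hmem1 : (d + a * R d, d + -b * R d) ∈ triangle := by
        have := mul_nonneg ha.le hR0
        have := mul_nonneg hb.le hR0
        refine ⟨?_, ?_, ?_⟩ <;> simp only <;> linarith [hξ₀.1]
      have h1 := hFG d d (R d) hR0 hmem0 hmem1
      rw [h1, add_sub_cancel_left, intervalIntegral.integral_of_le hR0,
        ← integral_Icc_eq_integral_Ioc]
      rw [← setIntegral_eq_integral_of_forall_compl_eq_zero (s := Icc 0 (R d))]
      · refine setIntegral_congr_fun measurableSet_Icc fun r hr => ?_
        have := mul_le_mul_of_nonneg_left hr.2 hb.le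
        exact upper_of_le (by linarith)
      · intro r hr
        refine hH0 d r fun h => hr ⟨h.1, le_min ?_ ?_⟩
        · rw [le_div_iff₀ hb]; linarith [h.2.1]
        · rw [le_div_iff₀ ha]; linarith [h.2.2]
    · rw [indicator_of_notMem hd]
      refine integral_eq_zero_of_ae (Filter.Eventually.of_forall fun r => hH0 d r fun h => hd ?_)
      have := mul_nonneg ha.le h.1
      have := mul_nonneg hb.le h.1
      exact ⟨by linarith [h.2.1], by linarith [h.2.2]⟩
  rw [integral_upper hξ₀ hG, hcv, hF.integral_eq hξ₀.2]
  simp_rw [hinner]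
  rw [integral_indicator measurableSet_Icc, integral_Icc_eq_integral_Ioc,
    ← intervalIntegral.integral_of_le hξ₀.2]
  have iF : ∀ u v : ℝ → ℝ, Measurable u → Measurable v → BddMeas₁ fun d => F (u d) (v d) := by
    intro u v hu hv
    obtain ⟨N, hN⟩ := hF.bdd
    exact ⟨hF.meas.comp (hu.prodMk hv), N, fun d => hN _ _⟩
  have hRm : Measurable R := by fun_prop
  have b1 := iF (fun d => d + a * R d) (fun d => d + -b * R d) (by fun_prop) (by fun_prop)
  have b2 := iF (fun d => d) (fun d => d) measurable_id measurable_id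
  rw [intervalIntegral.integral_sub (b1.intervalIntegrable _ _) (b2.intervalIntegrable _ _)]
  -- the characteristics from `(d, d)` leave through `ξ = ξ₀` for `d ≤ D`, through `x = 1` after
  set D := (b + a * ξ₀) / (a + b) with hD
  have hD1 : ξ₀ ≤ D := by
    rw [hD, le_div_iff₀ hab]
    have := mul_le_mul_of_nonneg_left hξ₀.2 hb.le
    linarith
  have hD2 : D ≤ 1 := by
    rw [hD, div_le_iff₀ hab]
    have := mul_le_mul_of_nonneg_left hξ₀.2 ha.le
    linarith
  have hDle : ∀ d, d ≤ D → R d = (d - ξ₀) / b := by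
    intro d hd
    refine min_eq_left ?_
    rw [div_le_div_iff₀ hb ha]
    rw [hD, le_div_iff₀ hab] at hd
    linarith
  have hDge : ∀ d, D ≤ d → R d = (1 - d) / a := by
    intro d hd
    refine min_eq_right ?_
    rw [div_le_div_iff₀ ha hb]
    rw [hD, div_le_iff₀ hab] at hd
    linarith
  rw [← intervalIntegral.integral_add_adjacent_intervals (b1.intervalIntegrable ξ₀ D)
    (b1.intervalIntegrable D 1)]
  have p1 : ∫ d in ξ₀..D, F (d + a * R d) (d + -b * R d) =
      b / (a + b) * ∫ x in ξ₀..1, F x ξ₀ := by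
    have e : ∫ d in ξ₀..D, F (d + a * R d) (d + -b * R d) =
        ∫ d in ξ₀..D, (fun x => F x ξ₀) ((a + b) / b * d - a * ξ₀ / b) := by
      refine intervalIntegral.integral_congr fun d hd => ?_
      rw [uIcc_of_le hD1] at hd
      simp only [hDle d hd.2]
      congr 1 <;> field_simp <;> ring
    rw [e, intervalIntegral.integral_comp_mul_sub (fun x => F x ξ₀) (by positivity)]
    rw [show (a + b) / b * ξ₀ - a * ξ₀ / b = ξ₀ by field_simp; ring,
      show (a + b) / b * D - a * ξ₀ / b = 1 by rw [hD]; field_simp; ring, smul_eq_mul, inv_div]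
  have p2 : ∫ d in D..1, F (d + a * R d) (d + -b * R d) =
      a / (a + b) * ∫ s in ξ₀..1, F 1 s := by
    have e : ∫ d in D..1, F (d + a * R d) (d + -b * R d) =
        ∫ d in D..1, (fun s => F 1 s) ((a + b) / a * d - b / a) := by
      refine intervalIntegral.integral_congr fun d hd => ?_
      rw [uIcc_of_le hD2] at hd
      simp only [hDge d hd.1]
      congr 1 <;> field_simp <;> ring
    rw [e, intervalIntegral.integral_comp_mul_sub (fun x => F 1 x) (by positivity)]
    rw [show (a + b) / a * 1 - b / a = 1 by field_simp; ring,
      show (a + b) / a * D - b / a = ξ₀ by rw [hD]; field_simp; ring, smul_eq_mul, inv_div]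
  rw [p1, p2]
  field_simp
  ring

/-- Divergence theorem for the field `F · (a, a)` on the triangle `ξ₀ ≤ ξ ≤ x ≤ 1`. -/
theorem divergence_parallel {a : ℝ} (ha : 0 < a) {F G : ℝ → ℝ → ℝ}
    (hF : TriKernel F) (hG : TriKernel G) (hFG : SolvesTransport a a F G) {ξ₀ : ℝ}
    (hξ₀ : ξ₀ ∈ Icc (0 : ℝ) 1) :
    a * ∫ x, F x ξ₀ ∂m01 = a * (∫ s in ξ₀..1, F 1 s) - ∫ s in ξ₀..1, ∫ x, G x s ∂m01 := by
  set H := upper ξ₀ G with hH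
  obtain ⟨M, hM⟩ := hG.bdd
  have hHm : Measurable H := upper_measurable ξ₀ hG.toBddMeas₂
  have hH0 : ∀ y s : ℝ, ¬(0 ≤ y ∧ ξ₀ ≤ s ∧ y + s ≤ 1) → H (y + s, s) = 0 := by
    intro y s h
    by_cases h1 : 0 ≤ y
    · by_cases h2 : ξ₀ ≤ s
      · exact upper_eq_zero (hG.eq_zero_of_one_lt (not_le.1 fun h3 => h ⟨h1, h2, h3⟩))
      · exact upper_of_lt (not_le.1 h2)
    · exact upper_eq_zero (hG.eq_zero_of_lt (by linarith [not_le.1 h1]))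
  have hcv : ∫ s, ∫ x, H (x, s) = ∫ y, ∫ s, H (y + s, s) := by
    have h1 : ∀ s, ∫ x, H (x, s) = ∫ y, H (y + s, s) := fun s =>
      (integral_add_right_eq_self (μ := volume) (fun y => H (y, s)) s).symm
    simp_rw [h1]
    refine integral_integral_swap (integrable_of_bdd_of_support (M := M) (by fun_prop)
      (fun p => upper_bound ξ₀ hM _) fun p hp => hH0 p.2 p.1 fun h => hp ?_)
    exact ⟨⟨hξ₀.1.trans h.2.1, by linarith⟩, h.1, by linarith [hξ₀.1]⟩
  have hinner : ∀ y, ∫ s, H (y + s, s) =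
      (Icc 0 (1 - ξ₀)).indicator (fun y => a * F 1 (1 - y) - a * F (ξ₀ + y) ξ₀) y := by
    intro y
    by_cases hy : y ∈ Icc 0 (1 - ξ₀)
    · rw [indicator_of_mem hy]
      have h0 : 0 ≤ (1 - y - ξ₀) / a := div_nonneg (by linarith [hy.2]) ha.le
      have e1 : ξ₀ + y + a * ((1 - y - ξ₀) / a) = 1 := by field_simp; ring
      have e2 : ξ₀ + a * ((1 - y - ξ₀) / a) = 1 - y := by field_simp; ring
      have h1 := hFG (ξ₀ + y) ξ₀ ((1 - y - ξ₀) / a) h0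
        ⟨hξ₀.1, by simp only; linarith [hy.1], by simp only; linarith [hy.2]⟩
        (by rw [e1, e2]; exact ⟨by simp only; linarith [hy.2, hξ₀.1],
          by simp only; linarith [hy.1], le_rfl⟩)
      rw [e1, e2] at h1
      rw [h1, mul_add, add_sub_cancel_left]
      have e3 := intervalIntegral.mul_integral_comp_add_mul (a := 0) (b := (1 - y - ξ₀) / a)
        (f := fun s => G (y + s) s) a ξ₀
      rw [e2, mul_zero, add_zero] at e3
      have e4 : (fun s => G (ξ₀ + y + a * s) (ξ₀ + a * s)) =
          fun s => G (y + (ξ₀ + a * s)) (ξ₀ + a * s) := by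
        funext s; congr 1; ring
      rw [e4, e3, intervalIntegral.integral_of_le (by linarith [hy.2]),
        ← integral_Icc_eq_integral_Ioc,
        ← setIntegral_eq_integral_of_forall_compl_eq_zero (s := Icc ξ₀ (1 - y))]
      · exact setIntegral_congr_fun measurableSet_Icc fun s hs => upper_of_le hs.1
      · exact fun s hs => hH0 y s fun h => hs ⟨h.2.1, by linarith⟩
    · rw [indicator_of_notMem hy]
      exact integral_eq_zero_of_ae (Filter.Eventually.of_forall fun s =>
        hH0 y s fun h => hy ⟨h.1, by linarith⟩)
  rw [integral_upper hξ₀ hG, hcv, hF.integral_eq hξ₀.2]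
  simp_rw [hinner]
  rw [integral_indicator measurableSet_Icc, integral_Icc_eq_integral_Ioc,
    ← intervalIntegral.integral_of_le (by linarith [hξ₀.2])]
  have iF : ∀ u v : ℝ → ℝ, Measurable u → Measurable v → BddMeas₁ fun d => F (u d) (v d) := by
    intro u v hu hv
    obtain ⟨N, hN⟩ := hF.bdd
    exact ⟨hF.meas.comp (hu.prodMk hv), N, fun d => hN _ _⟩
  have b1 := (iF (fun _ => 1) (fun y => 1 - y) (by fun_prop) (by fun_prop)).const_mul a
  have b2 := (iF (fun y => ξ₀ + y) (fun _ => ξ₀) (by fun_prop) (by fun_prop)).const_mul a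
  rw [intervalIntegral.integral_sub (b1.intervalIntegrable _ _) (b2.intervalIntegrable _ _),
    intervalIntegral.integral_const_mul, intervalIntegral.integral_const_mul,
    intervalIntegral.integral_comp_sub_left (fun s => F 1 s),
    intervalIntegral.integral_comp_add_left (fun x => F x ξ₀)]
  simp only [sub_sub_cancel, sub_zero, add_zero, add_sub_cancel]

/-! ### Primitives as test functions -/

/-- The kernel of `p ↦ ∫_x^1 p`. -/
def tailKer (x y : ℝ) : ℝ := if x ≤ y then 1 else 0

/-- The primitive of `p` on `[0,1]` with value `c` at `1`. -/
def prim (c : ℝ) (p : ℝ → ℝ) (x : ℝ) : ℝ := c - intOp tailKer p x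

theorem tailKer_bddMeas : BddMeas₂ tailKer := by
  refine ⟨?_, 1, fun x y => ?_⟩
  · exact Measurable.ite (measurableSet_le measurable_fst measurable_snd) measurable_const
      measurable_const
  · rw [tailKer]; split_ifs <;> simp

theorem intOp_tailKer {p : ℝ → ℝ} {x : ℝ} (hx : x ∈ Icc (0 : ℝ) 1) :
    intOp tailKer p x = ∫ y in x..1, p y := by
  rw [intervalIntegral.integral_of_le hx.2, ← integral_Icc_eq_integral_Ioc, intOp,
    ← integral_indicator measurableSet_Icc, ← integral_indicator measurableSet_Icc]
  congr 1
  funext y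
  by_cases hy : y ∈ Icc x 1
  · rw [indicator_of_mem hy, indicator_of_mem (show y ∈ Icc (0 : ℝ) 1 from ⟨hx.1.trans hy.1, hy.2⟩),
      tailKer, if_pos hy.1,
      one_mul]
  · rw [indicator_of_notMem hy]
    by_cases hy' : y ∈ Icc (0 : ℝ) 1
    · rw [indicator_of_mem hy', tailKer, if_neg (fun h => hy ⟨h, hy'.2⟩), zero_mul]
    · rw [indicator_of_notMem hy']

theorem adjOp_tailKer {p : ℝ → ℝ} {x : ℝ} (hx : x ∈ Icc (0 : ℝ) 1) :
    adjOp tailKer p x = ∫ y in (0 : ℝ)..x, p y := by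
  rw [intervalIntegral.integral_of_le hx.1, ← integral_Icc_eq_integral_Ioc, adjOp,
    ← integral_indicator measurableSet_Icc, ← integral_indicator measurableSet_Icc]
  congr 1
  funext y
  by_cases hy : y ∈ Icc 0 x
  · rw [indicator_of_mem hy, indicator_of_mem (show y ∈ Icc (0 : ℝ) 1 from ⟨hy.1, hy.2.trans hx.2⟩),
      tailKer, if_pos hy.2,
      one_mul]
  · rw [indicator_of_notMem hy]
    by_cases hy' : y ∈ Icc (0 : ℝ) 1
    · rw [indicator_of_mem hy', tailKer, if_neg (fun h => hy ⟨hy'.1, h⟩), zero_mul]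
    · rw [indicator_of_notMem hy']

theorem prim_bddMeas (c : ℝ) {p : ℝ → ℝ} (hp : BddMeas₁ p) : BddMeas₁ (prim c p) :=
  (BddMeas₁.const c).sub (intOp_bddMeas tailKer_bddMeas (hp.integrable _))

theorem prim_eq (c : ℝ) (p : ℝ → ℝ) {x : ℝ} (hx : x ∈ Icc (0 : ℝ) 1) :
    prim c p x = c - ∫ y in x..1, p y := by rw [prim, intOp_tailKer hx]

theorem prim_one (c : ℝ) (p : ℝ → ℝ) : prim c p 1 = c := by
  rw [prim_eq c p ⟨zero_le_one, le_rfl⟩, intervalIntegral.integral_same, sub_zero]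

theorem prim_sub_prim (c : ℝ) {p : ℝ → ℝ} (hp : BddMeas₁ p) {x y : ℝ} (hx : x ∈ Icc (0 : ℝ) 1)
    (hy : y ∈ Icc (0 : ℝ) 1) : prim c p y = prim c p x + ∫ s in x..y, p s := by
  rw [prim_eq c p hx, prim_eq c p hy, ← intervalIntegral.integral_add_adjacent_intervals
    (hp.intervalIntegrable x y) (hp.intervalIntegrable y 1)]
  ring

/-- The product rule for primitives. -/
theorem primitive_mul_primitive {p q : ℝ → ℝ} (hp : BddMeas₁ p) (hq : BddMeas₁ q) (f₀ g₀ : ℝ)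
    {r : ℝ} : (f₀ + ∫ s in (0 : ℝ)..r, p s) * (g₀ + ∫ s in (0 : ℝ)..r, q s) = f₀ * g₀ +
      ∫ t in (0 : ℝ)..r, (p t * (g₀ + ∫ s in (0 : ℝ)..t, q s) +
        (f₀ + ∫ s in (0 : ℝ)..t, p s) * q t) := by
  have ac : ∀ (h₀ : ℝ) {h : ℝ → ℝ}, BddMeas₁ h →
      AbsolutelyContinuousOnInterval (fun t => h₀ + ∫ s in (0 : ℝ)..t, h s) 0 r ∧
      ∀ᵐ t, t ∈ uIoc 0 r → deriv (fun t => h₀ + ∫ s in (0 : ℝ)..t, h s) t = h t := by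
    intro h₀ h hh
    have hi := hh.intervalIntegrable 0 r
    refine ⟨?_, ?_⟩
    · have h1 := hi.absolutelyContinuousOnInterval_intervalIntegral (c := 0) (by simp)
      have h2 : AbsolutelyContinuousOnInterval (fun _ : ℝ => h₀) 0 r :=
        (LipschitzWith.const h₀).lipschitzOnWith.absolutelyContinuousOnInterval
      exact h2.add h1
    · filter_upwards [hi.ae_hasDerivAt_integral] with t ht htr
      exact ((ht (uIoc_subset_uIcc htr) 0 (by simp)).const_add h₀).deriv
  obtain ⟨a1, d1⟩ := ac f₀ hp
  obtain ⟨a2, d2⟩ := ac g₀ hq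
  have h := a1.integral_deriv_mul_eq_sub a2
  simp only [intervalIntegral.integral_same, add_zero] at h
  rw [eq_sub_iff_add_eq, add_comm] at h
  rw [← h]
  congr 1
  refine intervalIntegral.integral_congr_ae ?_
  filter_upwards [d1, d2] with t h1 h2 ht
  rw [h1 ht, h2 ht]

/-- Multiplying a transported function by a primitive of a function of `x`. -/
theorem SolvesTransport.mul_prim {a b : ℝ} {F G : ℝ → ℝ → ℝ} (hG : TriKernel G)
    (h : SolvesTransport a b F G) (c : ℝ) {p : ℝ → ℝ} (hp : BddMeas₁ p) :
    SolvesTransport a b (fun x ξ => F x ξ * prim c p x)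
      (fun x ξ => G x ξ * prim c p x + a * (F x ξ * p x)) := by
  intro x ξ r hr h1 h2
  obtain ⟨M, hM⟩ := hG.bdd
  obtain ⟨N, hN⟩ := hp.bdd
  have bG : BddMeas₁ fun s => G (x + a * s) (ξ + b * s) :=
    ⟨hG.meas.comp (by fun_prop : Measurable fun s : ℝ => (x + a * s, ξ + b * s)), M,
      fun s => hM _ _⟩
  have bp : BddMeas₁ fun s => a * p (x + a * s) :=
    BddMeas₁.const_mul ⟨hp.meas.comp (by fun_prop), N, fun s => hN _⟩ a
  have hF : ∀ s ∈ Icc 0 r, F (x + a * s) (ξ + b * s) =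
      F x ξ + ∫ s in (0 : ℝ)..s, G (x + a * s) (ξ + b * s) := fun s hs =>
    h x ξ s hs.1 h1 (triangle_segment h1 h2 hs.1 hs.2)
  have hφ : ∀ s ∈ Icc 0 r, prim c p (x + a * s) =
      prim c p x + ∫ s in (0 : ℝ)..s, a * p (x + a * s) := by
    intro s hs
    have h3 := triangle_segment h1 h2 hs.1 hs.2
    rw [prim_sub_prim c hp ⟨h1.1.trans h1.2.1, h1.2.2⟩ ⟨h3.1.trans h3.2.1, h3.2.2⟩,
      intervalIntegral.integral_const_mul]
    have := intervalIntegral.mul_integral_comp_add_mul (a := 0) (b := s) (f := p) a x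
    rw [this, mul_zero, add_zero]
  simp only
  rw [hF r ⟨hr, le_rfl⟩, hφ r ⟨hr, le_rfl⟩, primitive_mul_primitive bG bp]
  congr 1
  refine intervalIntegral.integral_congr fun s hs => ?_
  rw [uIcc_of_le hr] at hs
  rw [← hF s hs, ← hφ s hs]
  ring

theorem TriKernel.mul_fst {κ : ℝ → ℝ → ℝ} (h : TriKernel κ) {φ : ℝ → ℝ} (hφ : BddMeas₁ φ) :
    TriKernel fun x ξ => κ x ξ * φ x :=
  ⟨h.toBddMeas₂.mul hφ.fst, fun x ξ hx => by simp only [h.supp _ _ hx, zero_mul]⟩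

theorem TriKernel.mul_snd {κ : ℝ → ℝ → ℝ} (h : TriKernel κ) {φ : ℝ → ℝ} (hφ : BddMeas₁ φ) :
    TriKernel fun x ξ => κ x ξ * φ ξ :=
  ⟨h.toBddMeas₂.mul hφ.snd, fun x ξ hx => by simp only [h.supp _ _ hx, zero_mul]⟩

theorem TriKernel.add {κ ℓ : ℝ → ℝ → ℝ} (h : TriKernel κ) (h' : TriKernel ℓ) :
    TriKernel fun x ξ => κ x ξ + ℓ x ξ :=
  ⟨h.toBddMeas₂.add h'.toBddMeas₂, fun x ξ hx => by simp [h.supp _ _ hx, h'.supp _ _ hx]⟩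

theorem TriKernel.const_mul {κ : ℝ → ℝ → ℝ} (h : TriKernel κ) (a : ℝ) :
    TriKernel fun x ξ => a * κ x ξ :=
  ⟨(BddMeas₁.const a).fst.mul h.toBddMeas₂, fun x ξ hx => by simp [h.supp _ _ hx]⟩

theorem TriKernel.neg {κ : ℝ → ℝ → ℝ} (h : TriKernel κ) : TriKernel fun x ξ => -κ x ξ := by
  simpa using h.const_mul (-1)

section adjoint
variable {a b c : ℝ} {F G : ℝ → ℝ → ℝ} {p : ℝ → ℝ}

theorem integral_adjOp_add (hF : TriKernel F) (hG : TriKernel G) (hp : BddMeas₁ p) (s : ℝ) :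
    ∫ x, (G x s * prim c p x + a * (F x s * p x)) ∂m01 =
      adjOp G (prim c p) s + a * adjOp F p s := by
  have i1 := ((hG.right s).mul (prim_bddMeas c hp)).integrable m01
  have i2 := (((hF.right s).mul hp).const_mul a).integrable m01
  rw [integral_add i1 i2, integral_const_mul]
  rfl

theorem diag_bddMeas {κ : ℝ → ℝ → ℝ} (h : BddMeas₂ κ) : BddMeas₁ fun s => κ s s := by
  obtain ⟨M, hM⟩ := h.bdd
  exact ⟨h.meas.comp (by fun_prop : Measurable fun s : ℝ => (s, s)), M, fun s => hM s s⟩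

/-- The adjoint Volterra operator maps primitives to primitives, for a kernel transported along
`(a, -b)`. -/
theorem adjOp_prim_from_diag (ha : 0 < a) (hb : 0 < b) (hF : TriKernel F) (hG : TriKernel G)
    (hFG : SolvesTransport a (-b) F G) (hp : BddMeas₁ p) {ξ : ℝ} (hξ : ξ ∈ Icc (0 : ℝ) 1) :
    adjOp F (prim c p) ξ = ∫ s in ξ..1, ((a + b) / b * (F s s * prim c p s) -
      a / b * c * F 1 s + 1 / b * (adjOp G (prim c p) s + a * adjOp F p s)) := by
  have hφ := prim_bddMeas c hp
  have h := divergence_from_diag ha hb (hF.mul_fst hφ)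
    ((hG.mul_fst hφ).add ((hF.mul_fst hp).const_mul a)) (hFG.mul_prim hG c hp) hξ
  simp only [integral_adjOp_add hF hG hp, prim_one] at h
  have b1 := (diag_bddMeas hF.toBddMeas₂).mul hφ
  have b2 := hF.left 1
  have b3 := (adjOp_bddMeas hG.toBddMeas₂ (hφ.integrable _)).add
    ((adjOp_bddMeas hF.toBddMeas₂ (hp.integrable _)).const_mul a)
  rw [intervalIntegral.integral_add (((b1.const_mul ((a + b) / b)).sub
      (b2.const_mul (a / b * c))).intervalIntegrable _ _)
      ((b3.const_mul (1 / b)).intervalIntegrable _ _),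
    intervalIntegral.integral_sub ((b1.const_mul ((a + b) / b)).intervalIntegrable _ _)
      ((b2.const_mul (a / b * c)).intervalIntegrable _ _),
    intervalIntegral.integral_const_mul, intervalIntegral.integral_const_mul,
    intervalIntegral.integral_const_mul]
  rw [intervalIntegral.integral_mul_const] at h
  have h' : adjOp F (prim c p) ξ = (b * ∫ x, F x ξ * prim c p x ∂m01) / b := by
    rw [mul_div_cancel_left₀ _ hb.ne']; rfl
  rw [h', h]
  field_simp

/-- The adjoint Volterra operator maps primitives to primitives, for a kernel transported along
`(a, a)`. -/
theorem adjOp_prim_parallel (ha : 0 < a) (hF : TriKernel F) (hG : TriKernel G)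
    (hFG : SolvesTransport a a F G) (hp : BddMeas₁ p) {ξ : ℝ} (hξ : ξ ∈ Icc (0 : ℝ) 1) :
    adjOp F (prim c p) ξ = ∫ s in ξ..1, (c * F 1 s -
      1 / a * (adjOp G (prim c p) s + a * adjOp F p s)) := by
  have hφ := prim_bddMeas c hp
  have h := divergence_parallel ha (hF.mul_fst hφ)
    ((hG.mul_fst hφ).add ((hF.mul_fst hp).const_mul a)) (hFG.mul_prim hG c hp) hξ
  simp only [integral_adjOp_add hF hG hp, prim_one] at h
  have b2 := hF.left 1
  have b3 := (adjOp_bddMeas hG.toBddMeas₂ (hφ.integrable _)).add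
    ((adjOp_bddMeas hF.toBddMeas₂ (hp.integrable _)).const_mul a)
  rw [intervalIntegral.integral_sub ((b2.const_mul c).intervalIntegrable _ _)
      ((b3.const_mul (1 / a)).intervalIntegrable _ _),
    intervalIntegral.integral_const_mul, intervalIntegral.integral_const_mul]
  rw [intervalIntegral.integral_mul_const] at h
  have h' : adjOp F (prim c p) ξ = (a * ∫ x, F x ξ * prim c p x ∂m01) / a := by
    rw [mul_div_cancel_left₀ _ ha.ne']; rfl
  rw [h', h]
  field_simp

end adjoint

/-! ### Duality between the original and the target system -/

section linear
variable {κ : ℝ → ℝ → ℝ} {f g φ : ℝ → ℝ}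

theorem adjOp_sub (h : BddMeas₂ κ) (hf : Integrable f m01) (hg : Integrable g m01) (x : ℝ) :
    adjOp κ (fun y => f y - g y) x = adjOp κ f x - adjOp κ g x := intOp_sub h.swap hf hg x

theorem adjOp_const_mul (κ : ℝ → ℝ → ℝ) (a : ℝ) (f : ℝ → ℝ) (x : ℝ) :
    adjOp κ (fun y => a * f y) x = a * adjOp κ f x := by
  simp only [adjOp]
  rw [← integral_const_mul]
  exact integral_congr_ae (Filter.Eventually.of_forall fun y => by ring)

theorem adjOp_mul_snd (κ : ℝ → ℝ → ℝ) (σ f : ℝ → ℝ) (ξ : ℝ) :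
    adjOp (fun x ξ => κ x ξ * σ ξ) f ξ = σ ξ * adjOp κ f ξ := by
  simp only [adjOp]
  rw [← integral_const_mul]
  exact integral_congr_ae (Filter.Eventually.of_forall fun y => by ring)

theorem adjOp_neg_mul_snd (κ : ℝ → ℝ → ℝ) (σ f : ℝ → ℝ) (ξ : ℝ) :
    adjOp (fun x ξ => -(κ x ξ * σ ξ)) f ξ = -(σ ξ * adjOp κ f ξ) := by
  rw [← adjOp_mul_snd]
  simp only [adjOp]
  rw [← integral_neg]
  exact integral_congr_ae (Filter.Eventually.of_forall fun y => by ring)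

end linear

/-- First component of the adjoint of the backstepping transformation. -/
def Kernels.dual₁ (k : Kernels) (φ ψ : ℝ → ℝ) (ξ : ℝ) : ℝ :=
  φ ξ - adjOp k.uu φ ξ - adjOp k.vu ψ ξ

/-- Second component of the adjoint of the backstepping transformation. -/
def Kernels.dual₂ (k : Kernels) (φ ψ : ℝ → ℝ) (ξ : ℝ) : ℝ :=
  ψ ξ - adjOp k.uv φ ξ - adjOp k.vv ψ ξ

/-- The derivative of `k.dual₁ φ ψ`, where `φ`, `ψ` are the primitives of `p`, `r` with values `c`,
`d` at `1`. -/
def dualDeriv₁ (S : HypSystem) (k : Kernels) (c d : ℝ) (p r : ℝ → ℝ) (ξ : ℝ) : ℝ :=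
  (k.dual₁ (fun x => S.lam * p x) (fun x => -S.mu * r x) ξ + S.lam * c * k.uu 1 ξ
    - S.mu * d * k.vu 1 ξ - S.sMP ξ * k.dual₂ (prim c p) (prim d r) ξ) / S.lam

/-- The derivative of `k.dual₂ φ ψ`, where `φ`, `ψ` are the primitives of `p`, `r` with values `c`,
`d` at `1`. -/
def dualDeriv₂ (S : HypSystem) (k : Kernels) (c d : ℝ) (p r : ℝ → ℝ) (ξ : ℝ) : ℝ :=
  -(k.dual₂ (fun x => S.lam * p x) (fun x => -S.mu * r x) ξ + S.lam * c * k.uv 1 ξ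
    - S.mu * d * k.vv 1 ξ - S.sPM ξ * k.dual₁ (prim c p) (prim d r) ξ) / S.mu

/-- A system with globally bounded measurable coefficients, and a backstepping kernel for it that is
supported in the triangle. -/
structure IsRegularPair (S : HypSystem) (k : Kernels) : Prop where
  lam_pos : 0 < S.lam
  mu_pos : 0 < S.mu
  tri : k.Tri
  sPM : BddMeas₁ S.sPM
  sMP : BddMeas₁ S.sMP
  ker : IsBacksteppingKernel S k

variable {S : HypSystem} {k : Kernels}

theorem Kernels.Tri.dual₁_bddMeas (h : k.Tri) {φ ψ : ℝ → ℝ} (hφ : BddMeas₁ φ) (hψ : BddMeas₁ ψ) :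
    BddMeas₁ (k.dual₁ φ ψ) :=
  (hφ.sub (adjOp_bddMeas h.uu.toBddMeas₂ (hφ.integrable _))).sub
    (adjOp_bddMeas h.vu.toBddMeas₂ (hψ.integrable _))

theorem Kernels.Tri.dual₂_bddMeas (h : k.Tri) {φ ψ : ℝ → ℝ} (hφ : BddMeas₁ φ) (hψ : BddMeas₁ ψ) :
    BddMeas₁ (k.dual₂ φ ψ) :=
  (hψ.sub (adjOp_bddMeas h.uv.toBddMeas₂ (hφ.integrable _))).sub
    (adjOp_bddMeas h.vv.toBddMeas₂ (hψ.integrable _))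

namespace IsRegularPair

variable (h : IsRegularPair S k)
include h

theorem dualDeriv₁_bddMeas (c d : ℝ) {p r : ℝ → ℝ} (hp : BddMeas₁ p) (hr : BddMeas₁ r) :
    BddMeas₁ (dualDeriv₁ S k c d p r) :=
  ((((h.tri.dual₁_bddMeas (hp.const_mul _) (hr.const_mul _)).add
    ((h.tri.uu.left 1).const_mul _)).sub ((h.tri.vu.left 1).const_mul _)).sub
    (h.sMP.mul (h.tri.dual₂_bddMeas (prim_bddMeas c hp) (prim_bddMeas d hr)))).div_const _

theorem dualDeriv₂_bddMeas (c d : ℝ) {p r : ℝ → ℝ} (hp : BddMeas₁ p) (hr : BddMeas₁ r) :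
    BddMeas₁ (dualDeriv₂ S k c d p r) :=
  (((((h.tri.dual₂_bddMeas (hp.const_mul _) (hr.const_mul _)).add
    ((h.tri.uv.left 1).const_mul _)).sub ((h.tri.vv.left 1).const_mul _)).sub
    (h.sPM.mul (h.tri.dual₁_bddMeas (prim_bddMeas c hp) (prim_bddMeas d hr)))).neg).div_const _

/-- The kernel equations say that the adjoint transformation maps Lipschitz functions to Lipschitz
functions, with an explicit derivative. -/
theorem dual₁_eq_prim (c d : ℝ) {p r : ℝ → ℝ} (hp : BddMeas₁ p) (hr : BddMeas₁ r) {ξ : ℝ}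
    (hξ : ξ ∈ Icc (0 : ℝ) 1) :
    k.dual₁ (prim c p) (prim d r) ξ = prim c (dualDeriv₁ S k c d p r) ξ := by
  have hl := h.lam_pos
  have hm := h.mu_pos
  have hφ := prim_bddMeas c hp
  have hψ := prim_bddMeas d hr
  have t1 := h.tri.uv.mul_snd h.sMP
  have t2 := h.tri.vv.mul_snd h.sMP
  rw [Kernels.dual₁, prim_eq c _ hξ, prim_eq c _ hξ,
    adjOp_prim_parallel hl h.tri.uu t1.neg h.ker.eq_uu hp hξ,
    adjOp_prim_from_diag hm hl h.tri.vu t2 h.ker.eq_vu hr hξ]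
  have a1 := adjOp_bddMeas h.tri.uu.toBddMeas₂ (hp.integrable _)
  have a2 := adjOp_bddMeas t1.neg.toBddMeas₂ (hφ.integrable _)
  have a3 := adjOp_bddMeas h.tri.vu.toBddMeas₂ (hr.integrable _)
  have a4 := adjOp_bddMeas t2.toBddMeas₂ (hψ.integrable _)
  have b1 := ((h.tri.uu.left 1).const_mul c).sub
    ((a2.add (a1.const_mul S.lam)).const_mul (1 / S.lam))
  have b2 := ((((diag_bddMeas h.tri.vu.toBddMeas₂).mul hψ).const_mul ((S.mu + S.lam) / S.lam)).sub
    ((h.tri.vu.left 1).const_mul (S.mu / S.lam * d))).add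
    ((a4.add (a3.const_mul S.mu)).const_mul (1 / S.lam))
  rw [sub_sub, sub_sub, ← intervalIntegral.integral_add (b1.intervalIntegrable _ _)
    (b2.intervalIntegrable _ _), ← intervalIntegral.integral_add (hp.intervalIntegrable _ _)
    ((b1.add b2).intervalIntegrable _ _)]
  congr 1
  refine intervalIntegral.integral_congr fun s hs => ?_
  rw [uIcc_of_le hξ.2] at hs
  have hs' : s ∈ Icc (0 : ℝ) 1 := ⟨hξ.1.trans hs.1, hs.2⟩
  simp only [adjOp_mul_snd, adjOp_neg_mul_snd, h.ker.diag_vu s hs', dualDeriv₁, Kernels.dual₁,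
    Kernels.dual₂, adjOp_const_mul]
  field_simp
  ring

theorem dual₂_eq_prim (c d : ℝ) {p r : ℝ → ℝ} (hp : BddMeas₁ p) (hr : BddMeas₁ r) {ξ : ℝ}
    (hξ : ξ ∈ Icc (0 : ℝ) 1) :
    k.dual₂ (prim c p) (prim d r) ξ = prim d (dualDeriv₂ S k c d p r) ξ := by
  have hl := h.lam_pos
  have hm := h.mu_pos
  have hφ := prim_bddMeas c hp
  have hψ := prim_bddMeas d hr
  have t1 := h.tri.uu.mul_snd h.sPM
  have t2 := h.tri.vu.mul_snd h.sPM
  rw [Kernels.dual₂, prim_eq d _ hξ, prim_eq d _ hξ,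
    adjOp_prim_parallel hm h.tri.vv t2 h.ker.eq_vv hr hξ,
    adjOp_prim_from_diag hl hm h.tri.uv t1.neg h.ker.eq_uv hp hξ]
  have a1 := adjOp_bddMeas h.tri.vv.toBddMeas₂ (hr.integrable _)
  have a2 := adjOp_bddMeas t2.toBddMeas₂ (hψ.integrable _)
  have a3 := adjOp_bddMeas h.tri.uv.toBddMeas₂ (hp.integrable _)
  have a4 := adjOp_bddMeas t1.neg.toBddMeas₂ (hφ.integrable _)
  have b1 := ((h.tri.vv.left 1).const_mul d).sub
    ((a2.add (a1.const_mul S.mu)).const_mul (1 / S.mu))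
  have b2 := ((((diag_bddMeas h.tri.uv.toBddMeas₂).mul hφ).const_mul ((S.lam + S.mu) / S.mu)).sub
    ((h.tri.uv.left 1).const_mul (S.lam / S.mu * c))).add
    ((a4.add (a3.const_mul S.lam)).const_mul (1 / S.mu))
  rw [sub_sub, sub_sub, ← intervalIntegral.integral_add (b2.intervalIntegrable _ _)
    (b1.intervalIntegrable _ _), ← intervalIntegral.integral_add (hr.intervalIntegrable _ _)
    ((b2.add b1).intervalIntegrable _ _)]
  congr 1
  refine intervalIntegral.integral_congr fun s hs => ?_
  rw [uIcc_of_le hξ.2] at hs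
  have hs' : s ∈ Icc (0 : ℝ) 1 := ⟨hξ.1.trans hs.1, hs.2⟩
  simp only [adjOp_mul_snd, adjOp_neg_mul_snd, h.ker.diag_uv s hs', dualDeriv₂, Kernels.dual₁,
    Kernels.dual₂, adjOp_const_mul]
  field_simp
  ring

end IsRegularPair

theorem integrable_fun_sub {f g : ℝ → ℝ} {μ : Measure ℝ} (hf : Integrable f μ)
    (hg : Integrable g μ) : Integrable (fun x => f x - g x) μ := hf.sub hg

theorem integrable_mul_bdd {f g : ℝ → ℝ} {μ : Measure ℝ} (hf : Integrable f μ) (hg : BddMeas₁ g) :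
    Integrable (fun x => f x * g x) μ := by
  simpa only [mul_comm] using hg.integrable_mul hf

/-- The transformation and its adjoint. -/
theorem Kernels.Tri.integral_dual (h : k.Tri) {f g φ ψ : ℝ → ℝ} (hf : Integrable f m01)
    (hg : Integrable g m01) (hφ : BddMeas₁ φ) (hψ : BddMeas₁ ψ) :
    (∫ x, (f x - k.op₁ f g x) * φ x ∂m01) + ∫ x, (g x - k.op₂ f g x) * ψ x ∂m01 =
      (∫ x, f x * k.dual₁ φ ψ x ∂m01) + ∫ x, g x * k.dual₂ φ ψ x ∂m01 := by
  have iφ := hφ.integrable m01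
  have iψ := hψ.integrable m01
  have A : ∀ {κ : ℝ → ℝ → ℝ} {f φ : ℝ → ℝ}, TriKernel κ → Integrable f m01 → BddMeas₁ φ →
      Integrable (fun x => intOp κ f x * φ x) m01 ∧ Integrable (fun x => f x * adjOp κ φ x) m01 ∧
        ∫ x, intOp κ f x * φ x ∂m01 = ∫ x, f x * adjOp κ φ x ∂m01 := fun hκ hf hφ =>
    ⟨((intOp_bddMeas hκ.toBddMeas₂ hf).mul hφ).integrable _,
      integrable_mul_bdd hf (adjOp_bddMeas hκ.toBddMeas₂ (hφ.integrable _)),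
      integral_intOp_mul hκ.toBddMeas₂ hf (hφ.integrable _)⟩
  obtain ⟨a1, a2, a3⟩ := A h.uu hf hφ
  obtain ⟨b1, b2, b3⟩ := A h.uv hg hφ
  obtain ⟨c1, c2, c3⟩ := A h.vu hf hψ
  obtain ⟨d1, d2, d3⟩ := A h.vv hg hψ
  have e1 := integrable_mul_bdd hf hφ
  have e2 := integrable_mul_bdd hg hψ
  have r1 : ∫ x, (f x - k.op₁ f g x) * φ x ∂m01 = (∫ x, f x * φ x ∂m01) -
      ((∫ x, intOp k.uu f x * φ x ∂m01) + ∫ x, intOp k.uv g x * φ x ∂m01) := by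
    rw [← integral_add a1 b1, ← integral_sub e1 (a1.fun_add b1)]
    exact integral_congr_ae (Filter.Eventually.of_forall fun x => by
      simp only [Kernels.op₁]; ring)
  have r2 : ∫ x, (g x - k.op₂ f g x) * ψ x ∂m01 = (∫ x, g x * ψ x ∂m01) -
      ((∫ x, intOp k.vu f x * ψ x ∂m01) + ∫ x, intOp k.vv g x * ψ x ∂m01) := by
    rw [← integral_add c1 d1, ← integral_sub e2 (c1.fun_add d1)]
    exact integral_congr_ae (Filter.Eventually.of_forall fun x => by
      simp only [Kernels.op₂]; ring)
  have r3 : ∫ x, f x * k.dual₁ φ ψ x ∂m01 = (∫ x, f x * φ x ∂m01) -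
      ((∫ x, f x * adjOp k.uu φ x ∂m01) + ∫ x, f x * adjOp k.vu ψ x ∂m01) := by
    rw [← integral_add a2 c2, ← integral_sub e1 (a2.fun_add c2)]
    exact integral_congr_ae (Filter.Eventually.of_forall fun x => by
      simp only [Kernels.dual₁]; ring)
  have r4 : ∫ x, g x * k.dual₂ φ ψ x ∂m01 = (∫ x, g x * ψ x ∂m01) -
      ((∫ x, g x * adjOp k.uv φ x ∂m01) + ∫ x, g x * adjOp k.vv ψ x ∂m01) := by
    rw [← integral_add b2 d2, ← integral_sub e2 (b2.fun_add d2)]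
    exact integral_congr_ae (Filter.Eventually.of_forall fun x => by
      simp only [Kernels.dual₂]; ring)
  rw [r1, r2, r3, r4, a3, b3, c3, d3]
  ring

/-- The weak form of a transport equation with speed `a`, integrated in time and in space: `W` is
the time integral of the profile, `w` the increment of the profile minus the time integral of the
source, and `B₀`, `B₁` are the time integrals of the traces at `0` and at `1`. -/
structure IntegratedTransport (a : ℝ) (W w : ℝ → ℝ) (B₀ B₁ : ℝ) : Prop where
  ae_eq : ∀ᵐ x ∂m01, a * W x + ∫ y in (0 : ℝ)..x, w y = a * B₀
  total : ∫ y, w y ∂m01 = a * (B₀ - B₁)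

/-- The defect of the weak form against the primitive of `p` with value `c` at `1`. -/
def defect (a : ℝ) (W w : ℝ → ℝ) (B₀ B₁ c : ℝ) (p : ℝ → ℝ) : ℝ :=
  (∫ x, w x * prim c p x ∂m01) - a * (∫ x, W x * p x ∂m01) - a * (prim c p 0 * B₀ - c * B₁)

/-- The defect measures both parts of `IntegratedTransport`: the coefficient of `c` is the total
balance, and `p` is tested against the pointwise balance. -/
theorem defect_eq {a : ℝ} {W w : ℝ → ℝ} (hW : Integrable W m01) (hw : Integrable w m01)
    (B₀ B₁ c : ℝ) {p : ℝ → ℝ} (hp : BddMeas₁ p) :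
    defect a W w B₀ B₁ c p = c * ((∫ x, w x ∂m01) - a * (B₀ - B₁)) -
      ∫ x, p x * (a * W x + adjOp tailKer w x - a * B₀) ∂m01 := by
  have h1 : ∫ x, w x * prim c p x ∂m01 =
      c * (∫ x, w x ∂m01) - ∫ x, p x * adjOp tailKer w x ∂m01 := by
    rw [← integral_intOp_mul tailKer_bddMeas (hp.integrable _) hw, ← integral_const_mul,
      ← integral_sub (hw.const_mul c)
        ((intOp_bddMeas tailKer_bddMeas (hp.integrable _)).integrable_mul hw)]
    exact integral_congr_ae (Filter.Eventually.of_forall fun x => by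
      simp only [prim]; ring)
  have h2 : ∫ x, p x * (a * W x + adjOp tailKer w x - a * B₀) ∂m01 =
      a * (∫ x, W x * p x ∂m01) + (∫ x, p x * adjOp tailKer w x ∂m01) -
        a * B₀ * ∫ x, p x ∂m01 := by
    have i1 := (integrable_mul_bdd hW hp).const_mul a
    have i2 := (hp.mul (adjOp_bddMeas tailKer_bddMeas hw)).integrable m01
    have i3 := (hp.integrable m01).const_mul (a * B₀)
    rw [← integral_const_mul, ← integral_const_mul, ← integral_add i1 i2,
      ← integral_sub (i1.fun_add i2) i3]
    exact integral_congr_ae (Filter.Eventually.of_forall fun x => by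
      ring)
  have h3 : prim c p 0 = c - ∫ x, p x ∂m01 := by
    rw [prim_eq c p ⟨le_rfl, zero_le_one⟩, intervalIntegral.integral_of_le zero_le_one,
      integral_Icc_eq_integral_Ioc]
  rw [defect, h1, h2, h3]
  ring

/-- Fubini turns the pointwise form of the integrated equation into the form with test functions. -/
theorem IntegratedTransport.defect_eq_zero {a : ℝ} {W w : ℝ → ℝ} {B₀ B₁ : ℝ}
    (h : IntegratedTransport a W w B₀ B₁) (hW : Integrable W m01) (hw : Integrable w m01)
    (c : ℝ) {p : ℝ → ℝ} (hp : BddMeas₁ p) : defect a W w B₀ B₁ c p = 0 := by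
  rw [defect_eq hW hw _ _ _ hp, h.total, sub_self, mul_zero, zero_sub, neg_eq_zero]
  refine integral_eq_zero_of_ae ?_
  filter_upwards [h.ae_eq, ae_restrict_mem measurableSet_Icc] with x hx hx'
  rw [adjOp_tailKer hx', hx, sub_self, mul_zero, Pi.zero_apply]

/-- The primitives of continuous functions are enough to recover the weak form. -/
theorem IntegratedTransport.of_defect {a : ℝ} {W w : ℝ → ℝ} {B₀ B₁ : ℝ} (hW : Integrable W m01)
    (hw : Integrable w m01)
    (h : ∀ (c : ℝ) (p : ℝ → ℝ), Continuous p → BddMeas₁ p → defect a W w B₀ B₁ c p = 0) :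
    IntegratedTransport a W w B₀ B₁ := by
  have i : Integrable (fun x => a * W x + adjOp tailKer w x - a * B₀) m01 :=
    ((hW.const_mul a).add ((adjOp_bddMeas tailKer_bddMeas hw).integrable _)).sub
      (integrable_const _)
  refine ⟨?_, ?_⟩
  · have h0 : ∀ᵐ x ∂m01, a * W x + adjOp tailKer w x - a * B₀ = 0 := by
      refine ae_eq_zero_of_integral_contDiff_smul_eq_zero i.locallyIntegrable fun p hp hpc => ?_
      have hpb : BddMeas₁ p := by
        obtain ⟨M, hM⟩ := hpc.exists_bound_of_continuous hp.continuous
        exact ⟨hp.continuous.measurable, M, hM⟩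
      have := h 0 p hp.continuous hpb
      rw [defect_eq hW hw _ _ _ hpb, zero_mul, zero_sub, neg_eq_zero] at this
      simpa only [smul_eq_mul] using this
    filter_upwards [h0, ae_restrict_mem measurableSet_Icc] with x hx hx'
    rw [adjOp_tailKer hx'] at hx
    linarith
  · have hb := BddMeas₁.const 0
    have := h 1 _ continuous_const hb
    rw [defect_eq hW hw _ _ _ hb] at this
    simp only [zero_mul, integral_zero, sub_zero, one_mul] at this
    linarith

/-- Testing the system with a transformed pair of test functions amounts to testing the
transformed system. -/
theorem IsRegularPair.defect_add_defect (h : IsRegularPair S k) {U V Δu Δv : ℝ → ℝ}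
    (hU : Integrable U m01) (hV : Integrable V m01) (hΔu : Integrable Δu m01)
    (hΔv : Integrable Δv m01) {A₀ A₁ B₀ B₁ : ℝ} (hA : A₀ = S.q * B₀) (c d : ℝ) {p r : ℝ → ℝ}
    (hp : BddMeas₁ p) (hr : BddMeas₁ r) :
    defect S.lam U (fun x => Δu x - S.sPM x * V x) A₀ A₁ c (dualDeriv₁ S k c d p r) +
      defect (-S.mu) V (fun x => Δv x - S.sMP x * U x) B₀ B₁ d (dualDeriv₂ S k c d p r) =
    defect S.lam (fun x => U x - k.op₁ U V x) (fun x => Δu x - k.op₁ Δu Δv x) A₀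
        (A₁ - k.op₁ U V 1) c p +
      defect (-S.mu) (fun x => V x - k.op₂ U V x) (fun x => Δv x - k.op₂ Δu Δv x) B₀
        (B₁ - k.op₂ U V 1) d r := by
  have hl := h.lam_pos
  have hm := h.mu_pos
  have hφ := prim_bddMeas c hp
  have hψ := prim_bddMeas d hr
  set φ := prim c p
  set ψ := prim d r
  have hΦ := h.tri.dual₁_bddMeas hφ hψ
  have hΨ := h.tri.dual₂_bddMeas hφ hψ
  have m0 : (0 : ℝ) ∈ Icc (0 : ℝ) 1 := ⟨le_rfl, zero_le_one⟩
  have E1 := h.tri.integral_dual hΔu hΔv hφ hψ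
  have E2 := h.tri.integral_dual hU hV (hp.const_mul S.lam) (hr.const_mul (-S.mu))
  have q1 : ∫ x, (U x - k.op₁ U V x) * (S.lam * p x) ∂m01 =
      S.lam * ∫ x, (U x - k.op₁ U V x) * p x ∂m01 := by
    rw [← integral_const_mul]
    exact integral_congr_ae (Filter.Eventually.of_forall fun x => by ring)
  have q2 : ∫ x, (V x - k.op₂ U V x) * (-S.mu * r x) ∂m01 =
      -S.mu * ∫ x, (V x - k.op₂ U V x) * r x ∂m01 := by
    rw [← integral_const_mul]
    exact integral_congr_ae (Filter.Eventually.of_forall fun x => by ring)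
  rw [q1, q2] at E2
  have p1 : ∀ {w : ℝ → ℝ}, ∫ x, w x * prim c (dualDeriv₁ S k c d p r) x ∂m01 =
      ∫ x, w x * k.dual₁ φ ψ x ∂m01 := by
    intro w
    refine integral_congr_ae ?_
    filter_upwards [ae_restrict_mem measurableSet_Icc] with x hx
    rw [h.dual₁_eq_prim c d hp hr hx]
  have p2 : ∀ {w : ℝ → ℝ}, ∫ x, w x * prim d (dualDeriv₂ S k c d p r) x ∂m01 =
      ∫ x, w x * k.dual₂ φ ψ x ∂m01 := by
    intro w
    refine integral_congr_ae ?_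
    filter_upwards [ae_restrict_mem measurableSet_Icc] with x hx
    rw [h.dual₂_eq_prim c d hp hr hx]
  have s1 : ∫ x, (Δu x - S.sPM x * V x) * k.dual₁ φ ψ x ∂m01 =
      (∫ x, Δu x * k.dual₁ φ ψ x ∂m01) - ∫ x, V x * (S.sPM x * k.dual₁ φ ψ x) ∂m01 := by
    rw [← integral_sub (integrable_mul_bdd hΔu hΦ) (integrable_mul_bdd hV (h.sPM.mul hΦ))]
    exact integral_congr_ae (Filter.Eventually.of_forall fun x => by ring)
  have s2 : ∫ x, (Δv x - S.sMP x * U x) * k.dual₂ φ ψ x ∂m01 =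
      (∫ x, Δv x * k.dual₂ φ ψ x ∂m01) - ∫ x, U x * (S.sMP x * k.dual₂ φ ψ x) ∂m01 := by
    rw [← integral_sub (integrable_mul_bdd hΔv hΨ) (integrable_mul_bdd hU (h.sMP.mul hΨ))]
    exact integral_congr_ae (Filter.Eventually.of_forall fun x => by ring)
  have hd1 := h.tri.dual₁_bddMeas (hp.const_mul S.lam) (hr.const_mul (-S.mu))
  have hd2 := h.tri.dual₂_bddMeas (hp.const_mul S.lam) (hr.const_mul (-S.mu))
  have t1 : S.lam * ∫ x, U x * dualDeriv₁ S k c d p r x ∂m01 =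
      (∫ x, U x * k.dual₁ (fun x => S.lam * p x) (fun x => -S.mu * r x) x ∂m01) +
      S.lam * c * (∫ x, k.uu 1 x * U x ∂m01) - S.mu * d * (∫ x, k.vu 1 x * U x ∂m01) -
      ∫ x, U x * (S.sMP x * k.dual₂ φ ψ x) ∂m01 := by
    have i1 := integrable_mul_bdd hU hd1
    have i2 := ((h.tri.uu.left 1).integrable_mul hU).const_mul (S.lam * c)
    have i3 := ((h.tri.vu.left 1).integrable_mul hU).const_mul (S.mu * d)
    have i4 := integrable_mul_bdd hU (h.sMP.mul hΨ)
    rw [← integral_const_mul, ← integral_const_mul, ← integral_const_mul, ← integral_add i1 i2,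
      ← integral_sub (i1.fun_add i2) i3, ← integral_sub (integrable_fun_sub (i1.fun_add i2) i3) i4]
    refine integral_congr_ae (Filter.Eventually.of_forall fun x => ?_)
    simp only [dualDeriv₁]
    field_simp
    ring
  have t2 : S.mu * ∫ x, V x * dualDeriv₂ S k c d p r x ∂m01 =
      -((∫ x, V x * k.dual₂ (fun x => S.lam * p x) (fun x => -S.mu * r x) x ∂m01) +
      S.lam * c * (∫ x, k.uv 1 x * V x ∂m01) - S.mu * d * (∫ x, k.vv 1 x * V x ∂m01) -
      ∫ x, V x * (S.sPM x * k.dual₁ φ ψ x) ∂m01) := by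
    have i1 := integrable_mul_bdd hV hd2
    have i2 := ((h.tri.uv.left 1).integrable_mul hV).const_mul (S.lam * c)
    have i3 := ((h.tri.vv.left 1).integrable_mul hV).const_mul (S.mu * d)
    have i4 := integrable_mul_bdd hV (h.sPM.mul hΦ)
    rw [← integral_const_mul, ← integral_const_mul, ← integral_const_mul, ← integral_add i1 i2,
      ← integral_sub (i1.fun_add i2) i3, ← integral_sub (integrable_fun_sub (i1.fun_add i2) i3) i4,
      ← integral_neg]
    refine integral_congr_ae (Filter.Eventually.of_forall fun x => ?_)
    simp only [dualDeriv₂]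
    field_simp
    ring
  -- the boundary conditions of the kernels at `ξ = 0` cancel the terms with the trace at `0`
  have bdry : S.lam * S.q * k.dual₁ φ ψ 0 - S.mu * k.dual₂ φ ψ 0 =
      S.lam * S.q * φ 0 - S.mu * ψ 0 := by
    have z1 : ∀ f : ℝ → ℝ, S.mu * adjOp k.uv f 0 = S.lam * S.q * adjOp k.uu f 0 := by
      intro f
      simp only [adjOp]
      rw [← integral_const_mul, ← integral_const_mul]
      refine integral_congr_ae ?_
      filter_upwards [ae_restrict_mem measurableSet_Icc] with x hx
      rw [h.ker.bottom_uv x hx]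
      field_simp
    have z2 : ∀ f : ℝ → ℝ, S.mu * adjOp k.vv f 0 = S.lam * S.q * adjOp k.vu f 0 := by
      intro f
      simp only [adjOp]
      rw [← integral_const_mul, ← integral_const_mul]
      refine integral_congr_ae ?_
      filter_upwards [ae_restrict_mem measurableSet_Icc] with x hx
      rw [h.ker.bottom_vv x hx]
      field_simp
    have := z1 φ
    have := z2 ψ
    simp only [Kernels.dual₁, Kernels.dual₂]
    linarith
  have o1 : k.op₁ U V 1 = (∫ x, k.uu 1 x * U x ∂m01) + ∫ x, k.uv 1 x * V x ∂m01 := rfl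
  have o2 : k.op₂ U V 1 = (∫ x, k.vu 1 x * U x ∂m01) + ∫ x, k.vv 1 x * V x ∂m01 := rfl
  simp only [defect]
  rw [← h.dual₁_eq_prim c d hp hr m0, ← h.dual₂_eq_prim c d hp hr m0, p1, p2, s1, s2, hA, o1, o2]
  linear_combination -E1 - t1 + t2 + E2 - B₀ * bdry

theorem prim_zero_fun (x : ℝ) : prim 0 (fun _ => 0) x = 0 := by
  simp [prim, intOp]

theorem defect_zero (a : ℝ) (W w : ℝ → ℝ) (B₀ B₁ : ℝ) :
    defect a W w B₀ B₁ 0 (fun _ => 0) = 0 := by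
  simp [defect, prim_zero_fun]

/-- The backstepping transformation removes the source terms. -/
theorem IsRegularPair.transform (h : IsRegularPair S k) {U V Δu Δv : ℝ → ℝ}
    (hU : Integrable U m01) (hV : Integrable V m01) (hΔu : Integrable Δu m01)
    (hΔv : Integrable Δv m01) {A₀ A₁ B₀ B₁ : ℝ} (hA : A₀ = S.q * B₀)
    (hu : IntegratedTransport S.lam U (fun x => Δu x - S.sPM x * V x) A₀ A₁)
    (hv : IntegratedTransport (-S.mu) V (fun x => Δv x - S.sMP x * U x) B₀ B₁) :
    IntegratedTransport S.lam (fun x => U x - k.op₁ U V x) (fun x => Δu x - k.op₁ Δu Δv x) A₀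
        (A₁ - k.op₁ U V 1) ∧
      IntegratedTransport (-S.mu) (fun x => V x - k.op₂ U V x) (fun x => Δv x - k.op₂ Δu Δv x) B₀
        (B₁ - k.op₂ U V 1) := by
  have key := fun c d p r hp hr => h.defect_add_defect hU hV hΔu hΔv (A₁ := A₁) (B₁ := B₁) hA c d
    (p := p) (r := r) hp hr
  have z := BddMeas₁.const 0
  have iu := integrable_fun_sub hΔu (h.sPM.integrable_mul hV)
  have iv := integrable_fun_sub hΔv (h.sMP.integrable_mul hU)
  constructor
  · refine IntegratedTransport.of_defect
      (integrable_fun_sub hU ((h.tri.op₁_bddMeas hU hV).integrable _))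
      (integrable_fun_sub hΔu ((h.tri.op₁_bddMeas hΔu hΔv).integrable _)) fun c p _ hp => ?_
    have := key c 0 p _ hp z
    rw [hu.defect_eq_zero hU iu c (h.dualDeriv₁_bddMeas c 0 hp z),
      hv.defect_eq_zero hV iv 0 (h.dualDeriv₂_bddMeas c 0 hp z), defect_zero] at this
    linarith
  · refine IntegratedTransport.of_defect
      (integrable_fun_sub hV ((h.tri.op₂_bddMeas hU hV).integrable _))
      (integrable_fun_sub hΔv ((h.tri.op₂_bddMeas hΔu hΔv).integrable _)) fun d r _ hr => ?_
    have := key 0 d _ r z hr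
    rw [hu.defect_eq_zero hU iu 0 (h.dualDeriv₁_bddMeas 0 d z hr),
      hv.defect_eq_zero hV iv d (h.dualDeriv₂_bddMeas 0 d z hr), defect_zero] at this
    linarith

theorem defect_congr {a : ℝ} {W w : ℝ → ℝ} {B₀ B₁ c : ℝ} {p p' : ℝ → ℝ}
    (hp : ∀ x ∈ Icc (0 : ℝ) 1, p x = p' x) :
    defect a W w B₀ B₁ c p = defect a W w B₀ B₁ c p' := by
  have e : p =ᵐ[m01] p' := (ae_restrict_mem measurableSet_Icc).mono hp
  have e1 : prim c p = prim c p' := by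
    funext x
    rw [prim, prim, intOp_congr_ae _ e]
  rw [defect, defect, e1]
  congr 3
  exact integral_congr_ae (e.mono fun x hx => by simp only [hx])

/-! ### Surjectivity of the adjoint transformation on Lipschitz functions -/

/-- The adjoint of a Volterra operator integrates over `[ξ, 1]`, so that it is absorbed by the
reflected weight `exp (γ (1 - x))`. -/
theorem abs_integral_le_exp_reflect {M γ C ξ : ℝ} (hγ : 0 < γ) (hξ : ξ ≤ 1) (hM : 0 ≤ M)
    (hC : 0 ≤ C) {h : ℝ → ℝ} (h0 : ∀ s, s < ξ → h s = 0)
    (hb : ∀ s ∈ Icc (0 : ℝ) 1, |h s| ≤ M * (C * Real.exp (γ * (1 - s)))) :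
    |∫ s, h s ∂m01| ≤ M / γ * (C * Real.exp (γ * (1 - ξ))) := by
  have e : ∫ s, h s ∂m01 = ∫ s, h (1 - s) ∂m01 := by
    rw [integral_Icc_eq_integral_Ioc, integral_Icc_eq_integral_Ioc,
      ← intervalIntegral.integral_of_le zero_le_one, ← intervalIntegral.integral_of_le zero_le_one,
      intervalIntegral.integral_comp_sub_left, sub_self, sub_zero]
  rw [e]
  exact abs_integral_le_exp hγ (by linarith) hM hC (h := fun s => h (1 - s))
    (fun s hs => h0 _ (by linarith))
    (fun s hs _ => by
      have := hb (1 - s) ⟨by linarith [hs.2], by linarith [hs.1]⟩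
      rwa [sub_sub_cancel] at this)

theorem TriKernel.abs_adjOp_le {κ : ℝ → ℝ → ℝ} (hκ : TriKernel κ) {M γ C ξ : ℝ} (hγ : 0 < γ)
    (hξ : ξ ≤ 1) (hM : ∀ x y, |κ x y| ≤ M) (hC : 0 ≤ C) {f : ℝ → ℝ}
    (hf : ∀ s ∈ Icc (0 : ℝ) 1, |f s| ≤ C * Real.exp (γ * (1 - s))) :
    |adjOp κ f ξ| ≤ M / γ * (C * Real.exp (γ * (1 - ξ))) :=
  abs_integral_le_exp_reflect hγ hξ ((abs_nonneg _).trans (hM 0 0)) hC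
    (fun s hs => by rw [hκ.eq_zero_of_lt hs, zero_mul])
    (fun s hs => by
      rw [abs_mul]
      exact mul_le_mul (hM _ _) (hf s hs) (abs_nonneg _) ((abs_nonneg _).trans (hM 0 0)))

theorem abs_prim_zero_le {γ C ξ : ℝ} (hγ : 0 < γ) (hξ : ξ ≤ 1) (hC : 0 ≤ C) {f : ℝ → ℝ}
    (hf : ∀ s ∈ Icc (0 : ℝ) 1, |f s| ≤ C * Real.exp (γ * (1 - s))) :
    |prim 0 f ξ| ≤ 1 / γ * (C * Real.exp (γ * (1 - ξ))) := by
  rw [prim, zero_sub, abs_neg]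
  exact abs_integral_le_exp_reflect hγ hξ zero_le_one hC
    (fun s hs => by rw [tailKer, if_neg (not_le.2 hs), zero_mul])
    (fun s hs => by
      rw [one_mul, abs_mul]
      refine (mul_le_of_le_one_left (abs_nonneg _) ?_).trans (hf s hs)
      rw [tailKer]; split_ifs <;> simp)

theorem prim_sub (c : ℝ) {p p' : ℝ → ℝ} (hp : BddMeas₁ p) (hp' : BddMeas₁ p') :
    prim 0 (fun x => p x - p' x) = fun x => prim c p x - prim c p' x := by
  funext x
  simp only [prim]
  rw [intOp_sub tailKer_bddMeas (hp.integrable _) (hp'.integrable _)]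
  ring

namespace IsRegularPair

variable (h : IsRegularPair S k)
include h

theorem dual₁_sub {p r p' r' : ℝ → ℝ} (hp : BddMeas₁ p) (hr : BddMeas₁ r)
    (hp' : BddMeas₁ p') (hr' : BddMeas₁ r') (ξ : ℝ) :
    k.dual₁ (fun x => p x - p' x) (fun x => r x - r' x) ξ = k.dual₁ p r ξ - k.dual₁ p' r' ξ := by
  simp only [Kernels.dual₁]
  rw [adjOp_sub h.tri.uu.toBddMeas₂ (hp.integrable _) (hp'.integrable _),
    adjOp_sub h.tri.vu.toBddMeas₂ (hr.integrable _) (hr'.integrable _)]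
  ring

theorem dual₂_sub {p r p' r' : ℝ → ℝ} (hp : BddMeas₁ p) (hr : BddMeas₁ r)
    (hp' : BddMeas₁ p') (hr' : BddMeas₁ r') (ξ : ℝ) :
    k.dual₂ (fun x => p x - p' x) (fun x => r x - r' x) ξ = k.dual₂ p r ξ - k.dual₂ p' r' ξ := by
  simp only [Kernels.dual₂]
  rw [adjOp_sub h.tri.uv.toBddMeas₂ (hp.integrable _) (hp'.integrable _),
    adjOp_sub h.tri.vv.toBddMeas₂ (hr.integrable _) (hr'.integrable _)]
  ring

theorem dualDeriv_sub (c d : ℝ) {p r p' r' : ℝ → ℝ} (hp : BddMeas₁ p) (hr : BddMeas₁ r)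
    (hp' : BddMeas₁ p') (hr' : BddMeas₁ r') (ξ : ℝ) :
    dualDeriv₁ S k 0 0 (fun x => p x - p' x) (fun x => r x - r' x) ξ =
        dualDeriv₁ S k c d p r ξ - dualDeriv₁ S k c d p' r' ξ ∧
      dualDeriv₂ S k 0 0 (fun x => p x - p' x) (fun x => r x - r' x) ξ =
        dualDeriv₂ S k c d p r ξ - dualDeriv₂ S k c d p' r' ξ := by
  have e1 : (fun x => S.lam * (p x - p' x)) = fun x => S.lam * p x - S.lam * p' x := by
    funext x; ring
  have e2 : (fun x => -S.mu * (r x - r' x)) = fun x => -S.mu * r x - -S.mu * r' x := by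
    funext x; ring
  have b1 := prim_bddMeas c hp
  have b2 := prim_bddMeas c hp'
  have b3 := prim_bddMeas d hr
  have b4 := prim_bddMeas d hr'
  have c1 := hp.const_mul S.lam
  have c2 := hp'.const_mul S.lam
  have c3 := hr.const_mul (-S.mu)
  have c4 := hr'.const_mul (-S.mu)
  constructor
  · simp only [dualDeriv₁]
    rw [e1, e2, prim_sub c hp hp', prim_sub d hr hr', h.dual₁_sub c1 c3 c2 c4,
      h.dual₂_sub b1 b3 b2 b4]
    ring
  · simp only [dualDeriv₂]
    rw [e1, e2, prim_sub c hp hp', prim_sub d hr hr', h.dual₂_sub c1 c3 c2 c4,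
      h.dual₁_sub b1 b3 b2 b4]
    ring

/-- Up to a Volterra operator, `dualDeriv` is the identity. -/
theorem exists_dualDeriv_bound : ∃ N, 0 < N ∧ ∀ γ C : ℝ, 1 ≤ γ → 0 ≤ C → ∀ p r : ℝ → ℝ,
    (∀ s ∈ Icc (0 : ℝ) 1, |p s| ≤ C * Real.exp (γ * (1 - s))) →
    (∀ s ∈ Icc (0 : ℝ) 1, |r s| ≤ C * Real.exp (γ * (1 - s))) → ∀ ξ ∈ Icc (0 : ℝ) 1,
      |p ξ - dualDeriv₁ S k 0 0 p r ξ| ≤ N / γ * (C * Real.exp (γ * (1 - ξ))) ∧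
      |r ξ - dualDeriv₂ S k 0 0 p r ξ| ≤ N / γ * (C * Real.exp (γ * (1 - ξ))) := by
  have hl := h.lam_pos
  have hm := h.mu_pos
  obtain ⟨M, hM0, hM1, hM2, hM3, hM4⟩ := h.tri.exists_bound
  obtain ⟨s₁, hs₁0, hs₁⟩ := h.sPM.exists_pos
  obtain ⟨s₂, hs₂0, hs₂⟩ := h.sMP.exists_pos
  set N₁ := (S.lam * M + S.mu * M + s₂ * (1 + 2 * M)) / S.lam with hN₁
  set N₂ := (S.lam * M + S.mu * M + s₁ * (1 + 2 * M)) / S.mu with hN₂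
  have hN₁0 : 0 < N₁ := by positivity
  have hN₂0 : 0 < N₂ := by positivity
  refine ⟨N₁ + N₂, by positivity, fun γ C hγ hC p r hp hr ξ hξ => ?_⟩
  have hγ0 : 0 < γ := by linarith
  set Q := C * Real.exp (γ * (1 - ξ)) / γ with hQ
  have hQ0 : 0 ≤ Q := by positivity
  have hpb : ∀ {f : ℝ → ℝ}, (∀ s ∈ Icc (0 : ℝ) 1, |f s| ≤ C * Real.exp (γ * (1 - s))) →
      ∀ s ∈ Icc (0 : ℝ) 1, |prim 0 f s| ≤ C * Real.exp (γ * (1 - s)) := fun hf s hs =>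
    (abs_prim_zero_le hγ0 hs.2 hC hf).trans
      (mul_le_of_le_one_left (by positivity) ((div_le_one hγ0).2 hγ))
  have A : ∀ {κ : ℝ → ℝ → ℝ} {f : ℝ → ℝ}, TriKernel κ → (∀ x y, |κ x y| ≤ M) →
      (∀ s ∈ Icc (0 : ℝ) 1, |f s| ≤ C * Real.exp (γ * (1 - s))) → |adjOp κ f ξ| ≤ M * Q := by
    intro κ f hκ hκM hf
    refine (hκ.abs_adjOp_le hγ0 hξ.2 hκM hC hf).trans (le_of_eq ?_)
    rw [hQ]; ring
  have P : ∀ {f : ℝ → ℝ}, (∀ s ∈ Icc (0 : ℝ) 1, |f s| ≤ C * Real.exp (γ * (1 - s))) →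
      |prim 0 f ξ| ≤ Q := fun hf =>
    (abs_prim_zero_le hγ0 hξ.2 hC hf).trans (le_of_eq (by rw [hQ]; ring))
  have d1 : |k.dual₁ (prim 0 p) (prim 0 r) ξ| ≤ (1 + 2 * M) * Q := by
    have := P hp
    have := A h.tri.uu hM1 (hpb hp)
    have := A h.tri.vu hM3 (hpb hr)
    simp only [Kernels.dual₁, abs_le] at *
    constructor <;> linarith
  have d2 : |k.dual₂ (prim 0 p) (prim 0 r) ξ| ≤ (1 + 2 * M) * Q := by
    have := P hr
    have := A h.tri.uv hM2 (hpb hp)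
    have := A h.tri.vv hM4 (hpb hr)
    simp only [Kernels.dual₂, abs_le] at *
    constructor <;> linarith
  have m1 : |S.sPM ξ * k.dual₁ (prim 0 p) (prim 0 r) ξ| ≤ s₁ * ((1 + 2 * M) * Q) := by
    rw [abs_mul]; exact mul_le_mul (hs₁ _) d1 (abs_nonneg _) hs₁0.le
  have m2 : |S.sMP ξ * k.dual₂ (prim 0 p) (prim 0 r) ξ| ≤ s₂ * ((1 + 2 * M) * Q) := by
    rw [abs_mul]; exact mul_le_mul (hs₂ _) d2 (abs_nonneg _) hs₂0.le
  have hmul : ∀ a : ℝ, 0 < a → ∀ {x : ℝ}, |x| ≤ M * Q → |a * x| ≤ a * (M * Q) := by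
    intro a ha x hx
    rw [abs_mul, abs_of_pos ha]
    exact mul_le_mul_of_nonneg_left hx ha.le
  have tri3 : ∀ x y z : ℝ, |x + y + z| ≤ |x| + |y| + |z| := fun x y z =>
    (abs_add_le _ _).trans (add_le_add_left (abs_add_le _ _) _)
  have fin' : ∀ N X : ℝ, N ≤ N₁ + N₂ → |X| ≤ N * Q →
      |X| ≤ (N₁ + N₂) / γ * (C * Real.exp (γ * (1 - ξ))) := by
    intro N X hN hX
    refine (hX.trans (mul_le_mul_of_nonneg_right hN hQ0)).trans (le_of_eq ?_)
    rw [hQ]; ring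
  constructor
  · refine fin' N₁ _ (by linarith) ?_
    have e : p ξ - dualDeriv₁ S k 0 0 p r ξ = (S.lam * adjOp k.uu p ξ + -(S.mu * adjOp k.vu r ξ) +
        S.sMP ξ * k.dual₂ (prim 0 p) (prim 0 r) ξ) / S.lam := by
      rw [dualDeriv₁, Kernels.dual₁, adjOp_const_mul, adjOp_const_mul]
      field_simp
      ring
    rw [e, abs_div, abs_of_pos hl, div_le_iff₀ hl]
    refine (tri3 _ _ _).trans ?_
    rw [abs_neg]
    have := hmul _ hl (A h.tri.uu hM1 hp)
    have := hmul _ hm (A h.tri.vu hM3 hr)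
    rw [hN₁]
    have e2 : (S.lam * M + S.mu * M + s₂ * (1 + 2 * M)) / S.lam * Q * S.lam =
        S.lam * (M * Q) + S.mu * (M * Q) + s₂ * ((1 + 2 * M) * Q) := by field_simp
    rw [e2]
    linarith
  · refine fin' N₂ _ (by linarith) ?_
    have e : r ξ - dualDeriv₂ S k 0 0 p r ξ = (-(S.lam * adjOp k.uv p ξ) + S.mu * adjOp k.vv r ξ +
        -(S.sPM ξ * k.dual₁ (prim 0 p) (prim 0 r) ξ)) / S.mu := by
      rw [dualDeriv₂, Kernels.dual₂, adjOp_const_mul, adjOp_const_mul]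
      field_simp
      ring
    rw [e, abs_div, abs_of_pos hm, div_le_iff₀ hm]
    refine (tri3 _ _ _).trans ?_
    rw [abs_neg, abs_neg]
    have := hmul _ hl (A h.tri.uv hM2 hp)
    have := hmul _ hm (A h.tri.vv hM4 hr)
    rw [hN₂]
    have e2 : (S.lam * M + S.mu * M + s₁ * (1 + 2 * M)) / S.mu * Q * S.mu =
        S.lam * (M * Q) + S.mu * (M * Q) + s₁ * ((1 + 2 * M) * Q) := by field_simp
    rw [e2]
    linarith

/-- The adjoint transformation maps onto the Lipschitz functions: on derivatives it is the identity
up to a Volterra operator, so that the equation is solved by Picard iteration. -/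
theorem exists_dualDeriv_eq (c d : ℝ) {P R : ℝ → ℝ} (hP : BddMeas₁ P) (hR : BddMeas₁ R) :
    ∃ p r : ℝ → ℝ, BddMeas₁ p ∧ BddMeas₁ r ∧ ∀ ξ ∈ Icc (0 : ℝ) 1,
      dualDeriv₁ S k c d p r ξ = P ξ ∧ dualDeriv₂ S k c d p r ξ = R ξ := by
  obtain ⟨N, hN0, hN⟩ := h.exists_dualDeriv_bound
  set γ := 2 * N + 1 with hγ
  have hγ1 : 1 ≤ γ := by linarith
  have bm : ∀ f : ℝ → ℝ × ℝ, Measurable f → (∃ M, ∀ x, ‖f x‖ ≤ M) →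
      BddMeas₁ (fun x => (f x).1) ∧ BddMeas₁ (fun x => (f x).2) := by
    rintro f hf ⟨M, hM⟩
    exact ⟨⟨hf.fst, M, fun x => (norm_fst_le _).trans (hM _)⟩,
      ⟨hf.snd, M, fun x => (norm_snd_le _).trans (hM _)⟩⟩
  obtain ⟨f, hf, hfb, -, hfix⟩ := exists_measurable_fixedPoint (E := ℝ × ℝ)
    (measurableSet_Icc (a := (0 : ℝ)) (b := 1))
    (fun f ξ => (P ξ + ((f ξ).1 - dualDeriv₁ S k c d (fun x => (f x).1) (fun x => (f x).2) ξ),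
      R ξ + ((f ξ).2 - dualDeriv₂ S k c d (fun x => (f x).1) (fun x => (f x).2) ξ)))
    (fun ξ => Real.exp (γ * (1 - ξ))) (Real.exp γ)
    (fun ξ hξ => ⟨Real.one_le_exp (mul_nonneg (by linarith) (by linarith [hξ.2])),
      Real.exp_le_exp.2 (mul_le_of_le_one_right (by linarith) (by linarith [hξ.1]))⟩)
    (θ := 1 / 2) (by norm_num) (by norm_num)
    (by
      intro f hf hfb _
      obtain ⟨b1, b2⟩ := bm f hf hfb
      have c1 := hP.add (b1.sub (h.dualDeriv₁_bddMeas c d b1 b2))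
      have c2 := hR.add (b2.sub (h.dualDeriv₂_bddMeas c d b1 b2))
      refine ⟨c1.meas.prodMk c2.meas, ?_⟩
      obtain ⟨N1, hN1⟩ := c1.bdd
      obtain ⟨N2, hN2⟩ := c2.bdd
      exact ⟨max N1 N2, fun x _ => max_le_max (hN1 x) (hN2 x)⟩)
    (by
      intro f g hf hfb _ hg hgb _ C hC hfg ξ hξ
      obtain ⟨b1, b2⟩ := bm f hf hfb
      obtain ⟨b3, b4⟩ := bm g hg hgb
      obtain ⟨l1, l2⟩ := h.dualDeriv_sub c d b1 b2 b3 b4 ξ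
      obtain ⟨k1, k2⟩ := hN γ C hγ1 hC (fun x => (f x).1 - (g x).1) (fun x => (f x).2 - (g x).2)
        (fun s hs => (norm_fst_le (f s - g s)).trans (hfg s hs))
        (fun s hs => (norm_snd_le (f s - g s)).trans (hfg s hs)) ξ hξ
      have hle : N / γ * (C * Real.exp (γ * (1 - ξ))) ≤
          1 / 2 * (C * Real.exp (γ * (1 - ξ))) := by
        refine mul_le_mul_of_nonneg_right ?_ (by positivity)
        rw [div_le_iff₀ (by linarith), hγ]
        linarith
      rw [l1] at k1
      rw [l2] at k2
      refine max_le ?_ ?_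
      · refine le_trans (le_of_eq ?_) (k1.trans hle)
        rw [Real.norm_eq_abs]
        congr 1
        simp only [Prod.fst_sub]
        ring
      · refine le_trans (le_of_eq ?_) (k2.trans hle)
        rw [Real.norm_eq_abs]
        congr 1
        simp only [Prod.snd_sub]
        ring)
  obtain ⟨b1, b2⟩ := bm f hf hfb
  refine ⟨_, _, b1, b2, fun ξ hξ => ?_⟩
  have e := hfix ξ hξ
  have e1 := congrArg Prod.fst e
  have e2 := congrArg Prod.snd e
  simp only at e1 e2
  exact ⟨by linarith, by linarith⟩

/-- The inverse of the backstepping transformation restores the source terms. -/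
theorem transform_symm {U V Δu Δv : ℝ → ℝ}
    (hU : Integrable U m01) (hV : Integrable V m01) (hΔu : Integrable Δu m01)
    (hΔv : Integrable Δv m01) {A₀ A₁ B₀ B₁ : ℝ} (hA : A₀ = S.q * B₀)
    (hα : IntegratedTransport S.lam (fun x => U x - k.op₁ U V x) (fun x => Δu x - k.op₁ Δu Δv x) A₀
        (A₁ - k.op₁ U V 1))
    (hβ : IntegratedTransport (-S.mu) (fun x => V x - k.op₂ U V x) (fun x => Δv x - k.op₂ Δu Δv x)
      B₀ (B₁ - k.op₂ U V 1)) :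
    IntegratedTransport S.lam U (fun x => Δu x - S.sPM x * V x) A₀ A₁ ∧
      IntegratedTransport (-S.mu) V (fun x => Δv x - S.sMP x * U x) B₀ B₁ := by
  have key : ∀ (c d : ℝ) (P R : ℝ → ℝ), BddMeas₁ P → BddMeas₁ R →
      defect S.lam U (fun x => Δu x - S.sPM x * V x) A₀ A₁ c P +
        defect (-S.mu) V (fun x => Δv x - S.sMP x * U x) B₀ B₁ d R = 0 := by
    intro c d P R hP hR
    obtain ⟨p, r, hp, hr, hpr⟩ := h.exists_dualDeriv_eq c d hP hR
    rw [← defect_congr fun x hx => (hpr x hx).1, ← defect_congr fun x hx => (hpr x hx).2,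
      h.defect_add_defect hU hV hΔu hΔv hA c d hp hr,
      hα.defect_eq_zero (integrable_fun_sub hU ((h.tri.op₁_bddMeas hU hV).integrable _))
        (integrable_fun_sub hΔu ((h.tri.op₁_bddMeas hΔu hΔv).integrable _)) c hp,
      hβ.defect_eq_zero (integrable_fun_sub hV ((h.tri.op₂_bddMeas hU hV).integrable _))
        (integrable_fun_sub hΔv ((h.tri.op₂_bddMeas hΔu hΔv).integrable _)) d hr, add_zero]
  have z := BddMeas₁.const 0
  constructor
  · refine IntegratedTransport.of_defect hU (integrable_fun_sub hΔu (h.sPM.integrable_mul hV))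
      fun c p _ hp => ?_
    have := key c 0 p _ hp z
    rwa [defect_zero, add_zero] at this
  · refine IntegratedTransport.of_defect hV (integrable_fun_sub hΔv (h.sMP.integrable_mul hU))
      fun d r _ hr => ?_
    have := key 0 d _ r z hr
    rwa [defect_zero, zero_add] at this

end IsRegularPair

/-! ### Operators on square integrable functions -/

/-- The space `L²(ℝ)`. -/
abbrev LineL2 : Type := Lp ℝ 2 (volume : Measure ℝ)

/-- A Bochner integral of `L²` functions can be computed pointwise. -/
theorem integral_Lp_ae {X Y : Type*} [MeasurableSpace X] [MeasurableSpace Y] {μ : Measure X}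
    {ν : Measure Y} [SigmaFinite μ] [SigmaFinite ν] {c : Y → Lp ℝ 2 μ} (hc : Integrable c ν)
    {f : Y → X → ℝ} (hf : Measurable (Function.uncurry f)) (hcf : ∀ᵐ s ∂ν, c s =ᵐ[μ] f s) :
    (∫ s, c s ∂ν : Lp ℝ 2 μ) =ᵐ[μ] fun x => ∫ s, f s x ∂ν := by
  have I : ∀ E, MeasurableSet E → μ E < ⊤ →
      Integrable (Function.uncurry f) (ν.prod (μ.restrict E)) := by
    intro E hE hμE
    have : IsFiniteMeasure (μ.restrict E) := ⟨by simpa using hμE⟩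
    rw [integrable_prod_iff hf.aestronglyMeasurable]
    refine ⟨?_, ?_⟩
    · filter_upwards [hcf] with s hs
      exact (((Lp.memLp (c s)).restrict E).integrable one_le_two).congr (ae_restrict_of_ae hs)
    -- Cauchy-Schwarz against the indicator of `E` bounds the inner integrals by the norm of `c s`
    · set one : Lp ℝ 2 μ := indicatorConstLp 2 hE hμE.ne (1 : ℝ)
      refine (hc.norm.const_mul ‖one‖).mono'
        (hf.norm.stronglyMeasurable.integral_prod_right'
          (f := fun p : Y × X => ‖Function.uncurry f p‖)).aestronglyMeasurable ?_
      filter_upwards [hcf] with s hs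
      have e : ∫ y, ‖Function.uncurry f (s, y)‖ ∂μ.restrict E = inner ℝ one |c s| := by
        rw [L2.inner_indicatorConstLp_one]
        refine integral_congr_ae (ae_restrict_of_ae ?_)
        filter_upwards [hs, Lp.coeFn_abs (c s)] with y h1 h2
        rw [h2, h1, Real.norm_eq_abs]; rfl
      rw [e, ← norm_abs_eq_norm (c s)]
      exact norm_inner_le_norm _ _
  have J : ∀ E, MeasurableSet E → μ E < ⊤ → IntegrableOn (fun x => ∫ s, f s x ∂ν) E μ :=
    fun E hE hμE => (I E hE hμE).integral_prod_right
  refine ae_eq_of_forall_setIntegral_eq_of_sigmaFinite ?_ J ?_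
  · intro E hE hμE
    have : IsFiniteMeasure (μ.restrict E) := ⟨by simpa using hμE⟩
    exact ((Lp.memLp _).restrict E).integrable one_le_two
  · intro E hE hμE
    rw [← L2.inner_indicatorConstLp_one (𝕜 := ℝ) hE hμE.ne, ← integral_inner hc,
      ← integral_integral_swap (I E hE hμE)]
    refine integral_congr_ae ?_
    filter_upwards [hcf] with s hs
    rw [L2.inner_indicatorConstLp_one]
    exact integral_congr_ae (ae_restrict_of_ae hs)

/-- Translation by `c` on `L²(ℝ)`. -/
def shift (c : ℝ) : LineL2 →ₗᵢ[ℝ] LineL2 :=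
  Lp.compMeasurePreservingₗᵢ ℝ (fun t => t - c) (measurePreserving_sub_right volume c)

theorem shift_coe (c : ℝ) (f : LineL2) : shift c f =ᵐ[volume] fun t => f (t - c) :=
  Lp.coeFn_compMeasurePreserving f (measurePreserving_sub_right volume c)

theorem continuous_shift (f : LineL2) : Continuous fun c => shift c f := by
  have hg : Continuous fun c : ℝ => (⟨fun t => t - c, by fun_prop⟩ : C(ℝ, ℝ)) :=
    ContinuousMap.continuous_of_continuous_uncurry _ (by
      simp only [Function.uncurry_def, ContinuousMap.coe_mk]; fun_prop)
  exact (continuous_const (y := f)).compMeasurePreservingLp hg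
    (fun c => measurePreserving_sub_right volume c) (by simp)

theorem map_mul_volume {m : ℝ} (hm : m ≠ 0) :
    Measure.map (fun x => m * x) volume = ENNReal.ofReal |m⁻¹| • (volume : Measure ℝ) :=
  Real.map_volume_mul_left hm

/-- The dilation `f ↦ f (m ·)` on `L²(ℝ)`. -/
def dilate (m : ℝ) (hm : m ≠ 0) : LineL2 →L[ℝ] LineL2 :=
  (Lp.compMeasurePreservingₗᵢ ℝ (fun x => m * x)
    ((measurable_const_mul m).measurePreserving volume)).toContinuousLinearMap ∘L
    Lp.LpToLpOfMeasureLeSMul (c := ENNReal.ofReal |m⁻¹|) ENNReal.ofReal_ne_top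
      (map_mul_volume hm).le

theorem ae_comp_mul {m : ℝ} (hm : m ≠ 0) {p : ℝ → Prop} (h : ∀ᵐ x, p x) : ∀ᵐ x, p (m * x) := by
  have : Measure.QuasiMeasurePreserving (fun x : ℝ => m * x) volume volume :=
    ⟨measurable_const_mul m, by
      rw [map_mul_volume hm]; exact Measure.smul_absolutelyContinuous⟩
  exact this.ae h

theorem ae_comp_add (c : ℝ) {p : ℝ → Prop} (h : ∀ᵐ x, p x) : ∀ᵐ x, p (x + c) :=
  (measurePreserving_add_right volume c).quasiMeasurePreserving.ae h

theorem ae_comp_sub (c : ℝ) {p : ℝ → Prop} (h : ∀ᵐ x, p x) : ∀ᵐ x, p (x - c) :=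
  (measurePreserving_sub_right volume c).quasiMeasurePreserving.ae h

theorem dilate_coe (m : ℝ) (hm : m ≠ 0) (f : LineL2) :
    dilate m hm f =ᵐ[volume] fun x => f (m * x) := by
  refine (Lp.coeFn_compMeasurePreserving _ _).trans ?_
  have := Lp.coeFn_LpToLpOfMeasureLeSMul (p := 2) ENNReal.ofReal_ne_top (map_mul_volume hm).le f
  exact ((measurable_const_mul m).measurePreserving volume).quasiMeasurePreserving.ae_eq this

/-- Restriction to `[0,1]`. -/
def restrict01 : LineL2 →L[ℝ] StateL2 := LpToLpRestrictCLM ℝ ℝ ℝ volume 2 (Icc 0 1)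

theorem restrict01_coe (f : LineL2) : restrict01 f =ᵐ[m01] f :=
  LpToLpRestrictCLM_coeFn ℝ (Icc (0 : ℝ) 1) f

theorem indicator_ae_eq {s : Set ℝ} (hs : MeasurableSet s) {f g : ℝ → ℝ}
    (h : f =ᵐ[volume.restrict s] g) : s.indicator f =ᵐ[volume] s.indicator g := by
  filter_upwards [(ae_restrict_iff' hs).1 h] with x hx
  by_cases hxs : x ∈ s
  · simp only [indicator_of_mem hxs, hx hxs]
  · simp only [indicator_of_notMem hxs]

/-- Extension by zero. -/
def extend (s : Set ℝ) (hs : MeasurableSet s) : Lp ℝ 2 (volume.restrict s) →L[ℝ] LineL2 :=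
  LinearMap.mkContinuous
    { toFun := fun f => ((memLp_indicator_iff_restrict hs).2 (Lp.memLp f)).toLp (s.indicator f)
      map_add' := fun f g => by
        rw [← MemLp.toLp_add]
        refine MemLp.toLp_congr _ _ ?_
        rw [← indicator_add']
        exact (indicator_ae_eq hs (Lp.coeFn_add f g))
      map_smul' := fun c f => by
        rw [RingHom.id_apply, ← MemLp.toLp_const_smul]
        refine MemLp.toLp_congr _ _ ?_
        refine (indicator_ae_eq hs (Lp.coeFn_smul c f)).trans
          (Filter.Eventually.of_forall fun x => ?_)
        exact indicator_const_smul_apply s c f x } 1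
    (fun f => by
      rw [one_mul, LinearMap.coe_mk, AddHom.coe_mk, Lp.norm_toLp,
        eLpNorm_indicator_eq_eLpNorm_restrict hs, Lp.norm_def])

theorem extend_coe {s : Set ℝ} (hs : MeasurableSet s) (f : Lp ℝ 2 (volume.restrict s)) :
    extend s hs f =ᵐ[volume] s.indicator f := by
  have e : extend s hs f =
    ((memLp_indicator_iff_restrict hs).2 (Lp.memLp f)).toLp (s.indicator f) := rfl
  rw [e]
  exact MemLp.coeFn_toLp _

theorem norm_extend_le {s : Set ℝ} (hs : MeasurableSet s) (f : Lp ℝ 2 (volume.restrict s)) :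
    ‖extend s hs f‖ ≤ ‖f‖ := by
  refine ((extend s hs).le_opNorm f).trans ?_
  exact mul_le_of_le_one_left (norm_nonneg _) (LinearMap.mkContinuous_norm_le _ zero_le_one _)

/-- Multiplication by the indicator function of `s`. -/
def cutL (s : Set ℝ) (hs : MeasurableSet s) : LineL2 →L[ℝ] LineL2 :=
  extend s hs ∘L LpToLpRestrictCLM ℝ ℝ ℝ volume 2 s

theorem cutL_coe {s : Set ℝ} (hs : MeasurableSet s) (f : LineL2) :
    cutL s hs f =ᵐ[volume] s.indicator f :=
  (extend_coe hs _).trans (indicator_ae_eq hs (LpToLpRestrictCLM_coeFn ℝ s f))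

theorem norm_cutL_le {s : Set ℝ} (hs : MeasurableSet s) (f : LineL2) : ‖cutL s hs f‖ ≤ ‖f‖ := by
  refine Lp.norm_le_norm_of_ae_le ?_
  filter_upwards [cutL_coe hs f] with x hx
  rw [hx]
  exact norm_indicator_le_norm_self _ _

instance : IsProbabilityMeasure m01 := ⟨by simp⟩

theorem Lp.integrable01 (f : StateL2) : Integrable f m01 := (Lp.memLp f).integrable one_le_two

theorem integral_abs_le_norm (f : StateL2) : ∫ x, |f x| ∂m01 ≤ ‖f‖ := by
  have := norm_inner_le_norm (𝕜 := ℝ)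
    (indicatorConstLp 2 MeasurableSet.univ (measure_ne_top m01 univ) (1 : ℝ)) |f|
  rw [L2.inner_indicatorConstLp_one, norm_abs_eq_norm, norm_indicatorConstLp (by simp) (by simp),
    setIntegral_univ, integral_congr_ae (Lp.coeFn_abs f)] at this
  simp at this
  exact (le_abs_self _).trans this

/-- The functional `u ↦ ∫ f u`. -/
def pair (f : ℝ → ℝ) (hf : BddMeas₁ f) : StateL2 →L[ℝ] ℝ := innerSL ℝ ((hf.memLp 2 m01).toLp f)

theorem pair_apply {f : ℝ → ℝ} (hf : BddMeas₁ f) (u : StateL2) :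
    pair f hf u = ∫ x, f x * u x ∂m01 := by
  rw [pair, innerSL_apply_apply, L2.inner_def]
  refine integral_congr_ae ?_
  filter_upwards [(hf.memLp 2 m01).coeFn_toLp] with x hx
  rw [hx]
  simp [inner, mul_comm]

/-- The operator `intOp κ` on `L²(0,1)`. -/
def opL (κ : ℝ → ℝ → ℝ) (hκ : BddMeas₂ κ) : StateL2 →L[ℝ] StateL2 :=
  LinearMap.mkContinuousOfExistsBound
    { toFun := fun f => ((intOp_bddMeas hκ (Lp.integrable01 f)).memLp 2 m01).toLp (intOp κ f)
      map_add' := fun f g => by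
        rw [← MemLp.toLp_add]
        refine MemLp.toLp_congr _ _ (Filter.Eventually.of_forall fun x => ?_)
        rw [intOp_congr_ae κ (Lp.coeFn_add f g)]
        exact intOp_add hκ (Lp.integrable01 f) (Lp.integrable01 g) x
      map_smul' := fun c f => by
        rw [RingHom.id_apply, ← MemLp.toLp_const_smul]
        refine MemLp.toLp_congr _ _ (Filter.Eventually.of_forall fun x => ?_)
        rw [intOp_congr_ae κ (Lp.coeFn_smul c f)]
        simp only [intOp, Pi.smul_apply, smul_eq_mul]
        rw [← integral_const_mul]
        exact integral_congr_ae (Filter.Eventually.of_forall fun y => by ring_nf) }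
    (by
      obtain ⟨M, hM0, hM⟩ := hκ.exists_pos
      refine ⟨M, fun f => ?_⟩
      have := Lp.norm_le_of_ae_bound (p := 2)
        (f := ((intOp_bddMeas hκ (Lp.integrable01 f)).memLp 2 m01).toLp (intOp κ f))
        (C := M * ‖f‖) (by positivity) (by
          filter_upwards [MemLp.coeFn_toLp
            ((intOp_bddMeas hκ (Lp.integrable01 f)).memLp 2 m01)] with x hx
          rw [hx, intOp]
          refine (norm_integral_le_integral_norm _).trans ?_
          refine le_trans ?_ (mul_le_mul_of_nonneg_left (integral_abs_le_norm f) hM0.le)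
          rw [← integral_const_mul]
          refine integral_mono (((hκ.left x).integrable_mul (Lp.integrable01 f)).norm)
            ((Lp.integrable01 f).abs.const_mul M) fun y => ?_
          simp only [norm_mul, Real.norm_eq_abs]
          exact mul_le_mul_of_nonneg_right (hM x y) (abs_nonneg _))
      refine this.trans (le_of_eq ?_)
      simp [measureUnivNNReal])

theorem opL_coe {κ : ℝ → ℝ → ℝ} (hκ : BddMeas₂ κ) (f : StateL2) : opL κ hκ f =ᵐ[m01] intOp κ f :=
  MemLp.coeFn_toLp ((intOp_bddMeas hκ (Lp.integrable01 f)).memLp 2 m01)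

/-! ### Transport waves and the weak form -/

theorem LineL2.intervalIntegrable (f : LineL2) (a b : ℝ) : IntervalIntegrable f volume a b := by
  rw [intervalIntegrable_iff']
  have : IsFiniteMeasure (volume.restrict (uIcc a b)) := ⟨by simp⟩
  exact ((Lp.memLp f).restrict _).integrable one_le_two

theorem IntegratedTransport.congr {a : ℝ} {W W' w w' : ℝ → ℝ} {B₀ B₁ : ℝ}
    (h : IntegratedTransport a W w B₀ B₁) (hW : W =ᵐ[m01] W') (hw : w =ᵐ[m01] w') :
    IntegratedTransport a W' w' B₀ B₁ := by
  refine ⟨?_, by rw [← h.total, integral_congr_ae hw]⟩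
  filter_upwards [h.ae_eq, hW, ae_restrict_mem measurableSet_Icc] with x hx h1 hx'
  rw [← hx, h1, ← adjOp_tailKer hx', ← adjOp_tailKer hx']
  congr 1
  exact (intOp_congr_ae (fun x y => tailKer y x) hw x).symm

/-- The wave of speed `a` with trace `f (· + c)` at `0`: the profile `x ↦ f (t + c - x / a)`. -/
def wave (a : ℝ) (ha : a ≠ 0) (c : ℝ) (f : LineL2) (t : ℝ) : StateL2 :=
  restrict01 (dilate (-a⁻¹) (neg_ne_zero.2 (inv_ne_zero ha)) (shift (-(t + c)) f))

theorem wave_coe {a : ℝ} (ha : a ≠ 0) (c : ℝ) (f : LineL2) (t : ℝ) :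
    wave a ha c f t =ᵐ[m01] fun x => f (t + c - x / a) := by
  refine (restrict01_coe _).trans (ae_restrict_of_ae ?_)
  filter_upwards [dilate_coe (-a⁻¹) (neg_ne_zero.2 (inv_ne_zero ha)) (shift (-(t + c)) f),
    ae_comp_mul (neg_ne_zero.2 (inv_ne_zero ha)) (shift_coe (-(t + c)) f)] with x h1 h2
  rw [h1, h2]
  congr 1
  ring

theorem continuous_wave {a : ℝ} (ha : a ≠ 0) (c : ℝ) (f : LineL2) : Continuous (wave a ha c f) := by
  have h := (continuous_shift f).comp (by fun_prop : Continuous fun t : ℝ => -(t + c))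
  exact restrict01.continuous.comp ((dilate _ _).continuous.comp h)

/-- A wave solves the integrated transport equation; its trace at `1` is the trace at `0` delayed by
`1 / a`. -/
theorem wave_transport {a : ℝ} (ha : a ≠ 0) (c : ℝ) (f : LineL2) {t : ℝ} (ht : 0 ≤ t) :
    IntegratedTransport a (∫ s in (0 : ℝ)..t, wave a ha c f s : StateL2)
      (wave a ha c f t - wave a ha c f 0 : StateL2)
      (∫ s in (0 : ℝ)..t, f (s + c)) (∫ s in (0 : ℝ)..t, f (s + c - 1 / a)) := by
  have hI := LineL2.intervalIntegrable f
  have hw : ∀ x, ∫ y in (0 : ℝ)..x, (f (t + c - y / a) - f (0 + c - y / a)) =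
      a * ((∫ y in (t + c - x / a)..(t + c), f y) - ∫ y in (c - x / a)..c, f y) := by
    intro x
    have e1 := intervalIntegral.integral_comp_sub_div (a := 0) (b := x) (⇑f) ha (t + c)
    have e2 := intervalIntegral.integral_comp_sub_div (a := 0) (b := x) (⇑f) ha (0 + c)
    have j : ∀ d, IntervalIntegrable (fun y => f (d - y / a)) volume 0 x := fun d => by
      have := ((hI (d - 0 / a) (d - x / a)).comp_sub_left d).comp_mul_left (c := a⁻¹)
      simpa [div_eq_inv_mul, ha] using this
    rw [intervalIntegral.integral_sub (j _) (j _), e1, e2, smul_eq_mul, smul_eq_mul, zero_div,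
      sub_zero, sub_zero, zero_add, mul_sub]
  have hW : (∫ s in (0 : ℝ)..t, wave a ha c f s : StateL2) =ᵐ[m01]
      fun x => ∫ s in (c - x / a)..(t + c - x / a), f s := by
    rw [intervalIntegral.integral_of_le ht]
    refine (integral_Lp_ae (f := fun s x => f (s + c - x / a))
      ((continuous_wave ha c f).integrableOn_Ioc) ?_
      (Filter.Eventually.of_forall fun s => wave_coe ha c f s)).trans
      (Filter.Eventually.of_forall fun x => ?_)
    · exact (Lp.stronglyMeasurable f).measurable.comp (by fun_prop)
    · have := intervalIntegral.integral_comp_add_right (a := 0) (b := t) (⇑f) (c - x / a)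
      beta_reduce
      rw [← intervalIntegral.integral_of_le ht]
      simp only [add_sub_assoc]
      rw [this, zero_add]
  have hΔ : (wave a ha c f t - wave a ha c f 0 : StateL2) =ᵐ[m01]
      fun y => f (t + c - y / a) - f (0 + c - y / a) := by
    filter_upwards [Lp.coeFn_sub (wave a ha c f t) (wave a ha c f 0), wave_coe ha c f t,
      wave_coe ha c f 0] with x h1 h2 h3
    rw [h1, Pi.sub_apply, h2, h3]
  have hB : ∀ d, ∫ s in (0 : ℝ)..t, f (s + c - d) = ∫ s in (c - d)..(t + c - d), f s := by
    intro d
    have := intervalIntegral.integral_comp_add_right (a := 0) (b := t) (⇑f) (c - d)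
    simp only [add_sub_assoc]
    rw [this, zero_add]
  have hB0 := hB 0
  simp only [sub_zero] at hB0
  refine IntegratedTransport.congr (W := fun x => ∫ s in (c - x / a)..(t + c - x / a), f s)
    (w := fun y => f (t + c - y / a) - f (0 + c - y / a)) ⟨?_, ?_⟩ hW.symm hΔ.symm
  · refine Filter.Eventually.of_forall fun x => ?_
    rw [hw, hB0, ← mul_add]
    congr 1
    have h1 := intervalIntegral.integral_add_adjacent_intervals (hI (c - x / a) (t + c - x / a))
      (hI (t + c - x / a) (t + c))
    have h2 := intervalIntegral.integral_add_adjacent_intervals (hI (c - x / a) c) (hI c (t + c))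
    linarith
  · have e : ∫ y, (f (t + c - y / a) - f (0 + c - y / a)) ∂m01 =
        ∫ y in (0 : ℝ)..1, (f (t + c - y / a) - f (0 + c - y / a)) := by
      rw [intervalIntegral.integral_of_le zero_le_one, integral_Icc_eq_integral_Ioc]
    rw [e, hw, hB0, hB]
    congr 1
    have h1 := intervalIntegral.integral_add_adjacent_intervals (hI (c - 1 / a) (t + c - 1 / a))
      (hI (t + c - 1 / a) (t + c))
    have h2 := intervalIntegral.integral_add_adjacent_intervals (hI (c - 1 / a) c) (hI c (t + c))
    linarith

/-- Both integrals are equal by Fubini, and they add up to the square of the total integral. -/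
theorem integral_mul_adjOp_tailKer {g : ℝ → ℝ} (hg : Integrable g m01) :
    (∫ x, g x * adjOp tailKer g x ∂m01) = (∫ x, g x ∂m01) ^ 2 / 2 ∧
      (∫ x, intOp tailKer g x * g x ∂m01) = (∫ x, g x ∂m01) ^ 2 / 2 := by
  have h1 := integral_intOp_mul tailKer_bddMeas hg hg
  have i1 := integrable_mul_bdd hg (adjOp_bddMeas tailKer_bddMeas hg)
  have i2 := (intOp_bddMeas tailKer_bddMeas hg).integrable_mul hg
  have h2 : (∫ x, g x * adjOp tailKer g x ∂m01) + ∫ x, intOp tailKer g x * g x ∂m01 =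
      (∫ x, g x ∂m01) ^ 2 := by
    rw [← integral_add i1 i2, sq, ← integral_mul_const]
    refine integral_congr_ae ?_
    filter_upwards [ae_restrict_mem measurableSet_Icc] with x hx
    have hgi : ∀ a b, a ∈ Icc (0 : ℝ) 1 → b ∈ Icc (0 : ℝ) 1 → IntervalIntegrable g volume a b :=
      fun a b ha hb => by
        rw [intervalIntegrable_iff']
        exact IntegrableOn.mono_set hg (uIcc_subset_Icc ha hb)
    have h0 : (0 : ℝ) ∈ Icc (0 : ℝ) 1 := ⟨le_rfl, zero_le_one⟩
    have h1 : (1 : ℝ) ∈ Icc (0 : ℝ) 1 := ⟨zero_le_one, le_rfl⟩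
    rw [adjOp_tailKer hx, intOp_tailKer hx, integral_Icc_eq_integral_Ioc,
      ← intervalIntegral.integral_of_le zero_le_one,
      ← intervalIntegral.integral_add_adjacent_intervals (hgi 0 x h0 hx) (hgi x 1 hx h1)]
    ring
  constructor <;> linarith

theorem inner_eq_mul (x y : ℝ) : inner ℝ x y = x * y := by
  simp [inner, mul_comm]

/-- Uniqueness for the transport equation without inflow: the inner product of the time integral
`Γ` of the solution `γ` with `γ` is nonpositive, so that `‖Γ‖` does not increase. -/
theorem IntegratedTransport.eq_zero {a : ℝ} (ha : a ≠ 0) {γ : ℝ → StateL2} {T : ℝ} (hT : 0 < T)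
    (hγ : ContinuousOn γ (Icc 0 T)) {B₀ B₁ : ℝ → ℝ}
    (h : ∀ t ∈ Icc 0 T, IntegratedTransport a (∫ s in (0 : ℝ)..t, γ s : StateL2) (γ t)
      (B₀ t) (B₁ t))
    (hin : ∀ t ∈ Icc 0 T, (0 < a → B₀ t = 0) ∧ (a < 0 → B₁ t = 0)) :
    ∀ t ∈ Icc 0 T, γ t = 0 ∧ B₀ t = B₁ t := by
  -- a continuous extension of `γ` to the line, so that its primitive is differentiable everywhere
  set g : ℝ → StateL2 := IccExtend hT.le ((Icc 0 T).domRestrict γ) with hg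
  have hgc : Continuous g := (hγ.domRestrict).Icc_extend'
  have hge : ∀ t ∈ Icc 0 T, g t = γ t := fun t ht => IccExtend_of_mem _ _ ht
  set G : ℝ → StateL2 := fun t => ∫ s in (0 : ℝ)..t, g s with hG
  have hGe : ∀ t ∈ Icc 0 T, G t = ∫ s in (0 : ℝ)..t, γ s := fun t ht =>
    intervalIntegral.integral_congr fun s hs => by
      rw [uIcc_of_le ht.1] at hs
      exact hge s ⟨hs.1, hs.2.trans ht.2⟩
  have hGd : ∀ t, HasDerivAt G (g t) t := fun t => (hgc.integral_hasStrictDerivAt 0 t).hasDerivAt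
  have hneg : ∀ t ∈ Icc 0 T, inner ℝ (G t) (g t) ≤ 0 := by
    intro t ht
    rw [hGe t ht, hge t ht]
    have hi := Lp.integrable01 (γ t)
    obtain ⟨q1, q2⟩ := integral_mul_adjOp_tailKer hi
    have hh := h t ht
    rw [L2.inner_def]
    rcases lt_or_gt_of_ne ha with han | hap
    · have hB := (hin t ht).2 han
      have e : ∫ x, inner ℝ ((∫ s in (0 : ℝ)..t, γ s : StateL2) x) (γ t x) ∂m01 =
          a⁻¹ * ∫ x, intOp tailKer (γ t) x * γ t x ∂m01 := by
        rw [← integral_const_mul]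
        refine integral_congr_ae ?_
        filter_upwards [hh.ae_eq, ae_restrict_mem measurableSet_Icc] with x hx hx'
        have htot := hh.total
        rw [hB, sub_zero, integral_Icc_eq_integral_Ioc,
          ← intervalIntegral.integral_of_le zero_le_one,
          ← intervalIntegral.integral_add_adjacent_intervals (b := x)] at htot
        · rw [intOp_tailKer hx']
          rw [inner_eq_mul]
          have hax : a * (∫ s in (0 : ℝ)..t, γ s : StateL2) x = ∫ y in x..1, γ t y := by linarith
          rw [← hax]
          field_simp
        · rw [intervalIntegrable_iff']
          exact IntegrableOn.mono_set hi (uIcc_subset_Icc ⟨le_rfl, zero_le_one⟩ hx')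
        · rw [intervalIntegrable_iff']
          exact IntegrableOn.mono_set hi (uIcc_subset_Icc hx' ⟨zero_le_one, le_rfl⟩)
      rw [e, q2]
      exact mul_nonpos_of_nonpos_of_nonneg (inv_nonpos.2 han.le) (by positivity)
    · have hB := (hin t ht).1 hap
      have e : ∫ x, inner ℝ ((∫ s in (0 : ℝ)..t, γ s : StateL2) x) (γ t x) ∂m01 =
          -a⁻¹ * ∫ x, γ t x * adjOp tailKer (γ t) x ∂m01 := by
        rw [← integral_const_mul]
        refine integral_congr_ae ?_
        filter_upwards [hh.ae_eq, ae_restrict_mem measurableSet_Icc] with x hx hx'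
        rw [adjOp_tailKer hx']
        rw [inner_eq_mul]
        rw [hB, mul_zero] at hx
        have : ∫ y in (0 : ℝ)..x, γ t y = -(a * (∫ s in (0 : ℝ)..t, γ s : StateL2) x) := by
          linarith
        rw [this]
        field_simp
      rw [e, q1]
      exact mul_nonpos_of_nonpos_of_nonneg (neg_nonpos.2 (inv_nonneg.2 hap.le)) (by positivity)
  have hanti : AntitoneOn (fun t => ‖G t‖ ^ 2) (Icc 0 T) := by
    have hd : ∀ t, HasDerivAt (fun t => ‖G t‖ ^ 2) (2 * inner ℝ (G t) (g t)) t :=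
      fun t => (hGd t).norm_sq
    refine antitoneOn_of_deriv_nonpos (convex_Icc 0 T)
      (fun t _ => (hd t).continuousAt.continuousWithinAt)
      (fun t _ => (hd t).differentiableAt.differentiableWithinAt) fun t ht => ?_
    rw [(hd t).deriv]
    have := hneg t (interior_subset ht)
    linarith
  have hG0 : ∀ t ∈ Icc 0 T, G t = 0 := by
    intro t ht
    have h1 := hanti ⟨le_rfl, hT.le⟩ ht ht.1
    have h2 : G 0 = 0 := by simp [hG]
    simp only [h2, norm_zero] at h1
    have h3 : ‖G t‖ ^ 2 = 0 := le_antisymm (by simpa using h1) (sq_nonneg _)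
    simpa using h3
  intro t ht
  have hγ0 : γ t = 0 := by
    rw [← hge t ht]
    have h1 : HasDerivWithinAt G (g t) (Icc 0 T) t := (hGd t).hasDerivWithinAt
    have h2 : HasDerivWithinAt G 0 (Icc 0 T) t :=
      (hasDerivWithinAt_const t (Icc 0 T) (0 : StateL2)).congr hG0 (hG0 t ht)
    exact ((uniqueDiffOn_Icc hT) t ht).eq_deriv _ h1 h2
  refine ⟨hγ0, ?_⟩
  have h1 := (h t ht).total
  rw [hγ0, integral_congr_ae (Lp.coeFn_zero ..)] at h1
  simp only [Pi.zero_apply, integral_zero] at h1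
  have h2 := (mul_eq_zero.1 h1.symm).resolve_left ha
  linarith

/-- The source and flux terms of the weak form, integrated in time. -/
theorem integral_weak_rhs {a t : ℝ} {σ : ℝ → ℝ} (hσ : BddMeas₁ σ) {z w : ℝ → StateL2}
    (hz : IntervalIntegrable z volume 0 t) (hw : IntervalIntegrable w volume 0 t) {z₀ z₁ : ℝ → ℝ}
    (h0 : IntervalIntegrable z₀ volume 0 t) (h1 : IntervalIntegrable z₁ volume 0 t) {φ p : ℝ → ℝ}
    {c : ℝ} (hp : BddMeas₁ p) (hφ : ∀ x ∈ Icc (0 : ℝ) 1, φ x = prim c p x)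
    (hφ' : ∀ x ∈ Icc (0 : ℝ) 1, deriv φ x = p x) :
    ∫ s in (0 : ℝ)..t, ((∫ x in Icc (0 : ℝ) 1, (a * z s x * deriv φ x + σ x * w s x * φ x))
        + a * (z₀ s * φ 0 - z₁ s * φ 1)) =
      a * (∫ x, (∫ s in (0 : ℝ)..t, z s : StateL2) x * p x ∂m01)
        + (∫ x, σ x * (∫ s in (0 : ℝ)..t, w s : StateL2) x * prim c p x ∂m01)
        + a * (prim c p 0 * (∫ s in (0 : ℝ)..t, z₀ s) - c * ∫ s in (0 : ℝ)..t, z₁ s) := by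
  have hP := prim_bddMeas c hp
  have e : ∀ s, ((∫ x in Icc (0 : ℝ) 1, (a * z s x * deriv φ x + σ x * w s x * φ x))
        + a * (z₀ s * φ 0 - z₁ s * φ 1)) =
      (a * pair p hp (z s) + pair _ (hσ.mul hP) (w s)) +
        (a * prim c p 0 * z₀ s - a * c * z₁ s) := by
    intro s
    rw [pair_apply, pair_apply, ← integral_const_mul, ← integral_add
      ((hp.integrable_mul (Lp.integrable01 _)).const_mul a)
      ((hσ.mul hP).integrable_mul (Lp.integrable01 _)), hφ 0 ⟨le_rfl, zero_le_one⟩,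
      hφ 1 ⟨zero_le_one, le_rfl⟩, prim_one]
    congr 1
    · refine integral_congr_ae ?_
      filter_upwards [ae_restrict_mem measurableSet_Icc] with x hx
      rw [hφ x hx, hφ' x hx]
      ring
    · ring
  simp only [e]
  have I : ∀ {q : ℝ → ℝ} (hq : BddMeas₁ q) {y : ℝ → StateL2},
      IntervalIntegrable y volume 0 t →
      IntervalIntegrable (fun s => pair q hq (y s)) volume 0 t := by
    intro q hq y hy
    exact ⟨(pair _ hq).integrable_comp hy.1, (pair _ hq).integrable_comp hy.2⟩
  rw [intervalIntegral.integral_add (((I hp hz).const_mul a).add (I (hσ.mul hP) hw))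
    ((h0.const_mul _).sub (h1.const_mul _)),
    intervalIntegral.integral_add ((I hp hz).const_mul a) (I (hσ.mul hP) hw),
    intervalIntegral.integral_sub (h0.const_mul _) (h1.const_mul _),
    intervalIntegral.integral_const_mul, intervalIntegral.integral_const_mul,
    intervalIntegral.integral_const_mul, ContinuousLinearMap.intervalIntegral_comp_comm _ hz,
    ContinuousLinearMap.intervalIntegral_comp_comm _ hw, pair_apply, pair_apply]
  have e1 : ∀ x, p x * (∫ s in (0 : ℝ)..t, z s : StateL2) x =
    (∫ s in (0 : ℝ)..t, z s : StateL2) x * p x := fun x => mul_comm _ _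
  have e2 : ∀ x, σ x * prim c p x * (∫ s in (0 : ℝ)..t, w s : StateL2) x =
    σ x * (∫ s in (0 : ℝ)..t, w s : StateL2) x * prim c p x := fun x => by ring
  simp only [e1, e2]
  ring

theorem integrable_source {σ : ℝ → ℝ} (hσ : BddMeas₁ σ) (z W : StateL2) :
    Integrable (fun x => z x - σ x * W x) m01 :=
  integrable_fun_sub (Lp.integrable01 _) (hσ.integrable_mul (Lp.integrable01 _))

/-- The weak form of a transport equation against `φ` in terms of the defect against `φ'`. -/
theorem weak_iff_defect {a t : ℝ} {σ : ℝ → ℝ} (hσ : BddMeas₁ σ) {z w : ℝ → StateL2}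
    (hz : IntervalIntegrable z volume 0 t) (hw : IntervalIntegrable w volume 0 t) {z₀ z₁ : ℝ → ℝ}
    (h0 : IntervalIntegrable z₀ volume 0 t) (h1 : IntervalIntegrable z₁ volume 0 t) {φ p : ℝ → ℝ}
    {c : ℝ} (hp : BddMeas₁ p) (hφ : ∀ x ∈ Icc (0 : ℝ) 1, φ x = prim c p x)
    (hφ' : ∀ x ∈ Icc (0 : ℝ) 1, deriv φ x = p x) :
    (∫ x in Icc (0 : ℝ) 1, z t x * φ x) - (∫ x in Icc (0 : ℝ) 1, z 0 x * φ x) =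
      (∫ s in (0 : ℝ)..t, ((∫ x in Icc (0 : ℝ) 1, (a * z s x * deriv φ x + σ x * w s x * φ x))
        + a * (z₀ s * φ 0 - z₁ s * φ 1))) ↔
    defect a (∫ s in (0 : ℝ)..t, z s : StateL2)
      (fun x => (z t - z 0 : StateL2) x - σ x * (∫ s in (0 : ℝ)..t, w s : StateL2) x)
      (∫ s in (0 : ℝ)..t, z₀ s) (∫ s in (0 : ℝ)..t, z₁ s) c p = 0 := by
  have hP := prim_bddMeas c hp
  rw [integral_weak_rhs hσ hz hw h0 h1 hp hφ hφ', defect]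
  have e : ∫ x, ((z t - z 0 : StateL2) x - σ x * (∫ s in (0 : ℝ)..t, w s : StateL2) x) *
      prim c p x ∂m01 = (∫ x in Icc (0 : ℝ) 1, z t x * φ x) - (∫ x in Icc (0 : ℝ) 1, z 0 x * φ x)
        - ∫ x, σ x * (∫ s in (0 : ℝ)..t, w s : StateL2) x * prim c p x ∂m01 := by
    have c1 : ∀ y : StateL2, ∫ x in Icc (0 : ℝ) 1, y x * φ x = ∫ x, y x * prim c p x ∂m01 :=
      fun y => integral_congr_ae (by
        filter_upwards [ae_restrict_mem measurableSet_Icc] with x hx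
        rw [hφ x hx])
    rw [c1, c1, ← integral_sub (integrable_mul_bdd (Lp.integrable01 _) hP)
      (integrable_mul_bdd (Lp.integrable01 _) hP), ← integral_sub
      (integrable_fun_sub (integrable_mul_bdd (Lp.integrable01 _) hP)
        (integrable_mul_bdd (Lp.integrable01 _) hP))
      (integrable_mul_bdd (hσ.integrable_mul (Lp.integrable01 _)) hP)]
    refine integral_congr_ae ?_
    filter_upwards [Lp.coeFn_sub (z t) (z 0)] with x hx
    rw [hx, Pi.sub_apply]
    ring
  rw [e]
  constructor <;> intro h <;> linarith

/-- The `C¹` test functions of the weak form contain the primitives of continuous functions that are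
needed in `IntegratedTransport.of_defect`. -/
theorem IntegratedTransport.of_weak {a t : ℝ} {σ : ℝ → ℝ} (hσ : BddMeas₁ σ) {z w : ℝ → StateL2}
    (hz : IntervalIntegrable z volume 0 t) (hw : IntervalIntegrable w volume 0 t) {z₀ z₁ : ℝ → ℝ}
    (h0 : IntervalIntegrable z₀ volume 0 t) (h1 : IntervalIntegrable z₁ volume 0 t)
    (h : ∀ φ : ℝ → ℝ, ContDiff ℝ 1 φ →
      (∫ x in Icc (0 : ℝ) 1, z t x * φ x) - (∫ x in Icc (0 : ℝ) 1, z 0 x * φ x) =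
      (∫ s in (0 : ℝ)..t, ((∫ x in Icc (0 : ℝ) 1, (a * z s x * deriv φ x + σ x * w s x * φ x))
        + a * (z₀ s * φ 0 - z₁ s * φ 1)))) :
    IntegratedTransport a (∫ s in (0 : ℝ)..t, z s : StateL2)
      (fun x => (z t - z 0 : StateL2) x - σ x * (∫ s in (0 : ℝ)..t, w s : StateL2) x)
      (∫ s in (0 : ℝ)..t, z₀ s) (∫ s in (0 : ℝ)..t, z₁ s) := by
  refine IntegratedTransport.of_defect (Lp.integrable01 _) (integrable_source hσ _ _)
    fun c p hpc hp => ?_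
  have hd : ∀ x, HasDerivAt (fun x => c - ∫ y in x..1, p y) (p x) x := fun x => by
    have := (intervalIntegral.integral_hasDerivAt_left (hpc.intervalIntegrable x 1)
      (hpc.stronglyMeasurableAtFilter _ _) hpc.continuousAt).const_sub c
    simpa using this
  refine (weak_iff_defect hσ hz hw h0 h1 hp (φ := fun x => c - ∫ y in x..1, p y)
    (fun x hx => (prim_eq c p hx).symm) (fun x _ => (hd x).deriv)).1 (h _ ?_)
  rw [contDiff_one_iff_deriv]
  exact ⟨fun x => (hd x).differentiableAt, by rwa [funext fun x => (hd x).deriv]⟩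

/-- Conversely, a `C¹` test function is on `[0,1]` the primitive of its derivative. -/
theorem IntegratedTransport.weak {a t : ℝ} {σ : ℝ → ℝ} (hσ : BddMeas₁ σ) {z w : ℝ → StateL2}
    (hz : IntervalIntegrable z volume 0 t) (hw : IntervalIntegrable w volume 0 t) {z₀ z₁ : ℝ → ℝ}
    (h0 : IntervalIntegrable z₀ volume 0 t) (h1 : IntervalIntegrable z₁ volume 0 t)
    (h : IntegratedTransport a (∫ s in (0 : ℝ)..t, z s : StateL2)
      (fun x => (z t - z 0 : StateL2) x - σ x * (∫ s in (0 : ℝ)..t, w s : StateL2) x)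
      (∫ s in (0 : ℝ)..t, z₀ s) (∫ s in (0 : ℝ)..t, z₁ s)) {φ : ℝ → ℝ} (hφ : ContDiff ℝ 1 φ) :
    (∫ x in Icc (0 : ℝ) 1, z t x * φ x) - (∫ x in Icc (0 : ℝ) 1, z 0 x * φ x) =
      (∫ s in (0 : ℝ)..t, ((∫ x in Icc (0 : ℝ) 1, (a * z s x * deriv φ x + σ x * w s x * φ x))
        + a * (z₀ s * φ 0 - z₁ s * φ 1))) := by
  rw [contDiff_one_iff_deriv] at hφ
  obtain ⟨C, hC⟩ := (isCompact_Icc (a := (0 : ℝ)) (b := 1)).exists_bound_of_continuousOn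
    hφ.2.continuousOn
  have hp : BddMeas₁ ((Icc (0 : ℝ) 1).indicator (deriv φ)) :=
    indicator_bddMeas hφ.2.measurable ⟨C, hC⟩
  refine (weak_iff_defect hσ hz hw h0 h1 hp (c := φ 1) (fun x hx => ?_)
    (fun x hx => (indicator_of_mem hx _).symm)).2
    (h.defect_eq_zero (Lp.integrable01 _) (integrable_source hσ _ _) _ hp)
  have e : ∫ y in x..1, (Icc (0 : ℝ) 1).indicator (deriv φ) y = φ 1 - φ x := by
    rw [← intervalIntegral.integral_deriv_eq_sub (fun y _ => hφ.1 y)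
      (hφ.2.intervalIntegrable x 1)]
    refine intervalIntegral.integral_congr fun y hy => ?_
    rw [uIcc_of_le hx.2] at hy
    have hy' : y ∈ Icc (0 : ℝ) 1 := ⟨hx.1.trans hy.1, hy.2⟩
    exact indicator_of_mem hy' _
  rw [prim_eq _ _ hx, e]
  ring

/-! ### The target system -/

section row
variable {κ κ' : ℝ → ℝ → ℝ} (hκ : BddMeas₂ κ) (hκ' : BddMeas₂ κ')

/-- The operator `(u, v) ↦ ∫ (κ u + κ' v)` on `L²(0,1)²`. -/
def rowL : StateL2 × StateL2 →L[ℝ] StateL2 := (opL κ hκ).coprod (opL κ' hκ')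

/-- The value at `1` of `rowL`. -/
def rowEnd : StateL2 × StateL2 →L[ℝ] ℝ := (pair (κ 1) (hκ.left 1)).coprod (pair (κ' 1) (hκ'.left 1))

theorem rowL_coe (u v : StateL2) :
    rowL hκ hκ' (u, v) =ᵐ[m01] fun x => intOp κ u x + intOp κ' v x := by
  rw [rowL, ContinuousLinearMap.coprod_apply]
  filter_upwards [Lp.coeFn_add (opL κ hκ u) (opL κ' hκ' v), opL_coe hκ u, opL_coe hκ' v]
    with x h1 h2 h3
  rw [h1, Pi.add_apply, h2, h3]

theorem rowEnd_eq (u v : StateL2) : rowEnd hκ hκ' (u, v) = intOp κ u 1 + intOp κ' v 1 := by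
  rw [rowEnd, ContinuousLinearMap.coprod_apply, pair_apply, pair_apply]; rfl

/-- Continuous linear maps commute with the integral over time. -/
theorem coprod_integral {F : Type*} [NormedAddCommGroup F] [NormedSpace ℝ F] [CompleteSpace F]
    (L : StateL2 × StateL2 →L[ℝ] F) {u v : ℝ → StateL2} {t : ℝ}
    (hu : IntervalIntegrable u volume 0 t) (hv : IntervalIntegrable v volume 0 t) :
    ∫ s in (0 : ℝ)..t, L (u s, v s) = L (∫ s in (0 : ℝ)..t, u s, ∫ s in (0 : ℝ)..t, v s) := by
  have e : ∀ p : StateL2 × StateL2, L p = (L ∘L ContinuousLinearMap.inl ℝ StateL2 StateL2) p.1 +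
      (L ∘L ContinuousLinearMap.inr ℝ StateL2 StateL2) p.2 := fun p => by
    simp only [ContinuousLinearMap.comp_apply, ContinuousLinearMap.inl_apply,
      ContinuousLinearMap.inr_apply]
    rw [← map_add]
    simp
  have i : ∀ (M : StateL2 →L[ℝ] F) {y : ℝ → StateL2}, IntervalIntegrable y volume 0 t →
      IntervalIntegrable (fun s => M (y s)) volume 0 t := fun M _ hy =>
    ⟨M.integrable_comp hy.1, M.integrable_comp hy.2⟩
  rw [e, intervalIntegral.integral_congr fun s _ => e (u s, v s),
    intervalIntegral.integral_add (i _ hu) (i _ hv),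
    ContinuousLinearMap.intervalIntegral_comp_comm _ hu,
    ContinuousLinearMap.intervalIntegral_comp_comm _ hv]

end row

/-- First component of the Volterra operator with kernels `k`, on `L²(0,1)²`. -/
def Kernels.Tri.opL₁ (h : k.Tri) : StateL2 × StateL2 →L[ℝ] StateL2 :=
  rowL h.uu.toBddMeas₂ h.uv.toBddMeas₂

/-- Second component of the Volterra operator with kernels `k`, on `L²(0,1)²`. -/
def Kernels.Tri.opL₂ (h : k.Tri) : StateL2 × StateL2 →L[ℝ] StateL2 :=
  rowL h.vu.toBddMeas₂ h.vv.toBddMeas₂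

/-- The value at `1` of the first component of the Volterra operator with kernels `k`. -/
def Kernels.Tri.end₁ (h : k.Tri) : StateL2 × StateL2 →L[ℝ] ℝ :=
  rowEnd h.uu.toBddMeas₂ h.uv.toBddMeas₂

/-- The value at `1` of the second component of the Volterra operator with kernels `k`. -/
def Kernels.Tri.end₂ (h : k.Tri) : StateL2 × StateL2 →L[ℝ] ℝ :=
  rowEnd h.vu.toBddMeas₂ h.vv.toBddMeas₂

theorem Kernels.Tri.opL₁_coe (h : k.Tri) (u v : StateL2) : h.opL₁ (u, v) =ᵐ[m01] k.op₁ u v :=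
  rowL_coe _ _ u v

theorem Kernels.Tri.opL₂_coe (h : k.Tri) (u v : StateL2) : h.opL₂ (u, v) =ᵐ[m01] k.op₂ u v :=
  rowL_coe _ _ u v

theorem Kernels.Tri.end₁_eq (h : k.Tri) (u v : StateL2) : h.end₁ (u, v) = k.op₁ u v 1 :=
  rowEnd_eq _ _ u v

theorem Kernels.Tri.end₂_eq (h : k.Tri) (u v : StateL2) : h.end₂ (u, v) = k.op₂ u v 1 :=
  rowEnd_eq _ _ u v

theorem continuousOn_clm_pair {F : Type*} [NormedAddCommGroup F] [NormedSpace ℝ F]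
    (L : StateL2 × StateL2 →L[ℝ] F) {u v : ℝ → StateL2} {s : Set ℝ} (hu : ContinuousOn u s)
    (hv : ContinuousOn v s) : ContinuousOn (fun t => L (u t, v t)) s :=
  L.continuous.comp_continuousOn (hu.prodMk hv)

theorem sub_coe {u w : StateL2} {f : ℝ → ℝ} (hw : w =ᵐ[m01] f) :
    (u - w : StateL2) =ᵐ[m01] fun x => u x - f x := by
  filter_upwards [Lp.coeFn_sub u w, hw] with x h1 h2
  rw [h1, Pi.sub_apply, h2]

/-- A pair of transport equations with the source terms of the original system corresponds to a
pair of transport equations without source for the transformed state. -/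
theorem IsRegularPair.target_iff (h : IsRegularPair S k) {u v : ℝ → StateL2}
    {u₀ u₁ v₀ v₁ : ℝ → ℝ} {t : ℝ} (ht : 0 ≤ t)
    (hu : ContinuousOn u (Icc 0 t)) (hv : ContinuousOn v (Icc 0 t))
    (h1 : IntervalIntegrable u₁ volume 0 t) (h2 : IntervalIntegrable v₁ volume 0 t)
    (hq : ∫ s in (0 : ℝ)..t, u₀ s = S.q * ∫ s in (0 : ℝ)..t, v₀ s) :
    (IntegratedTransport S.lam (∫ s in (0 : ℝ)..t, u s : StateL2)
        (fun x => (u t - u 0 : StateL2) x - S.sPM x * (∫ s in (0 : ℝ)..t, v s : StateL2) x)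
        (∫ s in (0 : ℝ)..t, u₀ s) (∫ s in (0 : ℝ)..t, u₁ s) ∧
      IntegratedTransport (-S.mu) (∫ s in (0 : ℝ)..t, v s : StateL2)
        (fun x => (v t - v 0 : StateL2) x - S.sMP x * (∫ s in (0 : ℝ)..t, u s : StateL2) x)
        (∫ s in (0 : ℝ)..t, v₀ s) (∫ s in (0 : ℝ)..t, v₁ s)) ↔
    (IntegratedTransport S.lam (∫ s in (0 : ℝ)..t, (u s - h.tri.opL₁ (u s, v s)) : StateL2)
        ((u t - h.tri.opL₁ (u t, v t)) - (u 0 - h.tri.opL₁ (u 0, v 0)) : StateL2)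
        (∫ s in (0 : ℝ)..t, u₀ s) (∫ s in (0 : ℝ)..t, (u₁ s - h.tri.end₁ (u s, v s))) ∧
      IntegratedTransport (-S.mu) (∫ s in (0 : ℝ)..t, (v s - h.tri.opL₂ (u s, v s)) : StateL2)
        ((v t - h.tri.opL₂ (u t, v t)) - (v 0 - h.tri.opL₂ (u 0, v 0)) : StateL2)
        (∫ s in (0 : ℝ)..t, v₀ s) (∫ s in (0 : ℝ)..t, (v₁ s - h.tri.end₂ (u s, v s)))) := by
  have cI : ∀ {F : Type} [NormedAddCommGroup F] {y : ℝ → F}, ContinuousOn y (Icc 0 t) →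
      IntervalIntegrable y volume 0 t := fun hy =>
    ContinuousOn.intervalIntegrable (by rwa [uIcc_of_le ht])
  have iu := cI hu
  have iv := cI hv
  have e : ∀ (L : StateL2 × StateL2 →L[ℝ] StateL2) (y : ℝ → StateL2),
      (y t - L (u t, v t)) - (y 0 - L (u 0, v 0)) = (y t - y 0) - L (u t - u 0, v t - v 0) := by
    intro L y
    have : ((u t - u 0, v t - v 0) : StateL2 × StateL2) = (u t, v t) - (u 0, v 0) := rfl
    rw [this, map_sub]
    abel
  rw [e, e, intervalIntegral.integral_sub iu (cI (continuousOn_clm_pair h.tri.opL₁ hu hv)),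
    intervalIntegral.integral_sub iv (cI (continuousOn_clm_pair h.tri.opL₂ hu hv)),
    intervalIntegral.integral_sub h1 (cI (continuousOn_clm_pair h.tri.end₁ hu hv)),
    intervalIntegral.integral_sub h2 (cI (continuousOn_clm_pair h.tri.end₂ hu hv)),
    coprod_integral _ iu iv, coprod_integral _ iu iv, coprod_integral _ iu iv,
    coprod_integral _ iu iv, h.tri.end₁_eq, h.tri.end₂_eq]
  constructor
  · rintro ⟨p1, p2⟩
    obtain ⟨q1, q2⟩ := h.transform (Lp.integrable01 _) (Lp.integrable01 _) (Lp.integrable01 _)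
      (Lp.integrable01 _) hq p1 p2
    exact ⟨q1.congr (sub_coe (h.tri.opL₁_coe _ _)).symm (sub_coe (h.tri.opL₁_coe _ _)).symm,
      q2.congr (sub_coe (h.tri.opL₂_coe _ _)).symm (sub_coe (h.tri.opL₂_coe _ _)).symm⟩
  · rintro ⟨p1, p2⟩
    exact h.transform_symm (Lp.integrable01 _) (Lp.integrable01 _) (Lp.integrable01 _)
      (Lp.integrable01 _) hq
      (p1.congr (sub_coe (h.tri.opL₁_coe _ _)) (sub_coe (h.tri.opL₁_coe _ _)))
      (p2.congr (sub_coe (h.tri.opL₂_coe _ _)) (sub_coe (h.tri.opL₂_coe _ _)))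

/-- `l` is the resolvent of `k`: the Volterra operators `𝒦` and `𝓛` with these kernels satisfy
`𝒦 = 𝓛 (1 - 𝒦)` and `𝓛 = 𝒦 (1 + 𝓛)` on `[0,1]`. -/
structure IsResolvent (k l : Kernels) : Prop where
  left₁ : ∀ u v : ℝ → ℝ, Integrable u m01 → Integrable v m01 → ∀ x ∈ Icc (0 : ℝ) 1,
    l.op₁ (fun y => u y - k.op₁ u v y) (fun y => v y - k.op₂ u v y) x = k.op₁ u v x
  left₂ : ∀ u v : ℝ → ℝ, Integrable u m01 → Integrable v m01 → ∀ x ∈ Icc (0 : ℝ) 1,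
    l.op₂ (fun y => u y - k.op₁ u v y) (fun y => v y - k.op₂ u v y) x = k.op₂ u v x
  right₁ : ∀ α β : ℝ → ℝ, Integrable α m01 → Integrable β m01 → ∀ x ∈ Icc (0 : ℝ) 1,
    k.op₁ (fun y => α y + l.op₁ α β y) (fun y => β y + l.op₂ α β y) x = l.op₁ α β x
  right₂ : ∀ α β : ℝ → ℝ, Integrable α m01 → Integrable β m01 → ∀ x ∈ Icc (0 : ℝ) 1,
    k.op₂ (fun y => α y + l.op₁ α β y) (fun y => β y + l.op₂ α β y) x = l.op₂ α β x

theorem Kernels.op₁_congr {f f' g g' : ℝ → ℝ} (hf : f =ᵐ[m01] f') (hg : g =ᵐ[m01] g') (x : ℝ) :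
    k.op₁ f g x = k.op₁ f' g' x := by
  rw [Kernels.op₁, Kernels.op₁, intOp_congr_ae _ hf, intOp_congr_ae _ hg]

theorem Kernels.op₂_congr {f f' g g' : ℝ → ℝ} (hf : f =ᵐ[m01] f') (hg : g =ᵐ[m01] g') (x : ℝ) :
    k.op₂ f g x = k.op₂ f' g' x := by
  rw [Kernels.op₂, Kernels.op₂, intOp_congr_ae _ hf, intOp_congr_ae _ hg]

theorem ae_m01_of_forall {p : ℝ → Prop} (h : ∀ x ∈ Icc (0 : ℝ) 1, p x) : ∀ᵐ x ∂m01, p x :=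
  (ae_restrict_mem measurableSet_Icc).mono h

/-- Any inverse kernel, extended by zero, is the resolvent. -/
theorem IsInverseKernel.isResolvent {l : Kernels} (hk : k.BddMeas) (h : IsInverseKernel k l) :
    IsResolvent k.cut l.cut := by
  have tk := hk.cut
  have tl := h.bddMeas.cut
  have L : ∀ u v : ℝ → ℝ, Integrable u m01 → Integrable v m01 → ∀ x ∈ Icc (0 : ℝ) 1,
      l.cut.op₁ (fun y => u y - k.cut.op₁ u v y) (fun y => v y - k.cut.op₂ u v y) x =
        k.cut.op₁ u v x ∧
      l.cut.op₂ (fun y => u y - k.cut.op₁ u v y) (fun y => v y - k.cut.op₂ u v y) x =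
        k.cut.op₂ u v x := by
    intro u v hu hv x hx
    have e1 : (fun y => u y - k.fst u v y) =ᵐ[m01] fun y => u y - k.cut.op₁ u v y :=
      ae_m01_of_forall fun y hy => by
        beta_reduce
        rw [Kernels.fst_eq hk hu hv hy]
    have e2 : (fun y => v y - k.snd u v y) =ᵐ[m01] fun y => v y - k.cut.op₂ u v y :=
      ae_m01_of_forall fun y hy => by
        beta_reduce
        rw [Kernels.snd_eq hk hu hv hy]
    have i1 := (integrable_fun_sub hu ((tk.op₁_bddMeas hu hv).integrable m01)).congr e1.symm
    have i2 := (integrable_fun_sub hv ((tk.op₂_bddMeas hu hv).integrable m01)).congr e2.symm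
    obtain ⟨a, b⟩ := h.left_inv u v hu hv x hx
    rw [Kernels.fst_eq h.bddMeas i1 i2 hx, Kernels.op₁_congr e1 e2, Kernels.fst_eq hk hu hv hx] at a
    rw [Kernels.snd_eq h.bddMeas i1 i2 hx, Kernels.op₂_congr e1 e2, Kernels.snd_eq hk hu hv hx] at b
    exact ⟨by linarith, by linarith⟩
  have R : ∀ α β : ℝ → ℝ, Integrable α m01 → Integrable β m01 → ∀ x ∈ Icc (0 : ℝ) 1,
      k.cut.op₁ (fun y => α y + l.cut.op₁ α β y) (fun y => β y + l.cut.op₂ α β y) x =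
        l.cut.op₁ α β x ∧
      k.cut.op₂ (fun y => α y + l.cut.op₁ α β y) (fun y => β y + l.cut.op₂ α β y) x =
        l.cut.op₂ α β x := by
    intro u v hu hv x hx
    have e1 : (fun y => u y + l.fst u v y) =ᵐ[m01] fun y => u y + l.cut.op₁ u v y :=
      ae_m01_of_forall fun y hy => by
        beta_reduce
        rw [Kernels.fst_eq h.bddMeas hu hv hy]
    have e2 : (fun y => v y + l.snd u v y) =ᵐ[m01] fun y => v y + l.cut.op₂ u v y :=
      ae_m01_of_forall fun y hy => by
        beta_reduce
        rw [Kernels.snd_eq h.bddMeas hu hv hy]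
    have i1 := (hu.fun_add ((tl.op₁_bddMeas hu hv).integrable m01)).congr e1.symm
    have i2 := (hv.fun_add ((tl.op₂_bddMeas hu hv).integrable m01)).congr e2.symm
    obtain ⟨a, b⟩ := h.right_inv u v hu hv x hx
    rw [Kernels.fst_eq hk i1 i2 hx, Kernels.op₁_congr e1 e2, Kernels.fst_eq h.bddMeas hu hv hx] at a
    rw [Kernels.snd_eq hk i1 i2 hx, Kernels.op₂_congr e1 e2, Kernels.snd_eq h.bddMeas hu hv hx] at b
    exact ⟨by linarith, by linarith⟩
  exact ⟨fun u v hu hv x hx => (L u v hu hv x hx).1, fun u v hu hv x hx => (L u v hu hv x hx).2,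
    fun u v hu hv x hx => (R u v hu hv x hx).1, fun u v hu hv x hx => (R u v hu hv x hx).2⟩

/-! ### The delay equation for the boundary value -/

theorem integrable_smul_shift {M : ℝ → ℝ} (hM : Integrable M) (f : LineL2) :
    Integrable fun ν => M ν • shift ν f := by
  refine (hM.norm.mul_const ‖f‖).mono'
    (hM.aestronglyMeasurable.smul (continuous_shift f).aestronglyMeasurable)
    (Filter.Eventually.of_forall fun ν => ?_)
  rw [norm_smul, LinearIsometry.norm_map]

/-- The convolution of an integrable and a square integrable function, as an average of
translates. -/
def conv (M : ℝ → ℝ) (f : LineL2) : LineL2 := ∫ ν, M ν • shift ν f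

theorem norm_conv_le {M : ℝ → ℝ} (f : LineL2) :
    ‖conv M f‖ ≤ (∫ ν, |M ν|) * ‖f‖ := by
  refine (norm_integral_le_integral_norm _).trans (le_of_eq ?_)
  rw [← integral_mul_const]
  refine integral_congr_ae (Filter.Eventually.of_forall fun ν => ?_)
  simp only [norm_smul, LinearIsometry.norm_map, Real.norm_eq_abs]

theorem conv_sub {M : ℝ → ℝ} (hM : Integrable M) (f g : LineL2) :
    conv M (f - g) = conv M f - conv M g := by
  rw [conv, conv, conv, ← integral_sub (integrable_smul_shift hM f) (integrable_smul_shift hM g)]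
  simp only [map_sub, smul_sub]

theorem conv_coe {M : ℝ → ℝ} (hM : Integrable M) (hMm : Measurable M) (f : LineL2) :
    conv M f =ᵐ[volume] fun t => ∫ ν, M ν * f (t - ν) := by
  refine integral_Lp_ae (f := fun ν t => M ν * f (t - ν)) (integrable_smul_shift hM f) ?_ ?_
  · exact (hMm.comp measurable_fst).mul
      ((Lp.stronglyMeasurable f).measurable.comp (measurable_snd.sub measurable_fst))
  · refine Filter.Eventually.of_forall fun ν => ?_
    filter_upwards [Lp.coeFn_smul (M ν) (shift ν f), shift_coe ν f] with t h1 h2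
    rw [h1, Pi.smul_apply, h2, smul_eq_mul]

variable {l : Kernels}

theorem HypSystem.tau_pos {S : HypSystem} (hlam : 0 < S.lam) (hmu : 0 < S.mu) : 0 < S.tau := by
  unfold HypSystem.tau; positivity

/-- `Ñ` is composed of the sections at `x = 1` of the inverse kernels by affine substitutions. -/
theorem Ntilde_bddMeas (S : HypSystem) (h : l.Tri) : BddMeas₁ (Ntilde S l) := by
  have comp : ∀ {f : ℝ → ℝ} (a b : ℝ), BddMeas₁ f → BddMeas₁ fun x => f (a * x + b) :=
    fun a b hf => ⟨hf.meas.comp (by fun_prop), hf.bdd.imp fun M hM x => hM _⟩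
  have hα : BddMeas₁ (Nalpha S l) := (h.vu.left 1).sub ((h.uu.left 1).const_mul S.rho)
  have hβ : BddMeas₁ (Nbeta S l) := (h.vv.left 1).sub ((h.uv.left 1).const_mul S.rho)
  have h1 := ((comp S.lam (-(S.lam / S.mu)) hα).const_mul (S.q * S.lam)).indicator
    (measurableSet_Icc (a := 1 / S.mu) (b := S.tau))
  have h2 := ((comp (-S.mu) 1 hβ).const_mul S.mu).indicator
    (measurableSet_Icc (a := (0 : ℝ)) (b := 1 / S.mu))
  have e : Ntilde S l = fun ν =>
      (Icc (1 / S.mu) S.tau).indicator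
        (fun x => S.q * S.lam * Nalpha S l (S.lam * x + -(S.lam / S.mu))) ν +
      (Icc 0 (1 / S.mu)).indicator (fun x => S.mu * Nbeta S l (-S.mu * x + 1)) ν := by
    funext ν
    unfold Ntilde
    simp only [sub_eq_add_neg, neg_mul, add_comm (1 : ℝ)]
  rw [e]
  exact h1.add h2

theorem Ntilde_supp (hlam : 0 < S.lam) (hmu : 0 < S.mu) {ν : ℝ} (h : ν ∉ Icc 0 S.tau) :
    Ntilde S l ν = 0 := by
  have h1 : 0 < 1 / S.mu := by positivity
  have h2 : 1 / S.mu ≤ S.tau := by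
    have : 0 < 1 / S.lam := by positivity
    unfold HypSystem.tau; linarith
  rw [Ntilde, indicator_of_notMem fun hh => h ⟨h1.le.trans hh.1, hh.2⟩,
    indicator_of_notMem fun hh => h ⟨hh.1, hh.2.trans h2⟩, add_zero]

theorem memLp_of_bdd_supp {f : ℝ → ℝ} (hf : BddMeas₁ f) {a b : ℝ}
    (hs : ∀ x, x ∉ Icc a b → f x = 0) (p : ENNReal) : MemLp f p volume := by
  have e : (Icc a b).indicator f = f := by
    funext x
    by_cases hx : x ∈ Icc a b
    · rw [indicator_of_mem hx]
    · rw [indicator_of_notMem hx, hs x hx]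
  rw [← e, memLp_indicator_iff_restrict measurableSet_Icc]
  have : IsFiniteMeasure (volume.restrict (Icc a b)) := ⟨by simp⟩
  exact hf.memLp p _

theorem Ntilde_memLp (hlam : 0 < S.lam) (hmu : 0 < S.mu) (h : l.Tri) (p : ENNReal) :
    MemLp (Ntilde S l) p volume :=
  memLp_of_bdd_supp (Ntilde_bddMeas S h) (fun _ hx => Ntilde_supp hlam hmu hx) p

/-- The profiles `α`, `β` of the target system at time `t`, encoded in the trace `b = β(·, 1)`:
the incoming wave `β` reaches `0` after the time `1 / μ`, and is there reflected into `α`. -/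
def alphaWave (S : HypSystem) (hlam : S.lam ≠ 0) (b : LineL2) (t : ℝ) : StateL2 :=
  S.q • wave S.lam hlam (-(1 / S.mu)) b t

/-- The second profile of the target system, see `alphaWave`. -/
def betaWave (S : HypSystem) (hmu : S.mu ≠ 0) (b : LineL2) (t : ℝ) : StateL2 :=
  wave (-S.mu) (neg_ne_zero.2 hmu) (-(1 / S.mu)) b t

theorem alphaWave_coe (hlam : S.lam ≠ 0) (b : LineL2) (t : ℝ) :
    alphaWave S hlam b t =ᵐ[m01] fun x => S.q * b (t - 1 / S.mu - x / S.lam) := by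
  filter_upwards [Lp.coeFn_smul S.q (wave S.lam hlam (-(1 / S.mu)) b t),
    wave_coe hlam (-(1 / S.mu)) b t] with x h1 h2
  rw [alphaWave, h1, Pi.smul_apply, h2, smul_eq_mul, ← sub_eq_add_neg]

theorem betaWave_coe (hmu : S.mu ≠ 0) (b : LineL2) (t : ℝ) :
    betaWave S hmu b t =ᵐ[m01] fun x => b (t - 1 / S.mu + x / S.mu) := by
  filter_upwards [wave_coe (neg_ne_zero.2 hmu) (-(1 / S.mu)) b t] with x h2
  rw [betaWave, h2]
  congr 1
  rw [div_neg, sub_neg_eq_add, ← sub_eq_add_neg]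

theorem integrable_Ntilde_mul (hlam : 0 < S.lam) (hmu : 0 < S.mu) (h : l.Tri) (b : LineL2)
    (t : ℝ) : Integrable fun ν => Ntilde S l ν * b (t - ν) :=
  (Ntilde_memLp hlam hmu h 2).integrable_mul
    ((Lp.memLp b).comp_measurePreserving (Measure.measurePreserving_sub_left volume t))

/-- The nonlocal boundary term of the target system is a distributed delay. -/
theorem op_waves_eq (hlam : 0 < S.lam) (hmu : 0 < S.mu) (h : l.Tri) (b : LineL2) (t : ℝ) :
    l.op₂ (alphaWave S hlam.ne' b t) (betaWave S hmu.ne' b t) 1 -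
      S.rho * l.op₁ (alphaWave S hlam.ne' b t) (betaWave S hmu.ne' b t) 1 =
    ∫ ν, Ntilde S l ν * b (t - ν) := by
  set α := alphaWave S hlam.ne' b t
  set β := betaWave S hmu.ne' b t
  have hα : BddMeas₁ (Nalpha S l) := (h.vu.left 1).sub ((h.uu.left 1).const_mul S.rho)
  have hβ : BddMeas₁ (Nbeta S l) := (h.vv.left 1).sub ((h.uv.left 1).const_mul S.rho)
  have ia := Lp.integrable01 α
  have ib := Lp.integrable01 β
  have e1 : l.op₂ α β 1 - S.rho * l.op₁ α β 1 =
      (∫ x, Nalpha S l x * α x ∂m01) + ∫ x, Nbeta S l x * β x ∂m01 := by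
    have c1 : ∫ x, Nalpha S l x * α x ∂m01 = intOp l.vu α 1 - S.rho * intOp l.uu α 1 := by
      rw [intOp, intOp, ← integral_const_mul, ← integral_sub ((h.vu.left 1).integrable_mul ia)
        (((h.uu.left 1).integrable_mul ia).const_mul _)]
      exact integral_congr_ae (Filter.Eventually.of_forall fun x => by
        simp only [Nalpha]; ring)
    have c2 : ∫ x, Nbeta S l x * β x ∂m01 = intOp l.vv β 1 - S.rho * intOp l.uv β 1 := by
      rw [intOp, intOp, ← integral_const_mul, ← integral_sub ((h.vv.left 1).integrable_mul ib)
        (((h.uv.left 1).integrable_mul ib).const_mul _)]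
      exact integral_congr_ae (Filter.Eventually.of_forall fun x => by
        simp only [Nbeta]; ring)
    rw [c1, c2, Kernels.op₁, Kernels.op₂]
    ring
  have ha : ∫ x, Nalpha S l x * α x ∂m01 = ∫ ν in (1 / S.mu)..S.tau,
      S.q * S.lam * Nalpha S l (S.lam * ν - S.lam / S.mu) * b (t - ν) := by
    have := intervalIntegral.integral_comp_div_add (a := 0) (b := 1)
      (fun ν => S.q * Nalpha S l (S.lam * ν - S.lam / S.mu) * b (t - ν)) hlam.ne' (1 / S.mu)
    have e : (1 / S.lam + 1 / S.mu) = S.tau := rfl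
    rw [zero_div, zero_add, e, smul_eq_mul, ← intervalIntegral.integral_const_mul,
      intervalIntegral.integral_of_le zero_le_one, ← integral_Icc_eq_integral_Ioc] at this
    rw [intervalIntegral.integral_congr (g := fun ν => S.lam *
      (S.q * Nalpha S l (S.lam * ν - S.lam / S.mu) * b (t - ν))) fun ν _ => by
        beta_reduce; ring, ← this]
    refine integral_congr_ae ?_
    filter_upwards [alphaWave_coe hlam.ne' b t] with x hx
    have c1 : S.lam * (x / S.lam + 1 / S.mu) - S.lam / S.mu = x := by field_simp; ring
    have c2 : t - (x / S.lam + 1 / S.mu) = t - 1 / S.mu - x / S.lam := by ring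
    rw [c1, c2, hx]
    ring
  have hb : ∫ x, Nbeta S l x * β x ∂m01 = ∫ ν in (0 : ℝ)..(1 / S.mu),
      S.mu * Nbeta S l (1 - S.mu * ν) * b (t - ν) := by
    have := intervalIntegral.integral_comp_sub_div (a := 0) (b := 1)
      (fun ν => Nbeta S l (1 - S.mu * ν) * b (t - ν)) hmu.ne' (1 / S.mu)
    rw [zero_div, sub_zero, sub_self, smul_eq_mul, ← intervalIntegral.integral_const_mul,
      intervalIntegral.integral_of_le zero_le_one, ← integral_Icc_eq_integral_Ioc] at this
    rw [intervalIntegral.integral_congr (g := fun ν => S.mu *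
      (Nbeta S l (1 - S.mu * ν) * b (t - ν))) fun ν _ => by
        beta_reduce; ring, ← this]
    refine integral_congr_ae ?_
    filter_upwards [betaWave_coe hmu.ne' b t] with x hx
    have c1 : 1 - S.mu * (1 / S.mu - x / S.mu) = x := by field_simp; ring
    have c2 : t - (1 / S.mu - x / S.mu) = t - 1 / S.mu + x / S.mu := by ring
    rw [c1, c2, hx]
  have hmu' : 0 < 1 / S.mu := by positivity
  have hτ : 1 / S.mu ≤ S.tau := by
    have : 0 < 1 / S.lam := by positivity
    unfold HypSystem.tau; linarith
  have hint := integrable_Ntilde_mul hlam hmu h b t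
  have hsplit : ∫ ν, Ntilde S l ν * b (t - ν) = (∫ ν in (0 : ℝ)..(1 / S.mu),
      Ntilde S l ν * b (t - ν)) + ∫ ν in (1 / S.mu)..S.tau, Ntilde S l ν * b (t - ν) := by
    rw [intervalIntegral.integral_add_adjacent_intervals hint.intervalIntegrable
      hint.intervalIntegrable, intervalIntegral.integral_of_le (hmu'.le.trans hτ),
      ← integral_Icc_eq_integral_Ioc]
    refine (setIntegral_eq_integral_of_forall_compl_eq_zero fun ν hν => ?_).symm
    rw [Ntilde_supp hlam hmu hν, zero_mul]
  rw [e1, ha, hb, hsplit, add_comm]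
  congr 1
  · refine intervalIntegral.integral_congr_ae ?_
    filter_upwards [Measure.ae_ne volume (1 / S.mu)] with ν hν hν'
    rw [uIoc_of_le hmu'.le] at hν'
    have h1 : ν ∉ Icc (1 / S.mu) S.tau := fun hh => hν (le_antisymm hν'.2 hh.1)
    rw [Ntilde, indicator_of_notMem h1,
      indicator_of_mem (show ν ∈ Icc 0 (1 / S.mu) from ⟨hν'.1.le, hν'.2⟩), zero_add]
  · refine intervalIntegral.integral_congr_ae (Filter.Eventually.of_forall fun ν hν' => ?_)
    rw [uIoc_of_le hτ] at hν'
    have h1 : ν ∉ Icc 0 (1 / S.mu) := fun hh => hν'.1.not_ge hh.2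
    rw [Ntilde, indicator_of_notMem h1,
      indicator_of_mem (show ν ∈ Icc (1 / S.mu) S.tau from ⟨hν'.1.le, hν'.2⟩), add_zero]

/-- The mismatch between the distributed delay and its copy delayed by `δ`. -/
def delayKer (S : HypSystem) (l : Kernels) (δ ν : ℝ) : ℝ := Ntilde S l ν - Ntilde S l (ν - δ)

theorem delayKer_bddMeas (S : HypSystem) (h : l.Tri) (δ : ℝ) : BddMeas₁ (delayKer S l δ) := by
  have := Ntilde_bddMeas S h
  exact this.sub ⟨this.meas.comp (measurable_sub_const δ), this.bdd.imp fun M hM x => hM _⟩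

theorem delayKer_supp (hlam : 0 < S.lam) (hmu : 0 < S.mu) {δ ν : ℝ} (hδ : 0 ≤ δ)
    (h : ν ∉ Icc 0 (S.tau + δ)) : delayKer S l δ ν = 0 := by
  rw [delayKer, Ntilde_supp hlam hmu fun hh => h ⟨hh.1, by linarith [hh.2]⟩,
    Ntilde_supp hlam hmu fun hh => h ⟨by linarith [hh.1], by linarith [hh.2]⟩, sub_zero]

theorem delayKer_exp_bddMeas (hlam : 0 < S.lam) (hmu : 0 < S.mu) (h : l.Tri) {δ ω : ℝ}
    (hδ : 0 ≤ δ) (hω : 0 ≤ ω) : BddMeas₁ fun ν => delayKer S l δ ν * Real.exp (ω * ν) := by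
  obtain ⟨M, hM0, hM⟩ := (delayKer_bddMeas S h δ).exists_pos
  refine ⟨(delayKer_bddMeas S h δ).meas.mul (by fun_prop), M * Real.exp (ω * (S.tau + δ)),
    fun ν => ?_⟩
  by_cases hν : ν ∈ Icc 0 (S.tau + δ)
  · rw [abs_mul, Real.abs_exp]
    exact mul_le_mul (hM ν) (Real.exp_le_exp.2 (mul_le_mul_of_nonneg_left hν.2 hω))
      (Real.exp_pos _).le hM0.le
  · rw [delayKer_supp hlam hmu hδ hν, zero_mul, abs_zero]
    positivity

theorem delayKer_exp_integrable (hlam : 0 < S.lam) (hmu : 0 < S.mu) (h : l.Tri) {δ ω : ℝ}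
    (hδ : 0 ≤ δ) (hω : 0 ≤ ω) : Integrable fun ν => delayKer S l δ ν * Real.exp (ω * ν) := by
  rw [← memLp_one_iff_integrable]
  refine memLp_of_bdd_supp (delayKer_exp_bddMeas hlam hmu h hδ hω) (a := 0) (b := S.tau + δ) ?_ 1
  intro ν hν
  rw [delayKer_supp hlam hmu hδ hν, zero_mul]

theorem delayKer_integrable (hlam : 0 < S.lam) (hmu : 0 < S.mu) (h : l.Tri) {δ : ℝ}
    (hδ : 0 ≤ δ) : Integrable (delayKer S l δ) := by
  simpa using delayKer_exp_integrable hlam hmu h hδ le_rfl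

/-- The operator of the delay equation for `b = β(·, 1)`, conjugated with `exp (ω t)`. -/
def delayOp (S : HypSystem) (l : Kernels) (K δ ω : ℝ) (f : LineL2) : LineL2 :=
  (S.q * S.rho * Real.exp (ω * S.tau)) • shift S.tau f
    - (K * S.q * Real.exp (ω * (S.tau + δ))) • shift (S.tau + δ) f
    - conv (fun ν => delayKer S l δ ν * Real.exp (ω * ν)) f

/-- The small-gain constant of the delay equation. -/
def loopGain (S : HypSystem) (l : Kernels) (K δ : ℝ) : ℝ :=
  |S.q * S.rho| + |K * S.q| + ∫ ν, |delayKer S l δ ν|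

theorem loopGain_nonneg (S : HypSystem) (l : Kernels) (K δ : ℝ) : 0 ≤ loopGain S l K δ := by
  have : 0 ≤ ∫ ν, |delayKer S l δ ν| := integral_nonneg fun _ => abs_nonneg _
  unfold loopGain; positivity

theorem delayOp_sub (hlam : 0 < S.lam) (hmu : 0 < S.mu) (h : l.Tri) {K δ ω : ℝ} (hδ : 0 ≤ δ)
    (hω : 0 ≤ ω) (f g : LineL2) :
    delayOp S l K δ ω (f - g) = delayOp S l K δ ω f - delayOp S l K δ ω g := by
  rw [delayOp, delayOp, delayOp, conv_sub (delayKer_exp_integrable hlam hmu h hδ hω), map_sub,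
    map_sub, smul_sub, smul_sub]
  abel

theorem norm_delayOp_le (hlam : 0 < S.lam) (hmu : 0 < S.mu) (h : l.Tri) {K δ ω : ℝ} (hδ : 0 ≤ δ)
    (hω : 0 ≤ ω) (f : LineL2) :
    ‖delayOp S l K δ ω f‖ ≤ loopGain S l K δ * Real.exp (ω * (S.tau + δ)) * ‖f‖ := by
  have hτ := HypSystem.tau_pos hlam hmu
  set E := Real.exp (ω * (S.tau + δ))
  have h1 : ‖(S.q * S.rho * Real.exp (ω * S.tau)) • shift S.tau f‖ ≤ |S.q * S.rho| * E * ‖f‖ := by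
    rw [norm_smul, LinearIsometry.norm_map, Real.norm_eq_abs, abs_mul _ (Real.exp _), Real.abs_exp]
    have : Real.exp (ω * S.tau) ≤ E :=
      Real.exp_le_exp.2 (mul_le_mul_of_nonneg_left (by linarith) hω)
    gcongr
  have h2 : ‖(K * S.q * Real.exp (ω * (S.tau + δ))) • shift (S.tau + δ) f‖ =
      |K * S.q| * E * ‖f‖ := by
    rw [norm_smul, LinearIsometry.norm_map, Real.norm_eq_abs, abs_mul _ (Real.exp _), Real.abs_exp]
  have h3 : ‖conv (fun ν => delayKer S l δ ν * Real.exp (ω * ν)) f‖ ≤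
      (∫ ν, |delayKer S l δ ν|) * E * ‖f‖ := by
    refine (norm_conv_le f).trans (mul_le_mul_of_nonneg_right ?_ (norm_nonneg _))
    rw [← integral_mul_const]
    refine integral_mono (delayKer_exp_integrable hlam hmu h hδ hω).abs
      ((delayKer_integrable hlam hmu h hδ).abs.mul_const _) fun ν => ?_
    beta_reduce
    by_cases hν : ν ∈ Icc 0 (S.tau + δ)
    · rw [abs_mul, Real.abs_exp]
      exact mul_le_mul_of_nonneg_left
        (Real.exp_le_exp.2 (mul_le_mul_of_nonneg_left hν.2 hω)) (abs_nonneg _)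
    · rw [delayKer_supp hlam hmu hδ hν, zero_mul, abs_zero, zero_mul]
  calc ‖delayOp S l K δ ω f‖ ≤ _ := norm_sub_le _ _
    _ ≤ _ := add_le_add (norm_sub_le _ _) le_rfl
    _ ≤ |S.q * S.rho| * E * ‖f‖ + |K * S.q| * E * ‖f‖ + (∫ ν, |delayKer S l δ ν|) * E * ‖f‖ :=
      add_le_add (add_le_add h1 h2.le) h3
    _ = _ := by rw [loopGain]; ring

theorem delayOp_coe (hlam : 0 < S.lam) (hmu : 0 < S.mu) (h : l.Tri) {K δ ω : ℝ} (hδ : 0 ≤ δ)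
    (hω : 0 ≤ ω) (f : LineL2) : delayOp S l K δ ω f =ᵐ[volume] fun t =>
      S.q * S.rho * Real.exp (ω * S.tau) * f (t - S.tau)
        - K * S.q * Real.exp (ω * (S.tau + δ)) * f (t - (S.tau + δ))
        - ∫ ν, delayKer S l δ ν * Real.exp (ω * ν) * f (t - ν) := by
  have hc := conv_coe (delayKer_exp_integrable hlam hmu h hδ hω)
    (delayKer_exp_bddMeas hlam hmu h hδ hω).meas f
  filter_upwards [hc, shift_coe S.tau f, shift_coe (S.tau + δ) f,
    Lp.coeFn_sub ((S.q * S.rho * Real.exp (ω * S.tau)) • shift S.tau f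
      - (K * S.q * Real.exp (ω * (S.tau + δ))) • shift (S.tau + δ) f)
      (conv (fun ν => delayKer S l δ ν * Real.exp (ω * ν)) f),
    Lp.coeFn_sub ((S.q * S.rho * Real.exp (ω * S.tau)) • shift S.tau f)
      ((K * S.q * Real.exp (ω * (S.tau + δ))) • shift (S.tau + δ) f),
    Lp.coeFn_smul (S.q * S.rho * Real.exp (ω * S.tau)) (shift S.tau f),
    Lp.coeFn_smul (K * S.q * Real.exp (ω * (S.tau + δ))) (shift (S.tau + δ) f)]
    with t h1 h2 h3 h4 h5 h6 h7
  rw [delayOp, h4, Pi.sub_apply, h5, Pi.sub_apply, h6, h7, Pi.smul_apply, Pi.smul_apply, h1, h2, h3,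
    smul_eq_mul, smul_eq_mul]

/-- The part of the delay equation that comes from the past actuation and from the initial state:
before the time `δ`, the delayed feedback is replaced by the history. -/
def forcing (S : HypSystem) (l : Kernels) (δ : ℝ) (hst : HistoryL2 δ) (b₀ : LineL2) : LineL2 :=
  cutL (Ico 0 δ) measurableSet_Ico
    (shift δ (extend (Icc (-δ) 0) measurableSet_Icc hst - conv (Ntilde S l) b₀))

theorem norm_forcing_le (S : HypSystem) (l : Kernels) (δ : ℝ) (hst : HistoryL2 δ) (b₀ : LineL2) :
    ‖forcing S l δ hst b₀‖ ≤ ‖hst‖ + (∫ ν, |Ntilde S l ν|) * ‖b₀‖ := by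
  refine (norm_cutL_le _ _).trans ?_
  rw [LinearIsometry.norm_map]
  exact (norm_sub_le _ _).trans (add_le_add (norm_extend_le _ _) (norm_conv_le _))

theorem ae_comp_const_sub (c : ℝ) {p : ℝ → Prop} (h : ∀ᵐ x, p x) : ∀ᵐ x, p (c - x) :=
  (Measure.measurePreserving_sub_left volume c).quasiMeasurePreserving.ae h

/-- `b` continues the initial datum `b₀`, which lives on `[-τ, 0]`. -/
structure Continues (S : HypSystem) (b b₀ : LineL2) : Prop where
  eq : ∀ᵐ y, y < 0 → b y = b₀ y
  supp : ∀ᵐ y, y ∉ Icc (-S.tau) 0 → b₀ y = 0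

/-- The right-hand side of the delay equation is the boundary condition of the target system at
`x = 1`. Before the time `δ` the delayed terms of `delayOp` see only the initial datum, and the
forcing replaces their contribution by the past actuation. -/
theorem delay_rhs (hlam : 0 < S.lam) (hmu : 0 < S.mu) (h : l.Tri) (K : ℝ) {δ : ℝ} (hδ : 0 ≤ δ)
    (hst : HistoryL2 δ) {b b₀ : LineL2} (hb : Continues S b b₀) :
    ∀ᵐ t, 0 ≤ t → delayOp S l K δ 0 b t + forcing S l δ hst b₀ t =
      S.q * S.rho * b (t - S.tau) - (∫ ν, Ntilde S l ν * b (t - ν)) +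
        if t < δ then hst (t - δ) else
          -K * (S.q * b (t - δ - S.tau)) + ∫ ν, Ntilde S l ν * b (t - δ - ν) := by
  have hτ := HypSystem.tau_pos hlam hmu
  have hN : Integrable (Ntilde S l) := memLp_one_iff_integrable.1 (Ntilde_memLp hlam hmu h 1)
  have hNm := (Ntilde_bddMeas S h).meas
  have hcut : forcing S l δ hst b₀ =ᵐ[volume] (Ico 0 δ).indicator fun t =>
      hst (t - δ) - ∫ ν, Ntilde S l ν * b₀ (t - δ - ν) := by
    refine (cutL_coe measurableSet_Ico _).trans ?_
    filter_upwards [shift_coe δ (extend (Icc (-δ) 0) measurableSet_Icc hst - conv (Ntilde S l) b₀),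
      ae_comp_sub δ (Lp.coeFn_sub (extend (Icc (-δ) 0) measurableSet_Icc hst)
        (conv (Ntilde S l) b₀)), ae_comp_sub δ (extend_coe measurableSet_Icc hst),
      ae_comp_sub δ (conv_coe hN hNm b₀)] with t h1 h2 h3 h4
    by_cases ht : t ∈ Ico 0 δ
    · rw [indicator_of_mem ht, indicator_of_mem ht, h1, h2, Pi.sub_apply, h3, h4,
        indicator_of_mem (show t - δ ∈ Icc (-δ) 0 from ⟨by linarith [ht.1], by linarith [ht.2]⟩)]
    · rw [indicator_of_notMem ht, indicator_of_notMem ht]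
  filter_upwards [hcut, delayOp_coe hlam hmu h (K := K) hδ le_rfl b,
    ae_comp_sub (S.tau + δ) hb.eq, ae_comp_sub (S.tau + δ) hb.supp] with t h1 h2 h3 h4 ht
  have hker : ∫ ν, delayKer S l δ ν * Real.exp (0 * ν) * b (t - ν) =
      (∫ ν, Ntilde S l ν * b (t - ν)) - ∫ ν, Ntilde S l ν * b (t - δ - ν) := by
    have i1 := integrable_Ntilde_mul hlam hmu h b t
    have i2 := (integrable_Ntilde_mul hlam hmu h b (t - δ)).comp_sub_right δ
    rw [← integral_sub_right_eq_self (fun ν => Ntilde S l ν * b (t - δ - ν)) δ,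
      ← integral_sub i1 i2]
    refine integral_congr_ae (Filter.Eventually.of_forall fun ν => ?_)
    simp only [zero_mul, Real.exp_zero, mul_one, delayKer]
    rw [show t - δ - (ν - δ) = t - ν by ring]
    ring
  rw [h1, h2, hker]
  simp only [zero_mul, Real.exp_zero, mul_one]
  by_cases htδ : t < δ
  · rw [indicator_of_mem (show t ∈ Ico 0 δ from ⟨ht, htδ⟩), if_pos htδ]
    -- the time `t - τ - δ` lies before the support of the initial datum
    have hz : b (t - (S.tau + δ)) = 0 := by
      rw [h3 (by linarith), h4 fun hh => by linarith [hh.1]]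
    have hc : ∫ ν, Ntilde S l ν * b (t - δ - ν) = ∫ ν, Ntilde S l ν * b₀ (t - δ - ν) := by
      refine integral_congr_ae ?_
      filter_upwards [ae_comp_const_sub (t - δ) hb.eq] with ν hν
      by_cases hν0 : ν ∈ Icc 0 S.tau
      · rw [hν (by linarith [hν0.1])]
      · rw [Ntilde_supp hlam hmu hν0, zero_mul, zero_mul]
    rw [hz, hc]
    ring
  · rw [indicator_of_notMem (fun hh => htδ hh.2), if_neg htδ,
      show t - δ - S.tau = t - (S.tau + δ) by ring]
    ring

/-- The small-gain condition makes the delay equation uniquely solvable. -/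
theorem exists_delay_solution (hlam : 0 < S.lam) (hmu : 0 < S.mu) (h : l.Tri) {K δ : ℝ}
    (hδ : 0 ≤ δ) (hgain : loopGain S l K δ < 1) (b₀ g : LineL2) :
    ∃ b : LineL2, (∀ᵐ y, y < 0 → b y = b₀ y) ∧
      ∀ᵐ t, 0 ≤ t → b t = delayOp S l K δ 0 b t + g t := by
  -- the values on the negative half line are prescribed, those on the positive one given by the
  -- equation
  set Φ : LineL2 → LineL2 := fun b => cutL (Iio 0) measurableSet_Iio b₀ +
    cutL (Ici 0) measurableSet_Ici (delayOp S l K δ 0 b + g) with hΦ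
  have hc : ContractingWith ⟨loopGain S l K δ, loopGain_nonneg S l K δ⟩ Φ := by
    refine ⟨hgain, LipschitzWith.of_dist_le_mul fun f f' => ?_⟩
    have e : Φ f - Φ f' = cutL (Ici 0) measurableSet_Ici (delayOp S l K δ 0 (f - f')) := by
      rw [delayOp_sub hlam hmu h hδ le_rfl]
      simp only [hΦ, map_add, map_sub]
      abel
    rw [dist_eq_norm, dist_eq_norm, e]
    refine (norm_cutL_le _ _).trans ((norm_delayOp_le hlam hmu h hδ le_rfl _).trans (le_of_eq ?_))
    rw [zero_mul, Real.exp_zero, mul_one]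
    rfl
  obtain ⟨b, hb⟩ : ∃ b, Φ b = b := ⟨_, hc.fixedPoint_isFixedPt⟩
  have hcoe : ∀ᵐ y, b y = (Iio (0 : ℝ)).indicator b₀ y +
      (Ici (0 : ℝ)).indicator (delayOp S l K δ 0 b + g : LineL2) y := by
    have := Lp.coeFn_add (cutL (Iio 0) measurableSet_Iio b₀)
      (cutL (Ici 0) measurableSet_Ici (delayOp S l K δ 0 b + g))
    rw [show cutL (Iio 0) measurableSet_Iio b₀ +
      cutL (Ici 0) measurableSet_Ici (delayOp S l K δ 0 b + g) = b from hb] at this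
    filter_upwards [this, cutL_coe measurableSet_Iio b₀,
      cutL_coe measurableSet_Ici (delayOp S l K δ 0 b + g)] with y h1 h2 h3
    rw [h1, Pi.add_apply, h2, h3]
  refine ⟨b, ?_, ?_⟩
  · filter_upwards [hcoe] with y hy hy0
    rw [hy, indicator_of_mem (show y ∈ Iio (0 : ℝ) from hy0),
      indicator_of_notMem (show y ∉ Ici (0 : ℝ) from not_le.2 hy0), add_zero]
  · filter_upwards [hcoe, Lp.coeFn_add (delayOp S l K δ 0 b) g] with y hy h1 hy0
    rw [hy, indicator_of_notMem (show y ∉ Iio (0 : ℝ) from not_lt.2 hy0),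
      indicator_of_mem (show y ∈ Ici (0 : ℝ) from hy0), zero_add, h1, Pi.add_apply]

/-- The small-gain condition, in a space with weight `exp (ω t)`, bounds the solutions of the delay
equation on `[0, T]` independently of `T`. -/
theorem delay_solution_bound (hlam : 0 < S.lam) (hmu : 0 < S.mu) (h : l.Tri) {K δ ω T : ℝ}
    (hδ : 0 ≤ δ) (hω : 0 ≤ ω) {b b₀ g : LineL2} (hb : Continues S b b₀)
    (hT : ∀ᵐ y, T < y → b y = 0)
    (heq : ∀ᵐ t, 0 ≤ t → t ≤ T → b t = delayOp S l K δ 0 b t + g t)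
    (hg : ∀ᵐ t, t ∉ Ico 0 δ → g t = 0) :
    ∃ B : LineL2, (∀ᵐ y, B y = Real.exp (ω * y) * b y) ∧
      (1 - loopGain S l K δ * Real.exp (ω * (S.tau + δ))) * ‖B‖ ≤
        ‖b₀‖ + Real.exp (ω * δ) * ‖g‖ := by
  have hm : MemLp (fun y => Real.exp (ω * y) * b y) 2 volume := by
    refine (Lp.memLp b).of_le_mul (c := Real.exp (ω * T))
      ((Measurable.aestronglyMeasurable (by fun_prop)).mul (Lp.aestronglyMeasurable b)) ?_
    filter_upwards [hT] with y hy
    rw [norm_mul, Real.norm_eq_abs, Real.abs_exp]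
    rcases le_or_gt y T with hyT | hyT
    · exact mul_le_mul_of_nonneg_right
        (Real.exp_le_exp.2 (mul_le_mul_of_nonneg_left hyT hω)) (norm_nonneg _)
    · rw [hy hyT, norm_zero, mul_zero, mul_zero]
  set B : LineL2 := hm.toLp _
  have hB : ∀ᵐ y, B y = Real.exp (ω * y) * b y := hm.coeFn_toLp
  refine ⟨B, hB, ?_⟩
  -- `B` solves the conjugated equation
  have hconj : ∀ᵐ t, delayOp S l K δ ω B t = Real.exp (ω * t) * delayOp S l K δ 0 b t := by
    filter_upwards [delayOp_coe hlam hmu h (K := K) hδ hω B,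
      delayOp_coe hlam hmu h (K := K) hδ le_rfl b, ae_comp_sub S.tau hB,
      ae_comp_sub (S.tau + δ) hB] with t h1 h2 h3 h4
    have e : ∀ c y : ℝ, Real.exp (ω * c) * (Real.exp (ω * (t - c)) * y) = Real.exp (ω * t) * y :=
      fun c y => by rw [← mul_assoc, ← Real.exp_add]; ring_nf
    have h5 : ∫ ν, delayKer S l δ ν * Real.exp (ω * ν) * B (t - ν) =
        Real.exp (ω * t) * ∫ ν, delayKer S l δ ν * Real.exp (0 * ν) * b (t - ν) := by
      rw [← integral_const_mul]
      refine integral_congr_ae ?_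
      filter_upwards [ae_comp_const_sub t hB] with ν hν
      rw [hν, mul_assoc, e]
      simp only [zero_mul, Real.exp_zero]
      ring
    rw [h1, h2, h3, h4, h5, mul_assoc _ (Real.exp _), e, mul_assoc _ (Real.exp _), e]
    simp only [zero_mul, Real.exp_zero]
    ring
  -- `|B|` is at most `|b₀|` for negative times, where the weight is at most `1`, and the forcing
  -- only
  -- acts before `δ`, where the weight is at most `exp (ω δ)`
  have hle : ∀ᵐ t, ‖B t‖ ≤
      ‖(|b₀| + |delayOp S l K δ ω B| + Real.exp (ω * δ) • |g| : LineL2) t‖ := by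
    filter_upwards [hB, hconj, hb.eq, heq, hg, hT, Lp.coeFn_abs b₀,
      Lp.coeFn_abs (delayOp S l K δ ω B), Lp.coeFn_abs g,
      Lp.coeFn_add (|b₀| + |delayOp S l K δ ω B|) (Real.exp (ω * δ) • |g|),
      Lp.coeFn_add |b₀| |delayOp S l K δ ω B|, Lp.coeFn_smul (Real.exp (ω * δ)) |g|]
      with t h1 h2 h3 h4 h5 h6 a1 a2 a3 a4 a5 a6
    rw [a4, Pi.add_apply, a5, Pi.add_apply, a6, Pi.smul_apply, a1, a2, a3, smul_eq_mul, h2, h1]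
    have hE := (Real.exp_pos (ω * δ)).le
    refine le_trans ?_ (le_abs_self _)
    rw [Real.norm_eq_abs]
    rcases lt_or_ge t 0 with ht | ht
    · rw [h3 ht, abs_mul, Real.abs_exp]
      have : Real.exp (ω * t) * |b₀ t| ≤ |b₀ t| := mul_le_of_le_one_left (abs_nonneg _)
        (Real.exp_le_one_iff.2 (mul_nonpos_of_nonneg_of_nonpos hω ht.le))
      have := abs_nonneg (Real.exp (ω * t) * delayOp S l K δ 0 b t)
      have := mul_nonneg hE (abs_nonneg (g t))
      linarith
    · rcases le_or_gt t T with htT | htT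
      · rw [h4 ht htT, mul_add]
        have h7 : |Real.exp (ω * t) * g t| ≤ Real.exp (ω * δ) * |g t| := by
          rw [abs_mul, Real.abs_exp]
          by_cases htδ : t ∈ Ico 0 δ
          · exact mul_le_mul_of_nonneg_right
              (Real.exp_le_exp.2 (mul_le_mul_of_nonneg_left htδ.2.le hω)) (abs_nonneg _)
          · rw [h5 htδ, abs_zero, mul_zero, mul_zero]
        have := abs_add_le (Real.exp (ω * t) * delayOp S l K δ 0 b t) (Real.exp (ω * t) * g t)
        have := abs_nonneg (b₀ t)
        linarith
      · rw [h6 htT, mul_zero, abs_zero]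
        positivity
  have hn := Lp.norm_le_norm_of_ae_le hle
  have h1 := norm_delayOp_le hlam hmu h (K := K) hδ hω B
  have h2 : ‖(|b₀| + |delayOp S l K δ ω B| + Real.exp (ω * δ) • |g| : LineL2)‖ ≤
      ‖b₀‖ + ‖delayOp S l K δ ω B‖ + Real.exp (ω * δ) * ‖g‖ := by
    refine (norm_add_le _ _).trans (add_le_add ((norm_add_le _ _).trans ?_) ?_)
    · rw [norm_abs_eq_norm, norm_abs_eq_norm]
    · rw [norm_smul, norm_abs_eq_norm, Real.norm_eq_abs, Real.abs_exp]
  linarith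

/-! ### Solutions of the target system are waves -/

theorem ae_comp_wave {a : ℝ} (ha : a ≠ 0) (c : ℝ) {p : ℝ → Prop} (h : ∀ᵐ y, p y) :
    ∀ᵐ x ∂m01, p (c + x / a) := by
  refine ae_restrict_of_ae ?_
  filter_upwards [ae_comp_mul (inv_ne_zero ha) (ae_comp_add c h)] with x hx
  rwa [div_eq_inv_mul, add_comm]

theorem alphaWave_eq_of_ae (hlam : S.lam ≠ 0) {t : ℝ} {b : LineL2} {f : StateL2}
    (h : ∀ᵐ x ∂m01, S.q * b (t - 1 / S.mu - x / S.lam) = f x) : alphaWave S hlam b t = f := by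
  refine Lp.ext ?_
  filter_upwards [h, alphaWave_coe hlam b t] with x h1 h2
  rw [h2, h1]

theorem betaWave_eq_of_ae (hmu : S.mu ≠ 0) {t : ℝ} {b : LineL2} {f : StateL2}
    (h : ∀ᵐ x ∂m01, b (t - 1 / S.mu + x / S.mu) = f x) : betaWave S hmu b t = f := by
  refine Lp.ext ?_
  filter_upwards [h, betaWave_coe hmu b t] with x h1 h2
  rw [h2, h1]

theorem ae_pos_lt_one : ∀ᵐ x ∂m01, 0 < x ∧ x < 1 := by
  filter_upwards [ae_restrict_mem measurableSet_Icc, ae_restrict_of_ae (Measure.ae_ne volume 0),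
    ae_restrict_of_ae (Measure.ae_ne volume 1)] with x hx h0 h1
  exact ⟨lt_of_le_of_ne hx.1 (Ne.symm h0), lt_of_le_of_ne hx.2 h1⟩

theorem ae_alpha_arg (hlam : S.lam ≠ 0) (t : ℝ) {p : ℝ → Prop} (h : ∀ᵐ y, p y) :
    ∀ᵐ x ∂m01, p (t - 1 / S.mu - x / S.lam) := by
  have := ae_comp_wave (neg_ne_zero.2 hlam) (t - 1 / S.mu) h
  simpa only [div_neg, ← sub_eq_add_neg] using this

theorem ae_beta_arg (hmu : S.mu ≠ 0) (t : ℝ) {p : ℝ → Prop} (h : ∀ᵐ y, p y) :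
    ∀ᵐ x ∂m01, p (t - 1 / S.mu + x / S.mu) := ae_comp_wave hmu (t - 1 / S.mu) h

/-- The initial datum of the delay equation that corresponds to the initial state `(α₀, β₀)`. -/
def initialTrace (S : HypSystem) (hlam : S.lam ≠ 0) (hmu : S.mu ≠ 0) (α₀ β₀ : StateL2) : LineL2 :=
  dilate S.mu hmu (shift (-1) (extend (Icc 0 1) measurableSet_Icc β₀)) +
    S.q⁻¹ • dilate (-S.lam) (neg_ne_zero.2 hlam)
      (shift (S.lam / S.mu) (extend (Icc 0 1) measurableSet_Icc α₀))

theorem initialTrace_coe (hlam : S.lam ≠ 0) (hmu : S.mu ≠ 0) (α₀ β₀ : StateL2) :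
    initialTrace S hlam hmu α₀ β₀ =ᵐ[volume] fun y => (Icc (0 : ℝ) 1).indicator β₀ (S.mu * y + 1) +
      S.q⁻¹ * (Icc (0 : ℝ) 1).indicator α₀ (-S.lam * y - S.lam / S.mu) := by
  set f := extend (Icc 0 1) measurableSet_Icc β₀
  set g := extend (Icc 0 1) measurableSet_Icc α₀
  filter_upwards [dilate_coe S.mu hmu (shift (-1) f), ae_comp_mul hmu (shift_coe (-1) f),
    ae_comp_mul hmu (ae_comp_sub (-1) (extend_coe measurableSet_Icc β₀)),
    dilate_coe (-S.lam) (neg_ne_zero.2 hlam) (shift (S.lam / S.mu) g),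
    ae_comp_mul (neg_ne_zero.2 hlam) (shift_coe (S.lam / S.mu) g),
    ae_comp_mul (neg_ne_zero.2 hlam)
      (ae_comp_sub (S.lam / S.mu) (extend_coe measurableSet_Icc α₀)),
    Lp.coeFn_add (dilate S.mu hmu (shift (-1) f))
      (S.q⁻¹ • dilate (-S.lam) (neg_ne_zero.2 hlam) (shift (S.lam / S.mu) g)),
    Lp.coeFn_smul S.q⁻¹ (dilate (-S.lam) (neg_ne_zero.2 hlam) (shift (S.lam / S.mu) g))]
    with y h1 h2 h3 h4 h5 h6 h7 h8
  rw [initialTrace, h7, Pi.add_apply, h8, Pi.smul_apply, h1, h2, h3, h4, h5, h6, smul_eq_mul,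
    sub_neg_eq_add]

theorem initialTrace_supp (hlam : 0 < S.lam) (hmu : 0 < S.mu) (α₀ β₀ : StateL2) :
    ∀ᵐ y, y ∉ Icc (-S.tau) 0 → initialTrace S hlam.ne' hmu.ne' α₀ β₀ y = 0 := by
  have e1 : S.mu * (1 / S.mu) = 1 := by field_simp
  have e2 : S.lam * (1 / S.lam) = 1 := by field_simp
  have e3 : S.lam * (1 / S.mu) = S.lam / S.mu := by ring
  have p1 : 0 < 1 / S.lam := by positivity
  have p2 : 0 < 1 / S.mu := by positivity
  filter_upwards [initialTrace_coe hlam.ne' hmu.ne' α₀ β₀] with y hy hy'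
  have hn : y < -S.tau ∨ 0 < y := by
    by_contra hh
    push Not at hh
    exact hy' ⟨hh.1, hh.2⟩
  unfold HypSystem.tau at hn
  rw [hy, indicator_of_notMem, indicator_of_notMem, mul_zero, add_zero]
  · rintro ⟨h1, h2⟩
    rcases hn with hn | hn
    · have := mul_lt_mul_of_pos_left hn hlam
      rw [mul_neg, mul_add] at this
      linarith
    · have := mul_pos hlam hn
      have : 0 < S.lam / S.mu := by positivity
      linarith
  · rintro ⟨h1, h2⟩
    rcases hn with hn | hn
    · have := mul_lt_mul_of_pos_left hn hmu
      rw [mul_neg, mul_add] at this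
      have := mul_pos hmu p1
      linarith
    · have := mul_pos hmu hn
      linarith

/-- At time `0` the waves of any continuation of the initial trace are the initial state. -/
theorem waves_initial (hlam : 0 < S.lam) (hmu : 0 < S.mu) (hq : S.q ≠ 0) {α₀ β₀ : StateL2}
    {b : LineL2} (hb : ∀ᵐ y, y < 0 → b y = initialTrace S hlam.ne' hmu.ne' α₀ β₀ y) :
    alphaWave S hlam.ne' b 0 = α₀ ∧ betaWave S hmu.ne' b 0 = β₀ := by
  have p2 : 0 < 1 / S.mu := by positivity
  constructor
  · refine alphaWave_eq_of_ae _ ?_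
    filter_upwards [ae_alpha_arg hlam.ne' 0 hb,
      ae_alpha_arg hlam.ne' 0 (initialTrace_coe hlam.ne' hmu.ne' α₀ β₀), ae_pos_lt_one]
      with x h1 h2 h3
    have p3 : 0 < x / S.lam := div_pos h3.1 hlam
    have e1 : S.mu * (0 - 1 / S.mu - x / S.lam) + 1 = -(S.mu * (x / S.lam)) := by
      field_simp; ring
    have e2 : -S.lam * (0 - 1 / S.mu - x / S.lam) - S.lam / S.mu = x := by field_simp; ring
    rw [h1 (by linarith), h2, e1, e2, indicator_of_notMem,
      indicator_of_mem (show x ∈ Icc (0 : ℝ) 1 from ⟨h3.1.le, h3.2.le⟩), zero_add,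
      mul_inv_cancel_left₀ hq]
    intro hh
    have := mul_pos hmu p3
    linarith [hh.1]
  · refine betaWave_eq_of_ae _ ?_
    filter_upwards [ae_beta_arg hmu.ne' 0 hb,
      ae_beta_arg hmu.ne' 0 (initialTrace_coe hlam.ne' hmu.ne' α₀ β₀), ae_pos_lt_one]
      with x h1 h2 h3
    have p3 : 0 < x / S.mu := div_pos h3.1 hmu
    have p4 : x / S.mu < 1 / S.mu := div_lt_div_of_pos_right h3.2 hmu
    have e1 : S.mu * (0 - 1 / S.mu + x / S.mu) + 1 = x := by field_simp; ring
    have e2 : -S.lam * (0 - 1 / S.mu + x / S.mu) - S.lam / S.mu = -(S.lam * (x / S.mu)) := by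
      field_simp; ring
    rw [h1 (by linarith), h2, e1, e2,
      indicator_of_mem (show x ∈ Icc (0 : ℝ) 1 from ⟨h3.1.le, h3.2.le⟩), indicator_of_notMem,
      mul_zero, add_zero]
    intro hh
    have := mul_pos hlam p3
    linarith [hh.1]

theorem exists_norm_initialTrace_le (hlam : S.lam ≠ 0) (hmu : S.mu ≠ 0) : ∃ C, 0 ≤ C ∧
    ∀ α₀ β₀, ‖initialTrace S hlam hmu α₀ β₀‖ ≤ C * (‖α₀‖ + ‖β₀‖) := by
  set D₁ := dilate S.mu hmu
  set D₂ := dilate (-S.lam) (neg_ne_zero.2 hlam)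
  refine ⟨‖D₁‖ + |S.q⁻¹| * ‖D₂‖, by positivity, fun α₀ β₀ => ?_⟩
  have h1 : ‖D₁ (shift (-1) (extend (Icc 0 1) measurableSet_Icc β₀))‖ ≤ ‖D₁‖ * ‖β₀‖ := by
    refine (D₁.le_opNorm _).trans (mul_le_mul_of_nonneg_left ?_ (norm_nonneg _))
    rw [LinearIsometry.norm_map]
    exact norm_extend_le _ _
  have h2 : ‖S.q⁻¹ • D₂ (shift (S.lam / S.mu) (extend (Icc 0 1) measurableSet_Icc α₀))‖ ≤
      |S.q⁻¹| * (‖D₂‖ * ‖α₀‖) := by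
    rw [norm_smul, Real.norm_eq_abs]
    refine mul_le_mul_of_nonneg_left ((D₂.le_opNorm _).trans
      (mul_le_mul_of_nonneg_left ?_ (norm_nonneg _))) (abs_nonneg _)
    rw [LinearIsometry.norm_map]
    exact norm_extend_le _ _
  refine (norm_add_le _ _).trans ((add_le_add h1 h2).trans ?_)
  have := mul_nonneg (norm_nonneg D₁) (norm_nonneg α₀)
  have := mul_nonneg (mul_nonneg (abs_nonneg S.q⁻¹) (norm_nonneg D₂)) (norm_nonneg β₀)
  linarith

/-- The bound is uniform in the time `t`, as translations are isometries. -/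
theorem exists_norm_wave_le {a : ℝ} (ha : a ≠ 0) : ∃ C, 0 ≤ C ∧
    ∀ c f t, ‖wave a ha c f t‖ ≤ C * ‖f‖ := by
  set D := dilate (-a⁻¹) (neg_ne_zero.2 (inv_ne_zero ha))
  refine ⟨‖restrict01‖ * ‖D‖, by positivity, fun c f t => ?_⟩
  refine (restrict01.le_opNorm _).trans ?_
  rw [mul_assoc]
  refine mul_le_mul_of_nonneg_left ((D.le_opNorm _).trans ?_) (norm_nonneg _)
  rw [LinearIsometry.norm_map]

/-- The waves at time `t` only involve `b` on `[t - τ, t]`, where an exponential weight is at least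
`exp (ω (t - τ))`. -/
theorem exists_norm_waves_le (hlam : 0 < S.lam) (hmu : 0 < S.mu) : ∃ C, 0 ≤ C ∧
    ∀ (ω : ℝ) (b B : LineL2) (t : ℝ), 0 ≤ ω → (∀ᵐ y, B y = Real.exp (ω * y) * b y) →
      ‖alphaWave S hlam.ne' b t‖ + ‖betaWave S hmu.ne' b t‖ ≤
        C * Real.exp (-ω * (t - S.tau)) * ‖B‖ := by
  obtain ⟨C₁, hC₁, h₁⟩ := exists_norm_wave_le hlam.ne'
  obtain ⟨C₂, hC₂, h₂⟩ := exists_norm_wave_le (neg_ne_zero.2 hmu.ne')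
  refine ⟨|S.q| * C₁ + C₂, by positivity, fun ω b B t hω hB => ?_⟩
  have p1 : 0 < 1 / S.lam := by positivity
  have p2 : 0 < 1 / S.mu := by positivity
  set E := Real.exp (-ω * (t - S.tau)) with hE
  have key : ∀ y, t - S.tau ≤ y → B y = Real.exp (ω * y) * b y → |b y| ≤ E * |B y| := by
    intro y hy hBy
    rw [hBy, abs_mul, Real.abs_exp, hE, ← mul_assoc, ← Real.exp_add]
    refine le_mul_of_one_le_left (abs_nonneg _) (Real.one_le_exp ?_)
    have := mul_le_mul_of_nonneg_left hy hω
    linarith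
  have hα : ‖alphaWave S hlam.ne' b t‖ ≤ E * ‖alphaWave S hlam.ne' B t‖ := by
    refine Lp.norm_le_mul_norm_of_ae_le_mul ?_
    filter_upwards [alphaWave_coe hlam.ne' b t, alphaWave_coe hlam.ne' B t,
      ae_alpha_arg hlam.ne' t hB, ae_pos_lt_one] with x h3 h4 h5 h6
    rw [h3, h4, norm_mul, norm_mul, ← mul_assoc, mul_comm E, mul_assoc]
    refine mul_le_mul_of_nonneg_left (key _ ?_ h5) (norm_nonneg _)
    have : x / S.lam ≤ 1 / S.lam := div_le_div_of_nonneg_right h6.2.le hlam.le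
    unfold HypSystem.tau
    linarith
  have hβ : ‖betaWave S hmu.ne' b t‖ ≤ E * ‖betaWave S hmu.ne' B t‖ := by
    refine Lp.norm_le_mul_norm_of_ae_le_mul ?_
    filter_upwards [betaWave_coe hmu.ne' b t, betaWave_coe hmu.ne' B t,
      ae_beta_arg hmu.ne' t hB, ae_pos_lt_one] with x h3 h4 h5 h6
    rw [h3, h4]
    refine key _ ?_ h5
    have : 0 < x / S.mu := div_pos h6.1 hmu
    unfold HypSystem.tau
    linarith
  have hα' : ‖alphaWave S hlam.ne' B t‖ ≤ |S.q| * C₁ * ‖B‖ := by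
    rw [alphaWave, norm_smul, Real.norm_eq_abs, mul_assoc]
    exact mul_le_mul_of_nonneg_left (h₁ _ _ _) (abs_nonneg _)
  have hβ' : ‖betaWave S hmu.ne' B t‖ ≤ C₂ * ‖B‖ := h₂ _ _ _
  have hE0 : 0 ≤ E := (Real.exp_pos _).le
  have := mul_le_mul_of_nonneg_left hα' hE0
  have := mul_le_mul_of_nonneg_left hβ' hE0
  calc _ ≤ E * (|S.q| * C₁ * ‖B‖) + E * (C₂ * ‖B‖) := by linarith
    _ = _ := by ring

theorem IntegratedTransport.const_smul {a : ℝ} {W w : ℝ → ℝ} {B₀ B₁ : ℝ}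
    (h : IntegratedTransport a W w B₀ B₁) (c : ℝ) :
    IntegratedTransport a (c • W) (c • w) (c * B₀) (c * B₁) := by
  refine ⟨?_, ?_⟩
  · filter_upwards [h.ae_eq] with x hx
    simp only [Pi.smul_apply, smul_eq_mul]
    rw [intervalIntegral.integral_const_mul]
    linear_combination c * hx
  · simp only [Pi.smul_apply, smul_eq_mul]
    rw [integral_const_mul, h.total]
    ring

theorem intervalIntegrable_of_m01 {w : ℝ → ℝ} (hw : Integrable w m01) {x y : ℝ}
    (hx : x ∈ Icc (0 : ℝ) 1) (hy : y ∈ Icc (0 : ℝ) 1) : IntervalIntegrable w volume x y := by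
  rw [intervalIntegrable_iff']
  exact IntegrableOn.mono_set hw (uIcc_subset_Icc hx hy)

theorem IntegratedTransport.sub {a : ℝ} {W w W' w' : ℝ → ℝ} {B₀ B₁ B₀' B₁' : ℝ}
    (h : IntegratedTransport a W w B₀ B₁) (h' : IntegratedTransport a W' w' B₀' B₁')
    (hw : Integrable w m01) (hw' : Integrable w' m01) :
    IntegratedTransport a (W - W') (w - w') (B₀ - B₀') (B₁ - B₁') := by
  refine ⟨?_, ?_⟩
  · filter_upwards [h.ae_eq, h'.ae_eq, ae_restrict_mem measurableSet_Icc] with x hx hx' hm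
    have h0 : (0 : ℝ) ∈ Icc (0 : ℝ) 1 := ⟨le_rfl, zero_le_one⟩
    simp only [Pi.sub_apply]
    rw [intervalIntegral.integral_sub (intervalIntegrable_of_m01 hw h0 hm)
      (intervalIntegrable_of_m01 hw' h0 hm)]
    linear_combination hx - hx'
  · simp only [Pi.sub_apply]
    rw [integral_sub hw hw', h.total, h'.total]
    ring

/-- The outflow of `β` at `0` is the inflow of `α`, up to the factor `q`. -/
theorem waves_transport (hlam : 0 < S.lam) (hmu : 0 < S.mu) (b : LineL2) {t : ℝ} (ht : 0 ≤ t) :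
    IntegratedTransport S.lam (∫ s in (0 : ℝ)..t, alphaWave S hlam.ne' b s : StateL2)
      (alphaWave S hlam.ne' b t - alphaWave S hlam.ne' b 0 : StateL2)
      (S.q * ∫ s in (0 : ℝ)..t, b (s - 1 / S.mu)) (S.q * ∫ s in (0 : ℝ)..t, b (s - S.tau)) ∧
    IntegratedTransport (-S.mu) (∫ s in (0 : ℝ)..t, betaWave S hmu.ne' b s : StateL2)
      (betaWave S hmu.ne' b t - betaWave S hmu.ne' b 0 : StateL2)
      (∫ s in (0 : ℝ)..t, b (s - 1 / S.mu)) (∫ s in (0 : ℝ)..t, b s) := by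
  constructor
  · have h := wave_transport hlam.ne' (-(1 / S.mu)) b ht
    have e : ∀ s, s - 1 / S.mu - 1 / S.lam = s - S.tau := fun s => by
      unfold HypSystem.tau; ring
    simp only [← sub_eq_add_neg, e] at h
    refine IntegratedTransport.congr (h.const_smul S.q) ?_ ?_
    · simp only [alphaWave, intervalIntegral.integral_smul]
      exact (Lp.coeFn_smul _ _).symm
    · simp only [alphaWave, ← smul_sub]
      exact (Lp.coeFn_smul _ _).symm
  · have h := wave_transport (neg_ne_zero.2 hmu.ne') (-(1 / S.mu)) b ht
    have e : ∀ s, s + -(1 / S.mu) - 1 / -S.mu = s := fun s => by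
      rw [div_neg]; ring
    simp only [e] at h
    simp only [← sub_eq_add_neg] at h
    exact h

/-- Lebesgue differentiation. -/
theorem ae_eq_zero_of_primitive_eq_zero {f : ℝ → ℝ} {T : ℝ} (hT : 0 ≤ T)
    (hf : IntervalIntegrable f volume 0 T) (h : ∀ t ∈ Icc 0 T, ∫ s in (0 : ℝ)..t, f s = 0) :
    ∀ᵐ t, 0 ≤ t → t ≤ T → f t = 0 := by
  have hi : Integrable ((Icc 0 T).indicator f) volume := by
    rw [integrable_indicator_iff measurableSet_Icc]
    rwa [intervalIntegrable_iff_integrableOn_Icc_of_le hT] at hf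
  filter_upwards [LocallyIntegrable.ae_hasDerivAt_integral hi.locallyIntegrable,
    Measure.ae_ne volume 0,
    Measure.ae_ne volume T] with t hd h0 h1 ht0 htT
  have hm : t ∈ Ioo 0 T := ⟨lt_of_le_of_ne ht0 (Ne.symm h0), lt_of_le_of_ne htT h1⟩
  have hz : HasDerivAt (fun x => ∫ s in (0 : ℝ)..x, (Icc 0 T).indicator f s) 0 t := by
    refine (hasDerivAt_const t (0 : ℝ)).congr_of_eventuallyEq ?_
    filter_upwards [Ioo_mem_nhds hm.1 hm.2] with x hx
    have e : ∫ s in (0 : ℝ)..x, (Icc 0 T).indicator f s = ∫ s in (0 : ℝ)..x, f s := by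
      refine intervalIntegral.integral_congr fun s hs => ?_
      rw [uIcc_of_le hx.1.le] at hs
      exact indicator_of_mem (show s ∈ Icc 0 T from ⟨hs.1, hs.2.trans hx.2.le⟩) _
    rw [e, h x ⟨hx.1.le, hx.2.le⟩]
  have := (hd 0).unique hz
  rwa [indicator_of_mem (show t ∈ Icc 0 T from ⟨ht0, htT⟩)] at this

/-- A solution of the target system on `[0, T]` is encoded in the trace of `β` at `1`. -/
theorem exists_waves_of_target (hlam : 0 < S.lam) (hmu : 0 < S.mu) (hq : S.q ≠ 0) {T : ℝ}
    (hT : 0 < T) {α β : ℝ → StateL2} (hα : ContinuousOn α (Icc 0 T))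
    (hβ : ContinuousOn β (Icc 0 T)) {u₀ v₀ α₁ β₁ : ℝ → ℝ} (hα₁ : IntervalIntegrable α₁ volume 0 T)
    (hβ₁ : MemLp β₁ 2 (volume.restrict (Icc 0 T)))
    (h0 : ∀ t ∈ Icc 0 T, ∫ s in (0 : ℝ)..t, u₀ s = S.q * ∫ s in (0 : ℝ)..t, v₀ s)
    (hA : ∀ t ∈ Icc 0 T, IntegratedTransport S.lam (∫ s in (0 : ℝ)..t, α s : StateL2)
      (α t - α 0 : StateL2) (∫ s in (0 : ℝ)..t, u₀ s) (∫ s in (0 : ℝ)..t, α₁ s))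
    (hB : ∀ t ∈ Icc 0 T, IntegratedTransport (-S.mu) (∫ s in (0 : ℝ)..t, β s : StateL2)
      (β t - β 0 : StateL2) (∫ s in (0 : ℝ)..t, v₀ s) (∫ s in (0 : ℝ)..t, β₁ s)) :
    ∃ b : LineL2, (∀ᵐ y, y < 0 → b y = initialTrace S hlam.ne' hmu.ne' (α 0) (β 0) y) ∧
      (∀ᵐ y, T < y → b y = 0) ∧ (∀ᵐ y, 0 ≤ y → y ≤ T → b y = β₁ y) ∧
      (∀ t ∈ Icc 0 T, α t = alphaWave S hlam.ne' b t ∧ β t = betaWave S hmu.ne' b t) ∧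
      ∀ᵐ t, 0 ≤ t → t ≤ T → α₁ t = S.q * b (t - S.tau) := by
  set b₀ := initialTrace S hlam.ne' hmu.ne' (α 0) (β 0)
  -- the initial state is stored at negative times, and `b` is cut off after `T` to be square
  -- integrable
  set b : LineL2 := b₀ + extend (Icc 0 T) measurableSet_Icc (hβ₁.toLp β₁)
  have hτ := HypSystem.tau_pos hlam hmu
  have hb : ∀ᵐ y, b y = b₀ y + (Icc 0 T).indicator β₁ y := by
    filter_upwards [Lp.coeFn_add b₀ (extend (Icc 0 T) measurableSet_Icc (hβ₁.toLp β₁)),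
      extend_coe measurableSet_Icc (hβ₁.toLp β₁),
      indicator_ae_eq measurableSet_Icc hβ₁.coeFn_toLp] with y h1 h2 h3
    rw [h1, Pi.add_apply, h2, h3]
  have hb1 : ∀ᵐ y, y < 0 → b y = b₀ y := by
    filter_upwards [hb] with y hy hy0
    rw [hy, indicator_of_notMem (fun hh => absurd hh.1 (not_le.2 hy0)), add_zero]
  have hsupp := initialTrace_supp hlam hmu (α 0) (β 0)
  have hb2 : ∀ᵐ y, T < y → b y = 0 := by
    filter_upwards [hb, hsupp] with y hy hy' hyT
    rw [hy, indicator_of_notMem (fun hh => absurd hh.2 (not_le.2 hyT)), add_zero]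
    exact hy' fun hh => absurd hh.2 (not_le.2 (hT.trans hyT))
  have hb3 : ∀ᵐ y, 0 ≤ y → y ≤ T → b y = β₁ y := by
    filter_upwards [hb, hsupp, Measure.ae_ne volume 0] with y hy hy' hne hy0 hyT
    rw [hy, indicator_of_mem (show y ∈ Icc 0 T from ⟨hy0, hyT⟩), hy' fun hh =>
      hne (le_antisymm hh.2 hy0), zero_add]
  obtain ⟨ha0, hb0⟩ := waves_initial hlam hmu hq hb1
  have hint : ∀ {y : ℝ → StateL2} {t : ℝ}, t ∈ Icc 0 T → ContinuousOn y (Icc 0 T) →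
      IntervalIntegrable y volume 0 t := fun ht hy =>
    ContinuousOn.intervalIntegrable (by
      rw [uIcc_of_le ht.1]
      exact hy.mono (Icc_subset_Icc_right ht.2))
  have cα : Continuous (alphaWave S hlam.ne' b) :=
    (continuous_wave hlam.ne' (-(1 / S.mu)) b).const_smul S.q
  have cβ : Continuous (betaWave S hmu.ne' b) :=
    continuous_wave (neg_ne_zero.2 hmu.ne') (-(1 / S.mu)) b
  have bβ : ∀ t ∈ Icc 0 T, ∫ s in (0 : ℝ)..t, b s = ∫ s in (0 : ℝ)..t, β₁ s := fun t ht =>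
    intervalIntegral.integral_congr_ae (by
      filter_upwards [hb3] with s hs hs'
      rw [uIoc_of_le ht.1] at hs'
      exact hs hs'.1.le (hs'.2.trans ht.2))
  -- the difference of `β` and its wave has no inflow at `1`; hence both have the same trace at
  -- `0`, and
  -- the difference of `α` and its wave has no inflow there
  have zβ := IntegratedTransport.eq_zero (neg_ne_zero.2 hmu.ne') hT (hβ.sub cβ.continuousOn)
    (B₀ := fun t => (∫ s in (0 : ℝ)..t, v₀ s) - ∫ s in (0 : ℝ)..t, b (s - 1 / S.mu))
    (B₁ := fun t => (∫ s in (0 : ℝ)..t, β₁ s) - ∫ s in (0 : ℝ)..t, b s)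
    (fun t ht => by
      refine ((hB t ht).sub (waves_transport hlam hmu b ht.1).2 (Lp.integrable01 _)
        (Lp.integrable01 _)).congr ?_ ?_
      · simp only [Pi.sub_apply]
        rw [intervalIntegral.integral_sub (hint ht hβ) (hint ht cβ.continuousOn)]
        exact (Lp.coeFn_sub _ _).symm
      · refine (Lp.coeFn_sub _ _).symm.trans (Filter.EventuallyEq.of_eq ?_)
        rw [hb0]
        congr 2
        simp only [Pi.sub_apply]
        abel)
    (fun t ht => ⟨fun hp => absurd hp (by linarith), fun _ => by
      rw [bβ t ht, sub_self]⟩)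
  have zα := IntegratedTransport.eq_zero hlam.ne' hT (hα.sub cα.continuousOn)
    (B₀ := fun t => (∫ s in (0 : ℝ)..t, u₀ s) - S.q * ∫ s in (0 : ℝ)..t, b (s - 1 / S.mu))
    (B₁ := fun t => (∫ s in (0 : ℝ)..t, α₁ s) - S.q * ∫ s in (0 : ℝ)..t, b (s - S.tau))
    (fun t ht => by
      refine ((hA t ht).sub (waves_transport hlam hmu b ht.1).1 (Lp.integrable01 _)
        (Lp.integrable01 _)).congr ?_ ?_
      · simp only [Pi.sub_apply]
        rw [intervalIntegral.integral_sub (hint ht hα) (hint ht cα.continuousOn)]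
        exact (Lp.coeFn_sub _ _).symm
      · refine (Lp.coeFn_sub _ _).symm.trans (Filter.EventuallyEq.of_eq ?_)
        rw [ha0]
        congr 2
        simp only [Pi.sub_apply]
        abel)
    (fun t ht => ⟨fun _ => by
      have h1 := (zβ t ht).2
      beta_reduce at h1 ⊢
      rw [bβ t ht, sub_self, sub_eq_zero] at h1
      rw [h0 t ht, h1, sub_self], fun hn => absurd hn (by linarith)⟩)
  refine ⟨b, hb1, hb2, hb3, fun t ht => ⟨sub_eq_zero.1 (zα t ht).1, sub_eq_zero.1 (zβ t ht).1⟩, ?_⟩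
  have ibτ : ∀ t, IntervalIntegrable (fun s => S.q * b (s - S.tau)) volume 0 t := fun t => by
    have := (LineL2.intervalIntegrable b (0 - S.tau) (t - S.tau)).comp_sub_right S.tau
    simpa using this.const_mul S.q
  have hz := ae_eq_zero_of_primitive_eq_zero hT.le (hα₁.sub (ibτ T)) (fun t ht => by
    have h1 := (zα t ht).2
    have h2 := (zβ t ht).2
    beta_reduce at h1 h2
    rw [bβ t ht, sub_self, sub_eq_zero] at h2
    rw [h0 t ht, h2, sub_self] at h1
    rw [intervalIntegral.integral_sub (hα₁.mono_set (by
      rw [uIcc_of_le ht.1, uIcc_of_le hT.le]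
      exact Icc_subset_Icc_right ht.2)) (ibτ t), intervalIntegral.integral_const_mul]
    exact h1.symm)
  filter_upwards [hz] with t ht h0t hTt
  exact sub_eq_zero.1 (ht h0t hTt)

/-! ### Stability under the small-gain condition -/

theorem controlBS2_eq (hk : k.Tri) (K u₁ : ℝ) (u v : StateL2) :
    controlBS2 S k K u₁ u v =
      -K * u₁ - (S.rho - K) * k.op₁ u v 1 + k.op₂ u v 1 := by
  rw [controlBS2, Kernels.op₁, Kernels.op₂, intOp, intOp, intOp, intOp,
    ← integral_add ((hk.uu.left 1).integrable_mul (Lp.integrable01 u))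
      ((hk.uv.left 1).integrable_mul (Lp.integrable01 v)),
    ← integral_add ((hk.vu.left 1).integrable_mul (Lp.integrable01 u))
      ((hk.vv.left 1).integrable_mul (Lp.integrable01 v))]

/-- `IsResolvent.left₁` and `IsResolvent.left₂` for square integrable states. -/
theorem IsResolvent.left_L2 (hr : IsResolvent k l) (hk : k.Tri) (hl : l.Tri) (u v : StateL2) :
    hl.opL₁ (u - hk.opL₁ (u, v), v - hk.opL₂ (u, v)) = hk.opL₁ (u, v) ∧
    hl.opL₂ (u - hk.opL₁ (u, v), v - hk.opL₂ (u, v)) = hk.opL₂ (u, v) ∧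
    l.op₁ (u - hk.opL₁ (u, v) : StateL2) (v - hk.opL₂ (u, v) : StateL2) 1 = k.op₁ u v 1 ∧
    l.op₂ (u - hk.opL₁ (u, v) : StateL2) (v - hk.opL₂ (u, v) : StateL2) 1 = k.op₂ u v 1 := by
  have e1 := sub_coe (u := u) (hk.opL₁_coe u v)
  have e2 := sub_coe (u := v) (hk.opL₂_coe u v)
  have iu := Lp.integrable01 u
  have iv := Lp.integrable01 v
  have h1 : (1 : ℝ) ∈ Icc (0 : ℝ) 1 := ⟨zero_le_one, le_rfl⟩
  refine ⟨Lp.ext ?_, Lp.ext ?_, ?_, ?_⟩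
  · filter_upwards [hl.opL₁_coe (u - hk.opL₁ (u, v)) (v - hk.opL₂ (u, v)), hk.opL₁_coe u v,
      ae_restrict_mem measurableSet_Icc] with x h1 h2 hx
    rw [h1, h2, Kernels.op₁_congr e1 e2, hr.left₁ u v iu iv x hx]
  · filter_upwards [hl.opL₂_coe (u - hk.opL₁ (u, v)) (v - hk.opL₂ (u, v)), hk.opL₂_coe u v,
      ae_restrict_mem measurableSet_Icc] with x h1 h2 hx
    rw [h1, h2, Kernels.op₂_congr e1 e2, hr.left₂ u v iu iv x hx]
  · rw [Kernels.op₁_congr e1 e2, hr.left₁ u v iu iv 1 h1]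
  · rw [Kernels.op₂_congr e1 e2, hr.left₂ u v iu iv 1 h1]

theorem add_coe {u w : StateL2} {f : ℝ → ℝ} (hw : w =ᵐ[m01] f) :
    (u + w : StateL2) =ᵐ[m01] fun x => u x + f x := by
  filter_upwards [Lp.coeFn_add u w, hw] with x h1 h2
  rw [h1, Pi.add_apply, h2]

/-- `IsResolvent.right₁` and `IsResolvent.right₂` for square integrable states. -/
theorem IsResolvent.right_L2 (hr : IsResolvent k l) (hk : k.Tri) (hl : l.Tri) (α β : StateL2) :
    hk.opL₁ (α + hl.opL₁ (α, β), β + hl.opL₂ (α, β)) = hl.opL₁ (α, β) ∧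
    hk.opL₂ (α + hl.opL₁ (α, β), β + hl.opL₂ (α, β)) = hl.opL₂ (α, β) ∧
    k.op₁ (α + hl.opL₁ (α, β) : StateL2) (β + hl.opL₂ (α, β) : StateL2) 1 = l.op₁ α β 1 ∧
    k.op₂ (α + hl.opL₁ (α, β) : StateL2) (β + hl.opL₂ (α, β) : StateL2) 1 = l.op₂ α β 1 := by
  have e1 := add_coe (u := α) (hl.opL₁_coe α β)
  have e2 := add_coe (u := β) (hl.opL₂_coe α β)
  have iu := Lp.integrable01 α
  have iv := Lp.integrable01 β
  have h1 : (1 : ℝ) ∈ Icc (0 : ℝ) 1 := ⟨zero_le_one, le_rfl⟩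
  refine ⟨Lp.ext ?_, Lp.ext ?_, ?_, ?_⟩
  · filter_upwards [hk.opL₁_coe (α + hl.opL₁ (α, β)) (β + hl.opL₂ (α, β)), hl.opL₁_coe α β,
      ae_restrict_mem measurableSet_Icc] with x h1 h2 hx
    rw [h1, h2, Kernels.op₁_congr e1 e2, hr.right₁ α β iu iv x hx]
  · filter_upwards [hk.opL₂_coe (α + hl.opL₁ (α, β)) (β + hl.opL₂ (α, β)), hl.opL₂_coe α β,
      ae_restrict_mem measurableSet_Icc] with x h1 h2 hx
    rw [h1, h2, Kernels.op₂_congr e1 e2, hr.right₂ α β iu iv x hx]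
  · rw [Kernels.op₁_congr e1 e2, hr.right₁ α β iu iv 1 h1]
  · rw [Kernels.op₂_congr e1 e2, hr.right₂ α β iu iv 1 h1]

theorem norm_clm_pair_le {F : Type*} [NormedAddCommGroup F] [NormedSpace ℝ F]
    (L : StateL2 × StateL2 →L[ℝ] F) (u v : StateL2) : ‖L (u, v)‖ ≤ ‖L‖ * (‖u‖ + ‖v‖) := by
  refine (L.le_opNorm _).trans (mul_le_mul_of_nonneg_left ?_ (norm_nonneg _))
  exact max_le (le_add_of_nonneg_right (norm_nonneg _)) (le_add_of_nonneg_left (norm_nonneg _))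

/-- The weak form of the second equation, written as a transport equation of speed `-μ`. -/
theorem neg_speed_integrand (S : HypSystem) (u v : ℝ → StateL2) (v0 v1 φ : ℝ → ℝ) (t : ℝ) :
    (∫ s in (0 : ℝ)..t,
        ((∫ x in Icc (0 : ℝ) 1, (-(S.mu * v s x * deriv φ x) + S.sMP x * u s x * φ x))
          + S.mu * (v1 s * φ 1 - v0 s * φ 0))) =
      ∫ s in (0 : ℝ)..t,
        ((∫ x in Icc (0 : ℝ) 1, (-S.mu * v s x * deriv φ x + S.sMP x * u s x * φ x))
          + -S.mu * (v0 s * φ 0 - v1 s * φ 1)) := by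
  refine intervalIntegral.integral_congr fun s _ => ?_
  congr 1
  · exact integral_congr_ae (Filter.Eventually.of_forall fun x => by ring)
  · ring

theorem intervalIntegrable_of_memLp {f : ℝ → ℝ} {t : ℝ} (ht : 0 ≤ t)
    (hf : MemLp f 2 (volume.restrict (Icc 0 t))) : IntervalIntegrable f volume 0 t := by
  have : IsFiniteMeasure (volume.restrict (Icc 0 t)) := ⟨by simp⟩
  rw [intervalIntegrable_iff_integrableOn_Icc_of_le ht]
  exact hf.integrable one_le_two

variable {K δ : ℝ} {uI vI : StateL2} {hst : HistoryL2 δ} {u v : ℝ → StateL2} {u0 u1 v0 v1 : ℝ → ℝ}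

/-- The transformed state of a solution satisfies the transport equations of the target system. -/
theorem IsRegularPair.target_of_solution (h : IsRegularPair S k) {𝒦 : Feedback}
    (sol : IsClosedLoopSolution S 𝒦 δ uI vI hst u v u0 u1 v0 v1) {t : ℝ} (ht : 0 ≤ t) :
    (∫ s in (0 : ℝ)..t, u0 s = S.q * ∫ s in (0 : ℝ)..t, v0 s) ∧
    IntegratedTransport S.lam (∫ s in (0 : ℝ)..t, (u s - h.tri.opL₁ (u s, v s)) : StateL2)
        ((u t - h.tri.opL₁ (u t, v t)) - (u 0 - h.tri.opL₁ (u 0, v 0)) : StateL2)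
        (∫ s in (0 : ℝ)..t, u0 s) (∫ s in (0 : ℝ)..t, (u1 s - h.tri.end₁ (u s, v s))) ∧
      IntegratedTransport (-S.mu) (∫ s in (0 : ℝ)..t, (v s - h.tri.opL₂ (u s, v s)) : StateL2)
        ((v t - h.tri.opL₂ (u t, v t)) - (v 0 - h.tri.opL₂ (u 0, v 0)) : StateL2)
        (∫ s in (0 : ℝ)..t, v0 s) (∫ s in (0 : ℝ)..t, (v1 s - h.tri.end₂ (u s, v s))) := by
  have cu := sol.continuousOn_u.mono (Icc_subset_Ici_self : Icc 0 t ⊆ Ici 0)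
  have cv := sol.continuousOn_v.mono (Icc_subset_Ici_self : Icc 0 t ⊆ Ici 0)
  have iu : IntervalIntegrable u volume 0 t :=
    ContinuousOn.intervalIntegrable (by rwa [uIcc_of_le ht])
  have iv : IntervalIntegrable v volume 0 t :=
    ContinuousOn.intervalIntegrable (by rwa [uIcc_of_le ht])
  have j0 := intervalIntegrable_of_memLp ht (sol.trace_u0 t)
  have j1 := intervalIntegrable_of_memLp ht (sol.trace_u1 t)
  have l0 := intervalIntegrable_of_memLp ht (sol.trace_v0 t)
  have l1 := intervalIntegrable_of_memLp ht (sol.trace_v1 t)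
  have hq : ∫ s in (0 : ℝ)..t, u0 s = S.q * ∫ s in (0 : ℝ)..t, v0 s := by
    rw [← intervalIntegral.integral_const_mul]
    refine intervalIntegral.integral_congr_ae ?_
    filter_upwards [(ae_restrict_iff' measurableSet_Ici).1 sol.boundary_zero] with s hs hs'
    rw [uIoc_of_le ht] at hs'
    exact hs hs'.1.le
  refine ⟨hq, (h.target_iff ht cu cv j1 l1 hq).1 ⟨?_, ?_⟩⟩
  · refine IntegratedTransport.of_weak h.sPM iu iv j0 j1 fun φ hφ => ?_
    rw [← sol.weak_u φ hφ t ht, sol.init_u]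
  · refine IntegratedTransport.of_weak h.sMP iv iu l0 l1 fun φ hφ => ?_
    rw [← neg_speed_integrand, ← sol.weak_v φ hφ t ht, sol.init_v]

/-- In the target variables the feedback is `-K α(·, 1)` plus the nonlocal boundary term. -/
theorem controlBS2_target (hk : k.Tri) (hl : l.Tri) (hr : IsResolvent k l) (K u₁ : ℝ)
    (u v : StateL2) : controlBS2 S k K u₁ u v = -K * (u₁ - hk.end₁ (u, v)) +
      (l.op₂ (u - hk.opL₁ (u, v) : StateL2) (v - hk.opL₂ (u, v) : StateL2) 1
        - S.rho * l.op₁ (u - hk.opL₁ (u, v) : StateL2) (v - hk.opL₂ (u, v) : StateL2) 1) := by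
  obtain ⟨-, -, h1, h2⟩ := hr.left_L2 hk hl u v
  rw [h1, h2, controlBS2_eq hk, hk.end₁_eq]
  ring

/-- On `[0, T]`, a solution of the closed loop is encoded in a solution of the delay equation. -/
theorem IsRegularPair.exists_delay_of_solution (h : IsRegularPair S k) (hq : S.q ≠ 0)
    (hl : l.Tri) (hr : IsResolvent k l) (hδ : 0 ≤ δ)
    (sol : IsClosedLoopSolution S (controlBS2 S k K) δ uI vI hst u v u0 u1 v0 v1) {T : ℝ}
    (hT : 0 < T) :
    ∃ b : LineL2,
      Continues S b (initialTrace S h.lam_pos.ne' h.mu_pos.ne' (uI - h.tri.opL₁ (uI, vI))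
        (vI - h.tri.opL₂ (uI, vI))) ∧
      (∀ᵐ y, T < y → b y = 0) ∧
      (∀ t ∈ Icc 0 T, u t - h.tri.opL₁ (u t, v t) = alphaWave S h.lam_pos.ne' b t ∧
        v t - h.tri.opL₂ (u t, v t) = betaWave S h.mu_pos.ne' b t) ∧
      ∀ᵐ t, 0 ≤ t → t ≤ T → b t = delayOp S l K δ 0 b t + forcing S l δ hst
        (initialTrace S h.lam_pos.ne' h.mu_pos.ne' (uI - h.tri.opL₁ (uI, vI))
          (vI - h.tri.opL₂ (uI, vI))) t := by
  have cu := sol.continuousOn_u.mono (Icc_subset_Ici_self : Icc 0 T ⊆ Ici 0)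
  have cv := sol.continuousOn_v.mono (Icc_subset_Ici_self : Icc 0 T ⊆ Ici 0)
  have hmem : ∀ {f : ℝ → ℝ}, ContinuousOn f (Icc 0 T) → MemLp f 2 (volume.restrict (Icc 0 T)) := by
    intro f hf
    have : IsFiniteMeasure (volume.restrict (Icc 0 T)) := ⟨by simp⟩
    obtain ⟨C, hC⟩ := isCompact_Icc.exists_bound_of_continuousOn hf
    exact MemLp.of_bound (hf.aestronglyMeasurable measurableSet_Icc) C
      ((ae_restrict_iff' measurableSet_Icc).2 (Filter.Eventually.of_forall hC))
  have c1 := continuousOn_clm_pair h.tri.end₁ cu cv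
  have c2 := continuousOn_clm_pair h.tri.end₂ cu cv
  obtain ⟨b, hb1, hb2, hb3, hb4, hb5⟩ := exists_waves_of_target h.lam_pos h.mu_pos hq hT
    (cu.sub (continuousOn_clm_pair h.tri.opL₁ cu cv))
    (cv.sub (continuousOn_clm_pair h.tri.opL₂ cu cv)) (u₀ := u0) (v₀ := v0)
    (α₁ := fun s => u1 s - h.tri.end₁ (u s, v s)) (β₁ := fun s => v1 s - h.tri.end₂ (u s, v s))
    (intervalIntegrable_of_memLp hT.le ((sol.trace_u1 T).sub (hmem c1)))
    ((sol.trace_v1 T).sub (hmem c2))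
    (fun t ht => (h.target_of_solution sol ht.1).1)
    (fun t ht => (h.target_of_solution sol ht.1).2.1)
    (fun t ht => (h.target_of_solution sol ht.1).2.2)
  simp only [Pi.sub_apply, sol.init_u, sol.init_v] at hb1 hb4
  have hcont : Continues S b (initialTrace S h.lam_pos.ne' h.mu_pos.ne'
      (uI - h.tri.opL₁ (uI, vI)) (vI - h.tri.opL₂ (uI, vI))) :=
    ⟨hb1, initialTrace_supp h.lam_pos h.mu_pos _ _⟩
  refine ⟨b, hcont, hb2, hb4, ?_⟩
  have hn : ∀ t ∈ Icc 0 T,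
      l.op₂ (u t - h.tri.opL₁ (u t, v t) : StateL2) (v t - h.tri.opL₂ (u t, v t) : StateL2) 1
      - S.rho * l.op₁ (u t - h.tri.opL₁ (u t, v t) : StateL2)
        (v t - h.tri.opL₂ (u t, v t) : StateL2) 1 = ∫ ν, Ntilde S l ν * b (t - ν) := by
    intro t ht
    rw [(hb4 t ht).1, (hb4 t ht).2]
    exact op_waves_eq h.lam_pos h.mu_pos hl b t
  filter_upwards [hb3, hb5, ae_comp_sub δ hb5,
    (ae_restrict_iff' measurableSet_Ici).1 sol.boundary_one,
    delay_rhs h.lam_pos h.mu_pos hl K hδ hst hcont] with t g1 g2 g3 g4 g5 ht0 htT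
  rw [g5 ht0, g1 ht0 htT, g4 ht0, delayedInput]
  have g2' := g2 ht0 htT
  have hnt := hn t ⟨ht0, htT⟩
  obtain ⟨-, -, h1, h2⟩ := hr.left_L2 h.tri hl (u t) (v t)
  rw [h1, h2] at hnt
  rw [← hnt, h.tri.end₂_eq]
  rw [h.tri.end₁_eq] at g2'
  have key : (if t < δ then hst (t - δ) else
      controlBS2 S k K (u1 (t - δ)) (u (t - δ)) (v (t - δ))) =
      if t < δ then hst (t - δ) else
          -K * (S.q * b (t - δ - S.tau)) + ∫ ν, Ntilde S l ν * b (t - δ - ν) := by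
    split_ifs with htδ
    · rfl
    · push Not at htδ
      rw [controlBS2_target h.tri hl hr, hn (t - δ) ⟨by linarith, by linarith⟩,
        g3 (by linarith) (by linarith)]
  rw [key]
  linear_combination S.rho * g2'

/-- The weighted bound for the trace `b` on `[0, t + 1]` does not depend on `t`; the waves and the
inverse transformation carry it over to the state at time `t`. -/
theorem IsRegularPair.decay (h : IsRegularPair S k) (hq : S.q ≠ 0) (hl : l.Tri)
    (hr : IsResolvent k l) (hδ : 0 ≤ δ) (hgain : loopGain S l K δ < 1) :
    ∃ C ω : ℝ, 0 < C ∧ 0 < ω ∧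
    ∀ (uI vI : StateL2) (hst : HistoryL2 δ) (u v : ℝ → StateL2) (u0 u1 v0 v1 : ℝ → ℝ),
      IsClosedLoopSolution S (controlBS2 S k K) δ uI vI hst u v u0 u1 v0 v1 →
      ∀ t : ℝ, 0 ≤ t →
        ‖u t‖ + ‖v t‖ ≤ C * Real.exp (-ω * t) * (‖uI‖ + ‖vI‖ + ‖hst‖) := by
  have hlam := h.lam_pos
  have hmu := h.mu_pos
  -- the small-gain condition is open, so that some positive rate `ω` is admissible
  obtain ⟨ω, hθ, hω⟩ : ∃ ω, loopGain S l K δ * Real.exp (ω * (S.tau + δ)) < 1 ∧ 0 < ω := by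
    have hc : Continuous fun ω => loopGain S l K δ * Real.exp (ω * (S.tau + δ)) := by fun_prop
    have h1 : ∀ᶠ ω in nhds 0, loopGain S l K δ * Real.exp (ω * (S.tau + δ)) < 1 :=
      (hc.tendsto 0).eventually_lt_const (by simpa using hgain)
    exact ((h1.filter_mono nhdsWithin_le_nhds).and
      (self_mem_nhdsWithin (s := Ioi (0 : ℝ)))).exists
  obtain ⟨C₁, hC₁, hw⟩ := exists_norm_waves_le hlam hmu
  obtain ⟨C₂, hC₂, hi⟩ := exists_norm_initialTrace_le (S := S) hlam.ne' hmu.ne'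
  set N := ∫ ν, |Ntilde S l ν|
  have hN : 0 ≤ N := integral_nonneg fun _ => abs_nonneg _
  set θ := loopGain S l K δ * Real.exp (ω * (S.tau + δ))
  set L := 1 + ‖hl.opL₁‖ + ‖hl.opL₂‖
  set M := 1 + ‖h.tri.opL₁‖ + ‖h.tri.opL₂‖
  set E := Real.exp (ω * δ)
  have hL : 1 ≤ L := by
    have := norm_nonneg hl.opL₁
    have := norm_nonneg hl.opL₂
    linarith
  have hM : 1 ≤ M := by
    have := norm_nonneg h.tri.opL₁
    have := norm_nonneg h.tri.opL₂
    linarith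
  have hE : 0 < E := Real.exp_pos _
  have hθ' : 0 < 1 - θ := by linarith
  set C₃ := ((1 + E * N) * (C₂ * M) + E) / (1 - θ)
  -- the summand `1` only serves to make the constant positive
  refine ⟨L * (C₁ * Real.exp (ω * S.tau)) * C₃ + 1, ω, by positivity, hω, ?_⟩
  intro uI vI hst u v u0 u1 v0 v1 sol t ht
  -- `T = t + 1` avoids the degenerate interval at `t = 0`
  obtain ⟨b, hb, hbT, hwave, heq⟩ := h.exists_delay_of_solution hq hl hr hδ sol
    (T := t + 1) (by linarith)
  set b₀ := initialTrace S hlam.ne' hmu.ne' (uI - h.tri.opL₁ (uI, vI)) (vI - h.tri.opL₂ (uI, vI))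
  have hg : ∀ᵐ s, s ∉ Ico 0 δ → forcing S l δ hst b₀ s = 0 := by
    filter_upwards [cutL_coe (measurableSet_Ico (a := 0) (b := δ))
      (shift δ (extend (Icc (-δ) 0) measurableSet_Icc hst - conv (Ntilde S l) b₀))] with s hs hs'
    rw [forcing, hs, indicator_of_notMem hs']
  obtain ⟨B, hB, hBn⟩ := delay_solution_bound hlam hmu hl hδ hω.le hb hbT heq hg
  set D := ‖uI‖ + ‖vI‖ + ‖hst‖
  have nn : ∀ (a c : StateL2), 0 ≤ ‖a‖ + ‖c‖ := fun a c => by positivity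
  have hbase : ‖uI - h.tri.opL₁ (uI, vI)‖ + ‖vI - h.tri.opL₂ (uI, vI)‖ ≤
      M * (‖uI‖ + ‖vI‖) := by
    have := norm_clm_pair_le h.tri.opL₁ uI vI
    have := norm_clm_pair_le h.tri.opL₂ uI vI
    have := norm_sub_le uI (h.tri.opL₁ (uI, vI))
    have := norm_sub_le vI (h.tri.opL₂ (uI, vI))
    calc _ ≤ (‖uI‖ + ‖vI‖) + ‖h.tri.opL₁‖ * (‖uI‖ + ‖vI‖) + ‖h.tri.opL₂‖ * (‖uI‖ + ‖vI‖) := by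
          linarith
      _ = _ := by ring
  have hD1 : ‖uI‖ + ‖vI‖ ≤ D := le_add_of_nonneg_right (norm_nonneg _)
  have hD2 : ‖hst‖ ≤ D := le_add_of_nonneg_left (nn _ _)
  have hD0 : 0 ≤ D := (nn _ _).trans hD1
  have hb₀ : ‖b₀‖ ≤ C₂ * M * D := by
    refine (hi _ _).trans ?_
    rw [mul_assoc]
    refine mul_le_mul_of_nonneg_left (hbase.trans ?_) hC₂
    exact mul_le_mul_of_nonneg_left hD1 (by linarith)
  have hBD : ‖B‖ ≤ C₃ * D := by
    have h1 := norm_forcing_le S l δ hst b₀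
    have h2 : ‖b₀‖ + E * ‖forcing S l δ hst b₀‖ ≤ ((1 + E * N) * (C₂ * M) + E) * D := by
      calc ‖b₀‖ + E * ‖forcing S l δ hst b₀‖ ≤ ‖b₀‖ + E * (‖hst‖ + N * ‖b₀‖) := by gcongr
        _ = (1 + E * N) * ‖b₀‖ + E * ‖hst‖ := by ring
        _ ≤ (1 + E * N) * (C₂ * M * D) + E * D := by gcongr
        _ = _ := by ring
    have h3 : C₃ * D = ((1 + E * N) * (C₂ * M) + E) * D / (1 - θ) := by
      simp only [C₃]; ring
    rw [h3, le_div_iff₀ hθ', mul_comm]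
    exact hBn.trans h2
  have htt : t ∈ Icc 0 (t + 1) := ⟨ht, by linarith⟩
  obtain ⟨e1, e2⟩ := hwave t htt
  have hαβ := hw ω b B t hω.le hB
  rw [← e1, ← e2] at hαβ
  set α := u t - h.tri.opL₁ (u t, v t)
  set β := v t - h.tri.opL₂ (u t, v t)
  obtain ⟨r1, r2, -, -⟩ := hr.left_L2 h.tri hl (u t) (v t)
  have eu : u t = α + hl.opL₁ (α, β) := by rw [r1, sub_add_cancel]
  have ev : v t = β + hl.opL₂ (α, β) := by rw [r2, sub_add_cancel]
  have huv : ‖u t‖ + ‖v t‖ ≤ L * (‖α‖ + ‖β‖) := by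
    have := norm_clm_pair_le hl.opL₁ α β
    have := norm_clm_pair_le hl.opL₂ α β
    have a1 := norm_add_le α (hl.opL₁ (α, β))
    have a2 := norm_add_le β (hl.opL₂ (α, β))
    rw [← eu] at a1
    rw [← ev] at a2
    calc _ ≤ (‖α‖ + ‖β‖) + ‖hl.opL₁‖ * (‖α‖ + ‖β‖) + ‖hl.opL₂‖ * (‖α‖ + ‖β‖) := by linarith
      _ = _ := by ring
  have hexp : Real.exp (-ω * (t - S.tau)) = Real.exp (ω * S.tau) * Real.exp (-ω * t) := by
    rw [← Real.exp_add]; ring_nf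
  rw [hexp] at hαβ
  have hE' := Real.exp_pos (ω * S.tau)
  have hE'' := Real.exp_pos (-ω * t)
  calc ‖u t‖ + ‖v t‖ ≤ L * (‖α‖ + ‖β‖) := huv
    _ ≤ L * (C₁ * (Real.exp (ω * S.tau) * Real.exp (-ω * t)) * (C₃ * D)) := by
      gcongr
      exact hαβ.trans (by gcongr)
    _ = L * (C₁ * Real.exp (ω * S.tau)) * C₃ * (Real.exp (-ω * t) * D) := by ring
    _ ≤ (L * (C₁ * Real.exp (ω * S.tau)) * C₃ + 1) * (Real.exp (-ω * t) * D) := by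
      have : 0 ≤ Real.exp (-ω * t) * D := by positivity
      linarith
    _ = _ := by ring

theorem memLp_restrict_shift (b : LineL2) (c : ℝ) (s : Set ℝ) :
    MemLp (fun t => b (t - c)) 2 (volume.restrict s) :=
  ((Lp.memLp b).comp_measurePreserving (measurePreserving_sub_right volume c)).restrict s

/-- The waves of a solution of the delay equation, transformed back, solve the closed loop. -/
theorem IsRegularPair.exists_solution (h : IsRegularPair S k) (hq : S.q ≠ 0) (hl : l.Tri)
    (hr : IsResolvent k l) (hδ : 0 ≤ δ) (hgain : loopGain S l K δ < 1) (uI vI : StateL2)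
    (hst : HistoryL2 δ) : ∃ (u v : ℝ → StateL2) (u0 u1 v0 v1 : ℝ → ℝ),
      IsClosedLoopSolution S (controlBS2 S k K) δ uI vI hst u v u0 u1 v0 v1 := by
  have hlam := h.lam_pos
  have hmu := h.mu_pos
  set α₀ := uI - h.tri.opL₁ (uI, vI) with hα₀
  set β₀ := vI - h.tri.opL₂ (uI, vI) with hβ₀
  set b₀ := initialTrace S hlam.ne' hmu.ne' α₀ β₀
  obtain ⟨b, hb, heq⟩ := exists_delay_solution hlam hmu hl hδ hgain b₀ (forcing S l δ hst b₀)
  have hcont : Continues S b b₀ := ⟨hb, initialTrace_supp hlam hmu _ _⟩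
  obtain ⟨iα, iβ⟩ := waves_initial hlam hmu hq hb
  set α := alphaWave S hlam.ne' b
  set β := betaWave S hmu.ne' b
  have cα : Continuous α := (continuous_wave hlam.ne' (-(1 / S.mu)) b).const_smul S.q
  have cβ : Continuous β := continuous_wave (neg_ne_zero.2 hmu.ne') (-(1 / S.mu)) b
  set u : ℝ → StateL2 := fun t => α t + hl.opL₁ (α t, β t)
  set v : ℝ → StateL2 := fun t => β t + hl.opL₂ (α t, β t)
  have cu : Continuous u := cα.add (hl.opL₁.continuous.comp (cα.prodMk cβ))
  have cv : Continuous v := cβ.add (hl.opL₂.continuous.comp (cα.prodMk cβ))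
  have ce1 : Continuous fun t => l.op₁ (α t) (β t) 1 := by
    simp only [← hl.end₁_eq]
    exact hl.end₁.continuous.comp (cα.prodMk cβ)
  have ce2 : Continuous fun t => l.op₂ (α t) (β t) 1 := by
    simp only [← hl.end₂_eq]
    exact hl.end₂.continuous.comp (cα.prodMk cβ)
  have R := fun t => hr.right_L2 h.tri hl (α t) (β t)
  have eu : ∀ t, u t - h.tri.opL₁ (u t, v t) = α t := fun t => by
    rw [(R t).1]; exact add_sub_cancel_right _ _
  have ev : ∀ t, v t - h.tri.opL₂ (u t, v t) = β t := fun t => by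
    rw [(R t).2.1]; exact add_sub_cancel_right _ _
  obtain ⟨L1, L2, -, -⟩ := hr.left_L2 h.tri hl uI vI
  have iu : u 0 = uI := by
    simp only [u, iα, iβ]
    rw [hα₀, hβ₀, L1, sub_add_cancel]
  have iv : v 0 = vI := by
    simp only [v, iα, iβ]
    rw [hα₀, hβ₀, L2, sub_add_cancel]
  have hmem : ∀ {f : ℝ → ℝ}, Continuous f → ∀ T, MemLp f 2 (volume.restrict (Icc 0 T)) := by
    intro f hf T
    have : IsFiniteMeasure (volume.restrict (Icc 0 T)) := ⟨by simp⟩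
    obtain ⟨C, hC⟩ := (isCompact_Icc (a := 0) (b := T)).exists_bound_of_continuousOn hf.continuousOn
    exact MemLp.of_bound hf.aestronglyMeasurable C
      ((ae_restrict_iff' measurableSet_Icc).2 (Filter.Eventually.of_forall hC))
  have m0 : ∀ T, MemLp (fun t => S.q * b (t - 1 / S.mu)) 2 (volume.restrict (Icc 0 T)) :=
    fun T => (memLp_restrict_shift b _ _).const_mul _
  have m1 : ∀ T, MemLp (fun t => S.q * b (t - S.tau) + l.op₁ (α t) (β t) 1) 2
      (volume.restrict (Icc 0 T)) :=
    fun T => ((memLp_restrict_shift b _ _).const_mul _).add (hmem ce1 T)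
  have m2 : ∀ T, MemLp (fun t => b (t - 1 / S.mu)) 2 (volume.restrict (Icc 0 T)) :=
    fun T => memLp_restrict_shift b _ _
  have m3 : ∀ T, MemLp (fun t => b t + l.op₂ (α t) (β t) 1) 2 (volume.restrict (Icc 0 T)) :=
    fun T => ((Lp.memLp b).restrict _).add (hmem ce2 T)
  have e1 : ∀ s, S.q * b (s - S.tau) + l.op₁ (α s) (β s) 1 - h.tri.end₁ (u s, v s) =
      S.q * b (s - S.tau) := fun s => by
    rw [h.tri.end₁_eq, (R s).2.2.1, add_sub_cancel_right]
  have e2 : ∀ s, b s + l.op₂ (α s) (β s) 1 - h.tri.end₂ (u s, v s) = b s := fun s => by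
    rw [h.tri.end₂_eq, (R s).2.2.2, add_sub_cancel_right]
  have hT : ∀ t : ℝ, 0 ≤ t → _ := fun t ht => (h.target_iff (u := u) (v := v) ht cu.continuousOn
    cv.continuousOn (intervalIntegrable_of_memLp ht (m1 t)) (intervalIntegrable_of_memLp ht (m3 t))
    (intervalIntegral.integral_const_mul S.q fun s => b (s - 1 / S.mu))).2 (by
      obtain ⟨w1, w2⟩ := waves_transport hlam hmu b ht
      simp only [eu, ev, e1, e2, intervalIntegral.integral_const_mul]
      exact ⟨w1, w2⟩)
  refine ⟨u, v, fun t => S.q * b (t - 1 / S.mu),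
    fun t => S.q * b (t - S.tau) + l.op₁ (α t) (β t) 1, fun t => b (t - 1 / S.mu),
    fun t => b t + l.op₂ (α t) (β t) 1, ?_⟩
  refine ⟨cu.continuousOn, cv.continuousOn, iu, iv, m0, m1, m2, m3, ?_, ?_, ?_, ?_⟩
  · intro φ hφ t ht
    have := (hT t ht).1.weak h.sPM (cu.intervalIntegrable 0 t) (cv.intervalIntegrable 0 t)
      (intervalIntegrable_of_memLp ht (m0 t)) (intervalIntegrable_of_memLp ht (m1 t)) hφ
    rw [iu] at this
    exact this
  · intro φ hφ t ht
    have := (hT t ht).2.weak h.sMP (cv.intervalIntegrable 0 t) (cu.intervalIntegrable 0 t)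
      (intervalIntegrable_of_memLp ht (m2 t)) (intervalIntegrable_of_memLp ht (m3 t)) hφ
    rw [iv] at this
    rw [neg_speed_integrand]
    exact this
  · exact Filter.Eventually.of_forall fun t => rfl
  · rw [ae_restrict_iff' measurableSet_Ici]
    filter_upwards [heq, delay_rhs hlam hmu hl K hδ hst hcont] with t g1 g2 ht
    have hn := fun s => op_waves_eq hlam hmu hl b s
    have key : delayedInput (controlBS2 S k K) δ hst u v
        (fun t => S.q * b (t - S.tau) + l.op₁ (α t) (β t) 1) t =
        if t < δ then hst (t - δ) else
          -K * (S.q * b (t - δ - S.tau)) + ∫ ν, Ntilde S l ν * b (t - δ - ν) := by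
      rw [delayedInput]
      split_ifs with htδ
      · rfl
      · rw [controlBS2_target h.tri hl hr, e1, eu, ev, hn]
    rw [key]
    have g3 := g1 ht
    rw [g2 ht, ← hn t] at g3
    linear_combination g3

theorem IsRegularPair.stableWithDelay (h : IsRegularPair S k) (hq : S.q ≠ 0) (hl : l.Tri)
    (hr : IsResolvent k l) (hδ : 0 ≤ δ) (hgain : loopGain S l K δ < 1) :
    StableWithDelay S (controlBS2 S k K) δ :=
  ⟨fun uI vI hst => h.exists_solution hq hl hr hδ hgain uI vI hst, h.decay hq hl hr hδ hgain⟩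

/-! ### Small delays and the characteristic function -/

/-- Continuity of translations in `L¹`. -/
theorem tendsto_integral_abs_sub_translate {f : ℝ → ℝ} (hf : Integrable f) :
    Filter.Tendsto (fun δ => ∫ ν, |f ν - f (ν - δ)|) (nhds 0) (nhds 0) := by
  set F : Lp ℝ 1 (volume : Measure ℝ) := hf.toL1 f
  have hg : Continuous fun c : ℝ => (⟨fun t => t - c, by fun_prop⟩ : C(ℝ, ℝ)) :=
    ContinuousMap.continuous_of_continuous_uncurry _ (by
      simp only [Function.uncurry_def, ContinuousMap.coe_mk]; fun_prop)
  have hc : Continuous fun c : ℝ => Lp.compMeasurePreserving (fun t => t - c)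
      (measurePreserving_sub_right volume c) F :=
    (continuous_const (y := F)).compMeasurePreservingLp hg
      (fun c => measurePreserving_sub_right volume c) (by simp)
  have hn := (continuous_const (y := F)).sub hc |>.norm
  have e : ∀ c, ‖F - Lp.compMeasurePreserving (fun t => t - c)
      (measurePreserving_sub_right volume c) F‖ = ∫ ν, |f ν - f (ν - c)| := by
    intro c
    rw [L1.norm_eq_integral_norm]
    refine integral_congr_ae ?_
    filter_upwards [Lp.coeFn_sub F (Lp.compMeasurePreserving (fun t => t - c)
      (measurePreserving_sub_right volume c) F), hf.coeFn_toL1, ae_comp_sub c hf.coeFn_toL1,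
      Lp.coeFn_compMeasurePreserving F (measurePreserving_sub_right volume c)] with ν h1 h2 h3 h4
    rw [h1, Pi.sub_apply, h4, Function.comp_apply, h2, h3, Real.norm_eq_abs]
  simpa using (hn.congr e).tendsto 0

/-- The small-gain condition holds for all small delays. -/
theorem exists_loopGain_lt_one (hlam : 0 < S.lam) (hmu : 0 < S.mu) (hl : l.Tri) {K : ℝ}
    (hK : |S.q * S.rho| + |K * S.q| < 1) :
    ∃ δ₀ : ℝ, 0 < δ₀ ∧ ∀ δ : ℝ, 0 ≤ δ → δ ≤ δ₀ → loopGain S l K δ < 1 := by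
  have hN : Integrable (Ntilde S l) := memLp_one_iff_integrable.1 (Ntilde_memLp hlam hmu hl 1)
  have ht := (tendsto_integral_abs_sub_translate hN).eventually_lt_const
    (show 0 < 1 - (|S.q * S.rho| + |K * S.q|) by linarith)
  obtain ⟨ε, hε, h⟩ := Metric.eventually_nhds_iff.1 ht
  refine ⟨ε / 2, by positivity, fun δ h0 h1 => ?_⟩
  have := h (y := δ) (by rw [Real.dist_eq, sub_zero, abs_of_nonneg h0]; linarith)
  simp only [loopGain, delayKer]
  linarith

/-- `Ñ` only involves the values of the kernels on the side `x = 1` of the triangle. -/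
theorem Ntilde_cut (hlam : 0 < S.lam) (hmu : 0 < S.mu) : Ntilde S l.cut = Ntilde S l := by
  have hm : ∀ ξ ∈ Icc (0 : ℝ) 1, ((1 : ℝ), ξ) ∈ triangle := fun ξ hξ => ⟨hξ.1, hξ.2, le_rfl⟩
  have ha : ∀ ξ ∈ Icc (0 : ℝ) 1, Nalpha S l.cut ξ = Nalpha S l ξ := fun ξ hξ => by
    simp only [Nalpha, Kernels.cut, cutTri_of_mem (hm ξ hξ)]
  have hb : ∀ ξ ∈ Icc (0 : ℝ) 1, Nbeta S l.cut ξ = Nbeta S l ξ := fun ξ hξ => by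
    simp only [Nbeta, Kernels.cut, cutTri_of_mem (hm ξ hξ)]
  funext ν
  unfold Ntilde
  congr 1
  · by_cases hν : ν ∈ Icc (1 / S.mu) S.tau
    · rw [indicator_of_mem hν, indicator_of_mem hν, ha]
      have h1 := mul_le_mul_of_nonneg_left hν.1 hlam.le
      have h2 := mul_le_mul_of_nonneg_left hν.2 hlam.le
      have e1 : S.lam * (1 / S.mu) = S.lam / S.mu := by ring
      have e2 : S.lam * S.tau = 1 + S.lam / S.mu := by
        unfold HypSystem.tau; field_simp
      constructor <;> linarith
    · rw [indicator_of_notMem hν, indicator_of_notMem hν]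
  · by_cases hν : ν ∈ Icc 0 (1 / S.mu)
    · rw [indicator_of_mem hν, indicator_of_mem hν, hb]
      have h1 := mul_nonneg hmu.le hν.1
      have h2 := mul_le_mul_of_nonneg_left hν.2 hmu.le
      have e1 : S.mu * (1 / S.mu) = 1 := by field_simp
      constructor <;> linarith
    · rw [indicator_of_notMem hν, indicator_of_notMem hν]

theorem norm_exp_neg_mul_le {ξ : ℝ} (hξ : 0 ≤ ξ) {s : ℂ} (hs : 0 ≤ s.re) :
    ‖Complex.exp (-(ξ * s))‖ ≤ 1 := by
  rw [Complex.norm_exp, Real.exp_le_one_iff]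
  simpa using mul_nonneg hξ hs

theorem integrable_mul_exp {f : ℝ → ℝ} (hf : Integrable f) (h0 : ∀ ξ < 0, f ξ = 0) {s : ℂ}
    (hs : 0 ≤ s.re) : Integrable fun ξ : ℝ => (f ξ : ℂ) * Complex.exp (-(ξ * s)) := by
  refine hf.norm.mono' (hf.ofReal.aestronglyMeasurable.mul
    (Continuous.aestronglyMeasurable (by fun_prop))) (Filter.Eventually.of_forall fun ξ => ?_)
  rw [norm_mul, Complex.norm_real]
  rcases lt_or_ge ξ 0 with h | h
  · rw [h0 ξ h, norm_zero, zero_mul]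
  · exact mul_le_of_le_one_right (norm_nonneg _) (norm_exp_neg_mul_le h hs)

/-- In the closed right half plane all exponentials in the characteristic function have modulus at
most `1`, so that it cannot vanish under the small-gain condition. -/
theorem charFun_ne_zero (hlam : 0 < S.lam) (hmu : 0 < S.mu) (hl : l.Tri) {K δ : ℝ} (hδ : 0 ≤ δ)
    (hgain : loopGain S l K δ < 1) {s : ℂ} (hs : 0 ≤ s.re) : charFun S l K δ s ≠ 0 := by
  have hτ := HypSystem.tau_pos hlam hmu
  have hN : Integrable (Ntilde S l) := memLp_one_iff_integrable.1 (Ntilde_memLp hlam hmu hl 1)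
  have hN0 : ∀ ξ < 0, Ntilde S l ξ = 0 := fun ξ hξ =>
    Ntilde_supp hlam hmu fun hh => absurd hh.1 (not_le.2 hξ)
  have i1 := integrable_mul_exp hN hN0 hs
  have i2 := integrable_mul_exp (hN.comp_sub_right δ) (fun ξ hξ => hN0 _ (by linarith)) hs
  have hint : ∫ ξ in (0 : ℝ)..S.tau, (Ntilde S l ξ : ℂ) *
        (Complex.exp (-(ξ * s)) - Complex.exp (-((ξ + δ) * s))) =
      ∫ ξ, (delayKer S l δ ξ : ℂ) * Complex.exp (-(ξ * s)) := by
    have e1 : ∫ ξ in (0 : ℝ)..S.tau, (Ntilde S l ξ : ℂ) *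
        (Complex.exp (-(ξ * s)) - Complex.exp (-((ξ + δ) * s))) =
        ∫ ξ : ℝ, (Ntilde S l ξ : ℂ) *
        (Complex.exp (-(ξ * s)) - Complex.exp (-((ξ + δ) * s))) := by
      rw [intervalIntegral.integral_of_le hτ.le, ← integral_Icc_eq_integral_Ioc]
      refine setIntegral_eq_integral_of_forall_compl_eq_zero fun ξ hξ => ?_
      rw [Ntilde_supp hlam hmu hξ, Complex.ofReal_zero, zero_mul]
    have i3 := i2.comp_add_right δ
    simp only [add_sub_cancel_right, Complex.ofReal_add] at i3
    -- a substitution moves the delay from the exponential to the kernel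
    have e2 : ∫ ξ : ℝ, (Ntilde S l ξ : ℂ) * Complex.exp (-((ξ + δ) * s)) =
        ∫ ξ : ℝ, (Ntilde S l (ξ - δ) : ℂ) * Complex.exp (-(ξ * s)) := by
      rw [← integral_add_right_eq_self
        (fun ξ : ℝ => (Ntilde S l (ξ - δ) : ℂ) * Complex.exp (-(ξ * s))) δ]
      simp only [add_sub_cancel_right, Complex.ofReal_add]
    rw [e1]
    simp only [mul_sub]
    rw [integral_sub i1 i3, e2, ← integral_sub i1 i2]
    refine integral_congr_ae (Filter.Eventually.of_forall fun ξ => ?_)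
    simp only [delayKer, Complex.ofReal_sub]
    ring
  have hM := delayKer_integrable hlam hmu hl hδ
  have hI : ‖∫ ξ, (delayKer S l δ ξ : ℂ) * Complex.exp (-(ξ * s))‖ ≤ ∫ ν, |delayKer S l δ ν| := by
    refine norm_integral_le_of_norm_le hM.abs (Filter.Eventually.of_forall fun ξ => ?_)
    rw [norm_mul, Complex.norm_real]
    rcases lt_or_ge ξ 0 with h | h
    · rw [delayKer_supp hlam hmu hδ fun hh => absurd hh.1 (not_le.2 h), norm_zero, zero_mul,
        abs_zero]
    · exact mul_le_of_le_one_right (norm_nonneg _) (norm_exp_neg_mul_le h hs)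
  intro h0
  rw [charFun, hint] at h0
  set I := ∫ ξ, (delayKer S l δ ξ : ℂ) * Complex.exp (-(ξ * s))
  set X := (S.q * S.rho : ℂ) * Complex.exp (-(S.tau * s)) with hX
  set Y := (K * S.q : ℂ) * Complex.exp (-((S.tau + δ) * s)) with hY
  have n1 : ‖X‖ ≤ |S.q * S.rho| := by
    rw [hX, norm_mul, ← Complex.ofReal_mul, Complex.norm_real]
    exact mul_le_of_le_one_right (norm_nonneg _) (norm_exp_neg_mul_le hτ.le hs)
  have n2 : ‖Y‖ ≤ |K * S.q| := by
    rw [hY, norm_mul, ← Complex.ofReal_mul, Complex.norm_real, ← Complex.ofReal_add]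
    exact mul_le_of_le_one_right (norm_nonneg _) (norm_exp_neg_mul_le (by linarith) hs)
  -- a zero would write `1` as a sum of terms whose moduli add up to at most the loop gain
  have h1 : (1 : ℂ) = X - Y - I := by linear_combination h0
  have h2 : (1 : ℝ) ≤ ‖X‖ + ‖Y‖ + ‖I‖ := by
    calc (1 : ℝ) = ‖X - Y - I‖ := by rw [← h1, norm_one]
      _ ≤ ‖X - Y‖ + ‖I‖ := norm_sub_le _ _
      _ ≤ _ := add_le_add (norm_sub_le _ _) le_rfl
  unfold loopGain at hgain
  linarith

/-- The system with coefficients extended by zero from `[0,1]`. -/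
def HypSystem.cut (S : HypSystem) : HypSystem :=
  { S with
    sPM := (Icc (0 : ℝ) 1).indicator S.sPM
    sMP := (Icc (0 : ℝ) 1).indicator S.sMP }

/-- All hypotheses on coefficients and kernels concern `[0,1]` and the triangle, so that they
survive the extension by zero. -/
theorem IsBacksteppingKernel.isRegularPair (h : IsBacksteppingKernel S k) (hlam : 0 < S.lam)
    (hmu : 0 < S.mu) (hPM : Measurable S.sPM)
    (hPM_bdd : ∃ M : ℝ, ∀ x ∈ Icc (0 : ℝ) 1, |S.sPM x| ≤ M)
    (hMP : Measurable S.sMP) (hMP_bdd : ∃ M : ℝ, ∀ x ∈ Icc (0 : ℝ) 1, |S.sMP x| ≤ M) :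
    IsRegularPair S.cut k.cut := by
  have ce : ∀ (f : ℝ → ℝ → ℝ) x ξ, (x, ξ) ∈ triangle → f x ξ = cutTri f x ξ := fun f x ξ hx =>
    (cutTri_of_mem hx).symm
  have ci : ∀ (f : ℝ → ℝ) x, x ∈ Icc (0 : ℝ) 1 → (Icc (0 : ℝ) 1).indicator f x = f x :=
    fun f x hx => indicator_of_mem hx f
  have m1 : ∀ x ξ, (x, ξ) ∈ triangle → ξ ∈ Icc (0 : ℝ) 1 := fun x ξ hx =>
    ⟨hx.1, hx.2.1.trans hx.2.2⟩
  have md : ∀ x ∈ Icc (0 : ℝ) 1, (x, x) ∈ triangle := fun x hx => ⟨hx.1, le_rfl, hx.2⟩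
  have mb : ∀ x ∈ Icc (0 : ℝ) 1, (x, (0 : ℝ)) ∈ triangle := fun x hx => ⟨le_rfl, hx.1, hx.2⟩
  refine ⟨hlam, hmu, h.bddMeas.cut, indicator_bddMeas hPM hPM_bdd, indicator_bddMeas hMP hMP_bdd,
    ⟨⟨h.bddMeas.cut.uu.bddMeasKernel, h.bddMeas.cut.uv.bddMeasKernel,
      h.bddMeas.cut.vu.bddMeasKernel, h.bddMeas.cut.vv.bddMeasKernel⟩,
      h.eq_uu.congr (ce _) ?_, h.eq_uv.congr (ce _) ?_, h.eq_vu.congr (ce _) ?_,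
      h.eq_vv.congr (ce _) ?_, ?_, ?_, ?_, ?_⟩⟩
  · intro x ξ hx
    simp only [Kernels.cut, HypSystem.cut, cutTri_of_mem hx, ci _ _ (m1 x ξ hx)]
  · intro x ξ hx
    simp only [Kernels.cut, HypSystem.cut, cutTri_of_mem hx, ci _ _ (m1 x ξ hx)]
  · intro x ξ hx
    simp only [Kernels.cut, HypSystem.cut, cutTri_of_mem hx, ci _ _ (m1 x ξ hx)]
  · intro x ξ hx
    simp only [Kernels.cut, HypSystem.cut, cutTri_of_mem hx, ci _ _ (m1 x ξ hx)]
  · intro x hx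
    simp only [Kernels.cut, HypSystem.cut, cutTri_of_mem (md x hx), ci _ _ hx]
    exact h.diag_vu x hx
  · intro x hx
    simp only [Kernels.cut, HypSystem.cut, cutTri_of_mem (mb x hx)]
    exact h.bottom_vv x hx
  · intro x hx
    simp only [Kernels.cut, HypSystem.cut, cutTri_of_mem (md x hx), ci _ _ hx]
    exact h.diag_uv x hx
  · intro x hx
    simp only [Kernels.cut, HypSystem.cut, cutTri_of_mem (mb x hx)]
    exact h.bottom_uv x hx

theorem controlBS2_cut (S : HypSystem) (k : Kernels) (K : ℝ) :
    controlBS2 S.cut k.cut K = controlBS2 S k K := by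
  funext u₁ u v
  have hm : ∀ ξ ∈ Icc (0 : ℝ) 1, ((1 : ℝ), ξ) ∈ triangle := fun ξ hξ => ⟨hξ.1, hξ.2, le_rfl⟩
  unfold controlBS2
  congr 1
  · congr 2
    refine integral_congr_ae (ae_m01_of_forall fun ξ hξ => ?_)
    simp only [Kernels.cut, cutTri_of_mem (hm ξ hξ)]
  · refine integral_congr_ae (ae_m01_of_forall fun ξ hξ => ?_)
    simp only [Kernels.cut, cutTri_of_mem (hm ξ hξ)]

/-- Only the values of the coefficients on `[0,1]` enter the closed loop. -/
theorem isClosedLoopSolution_cut {𝒦 : Feedback} {δ : ℝ} {uI vI : StateL2} {hst : HistoryL2 δ}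
    {u v : ℝ → StateL2} {u0 u1 v0 v1 : ℝ → ℝ} :
    IsClosedLoopSolution S.cut 𝒦 δ uI vI hst u v u0 u1 v0 v1 ↔
      IsClosedLoopSolution S 𝒦 δ uI vI hst u v u0 u1 v0 v1 := by
  have e : ∀ (σ z φ : ℝ → ℝ) (F : ℝ → ℝ),
      ∫ x in Icc (0 : ℝ) 1, (F x + (Icc (0 : ℝ) 1).indicator σ x * z x * φ x) =
        ∫ x in Icc (0 : ℝ) 1, (F x + σ x * z x * φ x) := fun σ z φ F =>
    integral_congr_ae (ae_m01_of_forall fun x hx => by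
      beta_reduce
      rw [indicator_of_mem hx])
  constructor
  · intro h
    refine ⟨h.continuousOn_u, h.continuousOn_v, h.init_u, h.init_v, h.trace_u0, h.trace_u1,
      h.trace_v0, h.trace_v1, fun φ hφ t ht => ?_, fun φ hφ t ht => ?_, h.boundary_zero,
      h.boundary_one⟩
    · have := h.weak_u φ hφ t ht
      simpa only [HypSystem.cut, e] using this
    · have := h.weak_v φ hφ t ht
      simpa only [HypSystem.cut, e] using this
  · intro h
    refine ⟨h.continuousOn_u, h.continuousOn_v, h.init_u, h.init_v, h.trace_u0, h.trace_u1,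
      h.trace_v0, h.trace_v1, fun φ hφ t ht => ?_, fun φ hφ t ht => ?_, h.boundary_zero,
      h.boundary_one⟩
    · simpa only [HypSystem.cut, e] using h.weak_u φ hφ t ht
    · simpa only [HypSystem.cut, e] using h.weak_v φ hφ t ht

theorem stableWithDelay_cut {𝒦 : Feedback} {δ : ℝ} :
    StableWithDelay S.cut 𝒦 δ ↔ StableWithDelay S 𝒦 δ := by
  simp only [StableWithDelay, isClosedLoopSolution_cut]

end Hyperbolic

end

theorem mainTheorem3 (S : Hyperbolic.HypSystem)
    (hlam : 0 < S.lam) (hmu : 0 < S.mu) (hq : S.q ≠ 0)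
    (hPM : Measurable S.sPM) (hPM_bdd : ∃ M : ℝ, ∀ x ∈ Set.Icc (0 : ℝ) 1, |S.sPM x| ≤ M)
    (hMP : Measurable S.sMP) (hMP_bdd : ∃ M : ℝ, ∀ x ∈ Set.Icc (0 : ℝ) 1, |S.sMP x| ≤ M)
    (hgain : |S.rho * S.q| < 1)
    (K : ℝ) (hK : |K| < (1 - |S.rho * S.q|) / |S.q|) :
    (∃ k : Hyperbolic.Kernels, Hyperbolic.IsBacksteppingKernel S k) ∧
    ∀ k : Hyperbolic.Kernels, Hyperbolic.IsBacksteppingKernel S k →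
      Hyperbolic.DelayRobustlyStabilizes S (Hyperbolic.controlBS2 S k K) ∧
      (∃ l : Hyperbolic.Kernels, Hyperbolic.IsInverseKernel k l) ∧
      ∀ l : Hyperbolic.Kernels, Hyperbolic.IsInverseKernel k l →
        ∃ δ₀ : ℝ, 0 < δ₀ ∧ ∀ δ : ℝ, 0 ≤ δ → δ ≤ δ₀ →
          ∀ s : ℂ, 0 ≤ s.re → Hyperbolic.charFun S l K δ s ≠ 0 := by
  have hgain' : |S.q * S.rho| + |K * S.q| < 1 := by
    rw [lt_div_iff₀ (abs_pos.2 hq), ← abs_mul] at hK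
    rw [mul_comm S.q]
    linarith
  refine ⟨Hyperbolic.exists_backsteppingKernel S hlam hmu hq hPM hPM_bdd hMP hMP_bdd,
    fun k hk => ⟨?_, Hyperbolic.exists_inverseKernel hk.bddMeas, fun l hl => ?_⟩⟩
  · obtain ⟨l, hl⟩ := Hyperbolic.exists_inverseKernel hk.bddMeas
    have hreg := hk.isRegularPair hlam hmu hPM hPM_bdd hMP hMP_bdd
    have htri := hl.bddMeas.cut
    obtain ⟨δ₀, h0, hδ₀⟩ := Hyperbolic.exists_loopGain_lt_one (S := S.cut) hlam hmu htri hgain'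
    have key : ∀ δ : ℝ, 0 ≤ δ → δ ≤ δ₀ →
        Hyperbolic.StableWithDelay S (Hyperbolic.controlBS2 S k K) δ := by
      intro δ h1 h2
      rw [← Hyperbolic.stableWithDelay_cut, ← Hyperbolic.controlBS2_cut]
      exact hreg.stableWithDelay hq htri (hl.isResolvent hk.bddMeas) h1 (hδ₀ δ h1 h2)
    exact ⟨key 0 le_rfl h0.le, δ₀, h0, fun δ h1 h2 => key δ h1.le h2⟩
  · have htri := hl.bddMeas.cut
    obtain ⟨δ₀, h0, hδ₀⟩ := Hyperbolic.exists_loopGain_lt_one (S := S) hlam hmu htri hgain'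
    refine ⟨δ₀, h0, fun δ h1 h2 s hs => ?_⟩
    have := Hyperbolic.charFun_ne_zero hlam hmu htri h1 (hδ₀ δ h1 h2) hs
    rwa [Hyperbolic.charFun, Hyperbolic.Ntilde_cut hlam hmu] at this
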